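/- Let $f=\min_{a\in A}(c_a+a_1x_1+a_2x_2)$ be a tropical (min-plus) Laurent polynomial, where $A\subset\mathbb Z^2$ is finite and $c_a\in\mathbb R$. Its tropical plane curve $\Gamma$ is dual to the regular subdivision of the Newton polygon $P=\operatorname{conv}(A)$ induced by the heights $c_a$: the vertices of $\Gamma$ correspond to the two-dimensional cells, and two of them are joined by an edge if and only if the cells share an edge. The curve $\Gamma$ is *smooth* if $P$ is two-dimensional and the subdivision is a unimodular triangulation, i.e. every two-dimensional cell is a triangle of area $\tfrac12$. The *skeleton* of $\Gamma$ is the (multi)graph obtained from $\Gamma$ by removing all rays, iteratively contracting all $1$-valent vertices, and then smoothing over all $2$-valent vertices; it inherits a planar embedding from $\Gamma\subset\mathbb R^2$. A graph is *tropically planar* if it is isomorphic to the skeleton of some smooth tropical plane curve. For $n\ge 3$ the prism graph $C_n\square K_2$, of genus $g=n+1$, is the Cartesian product of a cycle of length $n$ with a single edge. Its *standard embedding* is the planar embedding with one of the two copies of $C_n$ drawn inside the other, up to combinatorial isomorphism of plane graphs (graph isomorphisms that carry face boundaries to face boundaries and the unbounded face to the unbounded face): the unbounded face is bounded by one copy of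 $C_n$, and the bounded faces are the one bounded by the other copy of $C_n$ and those bounded by the $4$-cycles $e\square K_2$, for $e$ an edge of $C_n$. **Theorem.** Let $n\ge 3$ and $g=n+1$. 1. The prism graph $C_n\square K_2$ is tropically planar if and only if $g\le 11$. 2. If $5\le g\le 11$, then for every smooth tropical plane curve whose skeleton is isomorphic to $C_n\square K_2$, the planar embedding that the skeleton inherits from the curve is the standard embedding. -/

import Mathlib

/-- A tropical (Laurent) polynomial in two variables over the min-plus semiring: the minimum over
the exponents `a ∈ support` of the affine functions `x ↦ coeff a + a.1 * x.1 + a.2 * x.2`.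
(Values of `coeff` outside `support` are irrelevant; there the tropical coefficient is `∞`.) -/
structure TropicalPolynomial where
  support : Finset (ℤ × ℤ)
  coeff : ℤ × ℤ → ℝ

namespace TropicalPolynomial

/-- The value at the point `x` of the monomial of `f` with exponent `a`. -/
def monomialValue (f : TropicalPolynomial) (a : ℤ × ℤ) (x : ℝ × ℝ) : ℝ :=
  f.coeff a + (a.1 : ℝ) * x.1 + (a.2 : ℝ) * x.2

/-- The exponents whose monomials attain the minimum at `x`. The convex hulls of these sets, as `x`
runs over the plane, are exactly the cells of the regular subdivision of the Newton polygon
`conv support` that is induced by the heights `coeff`. -/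
def cell (f : TropicalPolynomial) (x : ℝ × ℝ) : Set (ℤ × ℤ) :=
  {a | a ∈ f.support ∧ ∀ b ∈ f.support, f.monomialValue a x ≤ f.monomialValue b x}

end TropicalPolynomial

/-- Twice the signed area of the triangle with vertices `a`, `b`, `c`. -/
def doubleArea (a b c : ℤ × ℤ) : ℤ :=
  (b.1 - a.1) * (c.2 - a.2) - (b.2 - a.2) * (c.1 - a.1)

/-- A set of lattice points whose convex hull is two-dimensional. -/
def IsTwoDimensional (S : Set (ℤ × ℤ)) : Prop :=
  ∃ a ∈ S, ∃ b ∈ S, ∃ c ∈ S, doubleArea a b c ≠ 0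

namespace TropicalPolynomial

/-- The vertices of the tropical plane curve of `f`: the points dual to the two-dimensional cells of
the regular subdivision. -/
def curveVertices (f : TropicalPolynomial) : Set (ℝ × ℝ) :=
  {x | IsTwoDimensional (f.cell x)}

/-- The tropical plane curve of `f` is smooth: its Newton polygon is two-dimensional and the dual
regular subdivision is a unimodular triangulation, that is, every two-dimensional cell is a triangle
of area `1/2`. -/
def IsSmooth (f : TropicalPolynomial) : Prop :=
  IsTwoDimensional (f.support : Set (ℤ × ℤ)) ∧
    ∀ x ∈ f.curveVertices, ∃ a b c, f.cell x = {a, b, c} ∧ |doubleArea a b c| = 1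

/-- The bounded part of the tropical curve (all rays removed) as a graph in the plane: its vertices
are the vertices of the curve (other points of the plane are isolated), and two of them are joined
by an edge, which is the line segment between them, if and only if the dual two-dimensional cells
share an edge. -/
def curveGraph (f : TropicalPolynomial) : SimpleGraph (ℝ × ℝ) where
  Adj x y := x ≠ y ∧ x ∈ f.curveVertices ∧ y ∈ f.curveVertices ∧ (f.cell x ∩ f.cell y).Nontrivial
  symm := ⟨fun x y h => ⟨h.1.symm, h.2.2.1, h.2.1, by rw [Set.inter_comm]; exact h.2.2.2⟩⟩

/-- What is left of the vertices of the curve after `k` rounds of removing (contracting) all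
`1`-valent vertices. -/
def pruned (f : TropicalPolynomial) : ℕ → Set (ℝ × ℝ)
  | 0 => f.curveVertices
  | k + 1 => {x ∈ f.pruned k | ¬ ∃! y, y ∈ f.pruned k ∧ f.curveGraph.Adj x y}

/-- The vertices that survive the iterated removal of `1`-valent vertices. -/
def coreVertices (f : TropicalPolynomial) : Set (ℝ × ℝ) :=
  {x | ∀ k, x ∈ f.pruned k}

/-- The graph that is left after removing all rays and iteratively contracting all `1`-valent
vertices. -/
def coreGraph (f : TropicalPolynomial) : SimpleGraph (ℝ × ℝ) where
  Adj x y := x ∈ f.coreVertices ∧ y ∈ f.coreVertices ∧ f.curveGraph.Adj x y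
  symm := ⟨fun _ _ h => ⟨h.2.1, h.1, h.2.2.symm⟩⟩

/-- The `2`-valent vertices of the core; they are smoothed over in the skeleton. -/
def IsTwoValent (f : TropicalPolynomial) (x : ℝ × ℝ) : Prop :=
  (f.coreGraph.neighborSet x).ncard = 2

/-- The vertices of the skeleton. -/
def skeletonVertices (f : TropicalPolynomial) : Set (ℝ × ℝ) :=
  {x ∈ f.coreVertices | ¬ f.IsTwoValent x}

/-- `e` is the set of edges of a chain of core edges that leads from the skeleton vertex `u` to the
skeleton vertex `v` through `2`-valent vertices only. Such chains become the edges of the skeleton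
when the `2`-valent vertices are smoothed over. -/
def IsChain (f : TropicalPolynomial) (e : Set (Sym2 (ℝ × ℝ))) (u v : ℝ × ℝ) : Prop :=
  u ∈ f.skeletonVertices ∧ v ∈ f.skeletonVertices ∧
    ∃ p : f.coreGraph.Walk u v, p.IsTrail ∧ 0 < p.length ∧
      (∀ w ∈ p.support.tail.dropLast, f.IsTwoValent w) ∧ e = {d | d ∈ p.edges}

theorem IsChain.symm {f : TropicalPolynomial} {e : Set (Sym2 (ℝ × ℝ))} {u v : ℝ × ℝ}
    (h : f.IsChain e u v) : f.IsChain e v u := by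
  obtain ⟨hu, hv, p, hp, hl, hi, he⟩ := h
  refine ⟨hv, hu, p.reverse, hp.reverse, by simpa using hl, ?_, by simp [he]⟩
  intro w hw
  apply hi
  rw [SimpleGraph.Walk.support_reverse, List.tail_reverse, List.dropLast_reverse,
    List.mem_reverse, List.tail_dropLast] at hw
  exact hw

theorem IsChain.left_eq_or_eq {f : TropicalPolynomial} {e : Set (Sym2 (ℝ × ℝ))}
    {u v x y : ℝ × ℝ} (h : f.IsChain e u v) (h' : f.IsChain e x y) : u = x ∨ u = y := by
  obtain ⟨hu, -, p, -, hl, -, he⟩ := h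
  obtain ⟨-, -, q, -, -, hi, he'⟩ := h'
  have hq : u ∈ q.support := by
    cases p with
    | nil => simp at hl
    | @cons _ w _ hadj p' =>
      have h1 : s(u, w) ∈ e := by rw [he]; simp
      rw [he'] at h1
      exact q.fst_mem_support_of_mem_edges h1
  rw [← q.cons_tail_support] at hq
  rcases List.mem_cons.1 hq with h | h
  · exact Or.inl h
  · right
    have hne : q.support.tail ≠ [] := List.ne_nil_of_mem h
    by_contra hy
    refine hu.2 (hi u ?_)
    rw [← List.dropLast_append_getLast hne] at h
    rcases List.mem_append.1 h with h | h
    · exact h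
    · rw [List.mem_singleton, List.getLast_tail] at h
      exact absurd (h.trans (q.getLast_support)) hy

/-- The skeleton of the tropical curve of `f`, as an abstract multigraph (loops and parallel edges
may occur): remove all rays, iteratively contract all `1`-valent vertices, and smooth over all
`2`-valent vertices. An edge is recorded as the set of the edges of the curve that it consists of. -/
def skeleton (f : TropicalPolynomial) : Graph (ℝ × ℝ) (Set (Sym2 (ℝ × ℝ))) where
  vertexSet := f.skeletonVertices
  IsLink := f.IsChain
  isLink_symm _ _ := ⟨fun _ _ h => h.symm⟩
  eq_or_eq_of_isLink_of_isLink _ _ _ _ _ h h' := h.left_eq_or_eq h'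
  left_mem_of_isLink _ _ _ h := h.1

/-- The simple graph `G` is the skeleton of the tropical curve of `f`: the skeleton has no loops and
no parallel edges, and it is isomorphic to `G`. -/
def HasSkeleton {V : Type*} (f : TropicalPolynomial) (G : SimpleGraph V) : Prop :=
  f.skeleton.Simple ∧ Nonempty (f.skeleton.toSimpleGraph ≃g G)

/-- The subset of the tropical curve that is a subdivided copy of the skeleton, embedded in the
plane. -/
def skeletonSupport (f : TropicalPolynomial) : Set (ℝ × ℝ) :=
  {z | ∃ x y, f.coreGraph.Adj x y ∧ z ∈ segment ℝ x y}

/-- The faces of the planar embedding that the skeleton inherits from the tropical curve: the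
connected components of the complement of the embedded skeleton. -/
def IsFace (f : TropicalPolynomial) (F : Set (ℝ × ℝ)) : Prop :=
  ∃ p ∈ f.skeletonSupportᶜ, F = connectedComponentIn f.skeletonSupportᶜ p

end TropicalPolynomial

/-- A simple graph is tropically planar if it is the skeleton of some smooth tropical plane
curve. -/
def TropicallyPlanar {V : Type*} (G : SimpleGraph V) : Prop :=
  ∃ f : TropicalPolynomial, f.IsSmooth ∧ f.HasSkeleton G

/-- The prism graph `C_n □ K_2`, of genus `n + 1`. -/
def prismGraph (n : ℕ) : SimpleGraph (Fin n × Fin 2) :=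
  (SimpleGraph.cycleGraph n).boxProd (SimpleGraph.completeGraph (Fin 2))

/-- For an identification `φ` of the skeleton with a graph `G`, the vertices of `G` on the boundary
of the plane region `F`. -/
def boundaryVertices {V : Type*} {G : SimpleGraph V} {f : TropicalPolynomial}
    (φ : f.skeleton.toSimpleGraph ≃g G) (F : Set (ℝ × ℝ)) : Set V :=
  {v | ((φ.symm v : f.skeleton.vertexSet) : ℝ × ℝ) ∈ frontier F}

/-- The planar embedding that the skeleton inherits from the tropical curve of `f` is the standard
embedding of the prism graph (one `n`-cycle drawn inside the other one, with matching vertices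
joined): the skeleton can be identified with the prism graph so that the unbounded face is bounded by
one of the two copies of `C_n`, and the bounded faces are the one bounded by the other copy of `C_n`
and those bounded by the `4`-cycles over the edges of `C_n`. -/
def InheritsStandardEmbedding (f : TropicalPolynomial) (n : ℕ) : Prop :=
  f.skeleton.Simple ∧
  ∃ φ : f.skeleton.toSimpleGraph ≃g prismGraph n,
    (∀ F, f.IsFace F → ¬ Bornology.IsBounded F → boundaryVertices φ F = {v | v.2 = 1}) ∧
    {s | ∃ F, f.IsFace F ∧ Bornology.IsBounded F ∧ boundaryVertices φ F = s} =
      insert {v | v.2 = 0}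
        {s | ∃ i j, (SimpleGraph.cycleGraph n).Adj i j ∧ s = {v | v.1 = i ∨ v.1 = j}}

/-! Duality turns the theorem into a question about lattice polygons. Every lattice point in the
interior of the Newton polygon of a smooth curve is a vertex of the triangulation
(`IsSmooth.exists_vertex_of_interior`), and it is dual to a bounded region of the complement of the
curve.

For `n ≥ 4` the prism graph has `n + 2` peripheral cycles (induced cycles with connected
complement): the two `n`-cycles and the `n` quadrilaterals. As in the uniqueness theorem for planar
embeddings, each of them must bound a face. The proof is a parity argument. A subgraph of the curve
with even degrees is the boundary of a set of regions (`IsSmooth.exists_potential`); for a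
peripheral cycle this set is a single bounded region or all of them (`IsSmooth.peripheral`); and
because the cycles cover each edge twice, exactly one of them bounds the outer face while the others
correspond to the interior lattice points (`IsSmooth.exists_outer`). The interior points and the
unimodular triangles at them are thus known once the outer cycle is known.

Suppose first that a quadrilateral is the outer cycle and `n ≥ 5`. The interior points then are a
path of `n - 1` points and two points joined to the whole path from its two sides. Unimodularity
makes the path straight or bent at one point, and in either case some interior point is forced to
the boundary (`IsPrismLabelling.ne_inl`). For `n = 4` the prism is the cube, whose symmetries make
all six cycles equivalent. So the embedding is standard.

Suppose next that an `n`-cycle is the outer cycle. The interior points then are one centre and `n`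
points around it that span a complete fan of unimodular cones. In such a fan all nonzero interior
points are primitive, which bounds the coefficients of the fan by 3 in absolute value and the runs
of collinear points; moreover two adjacent edges of the interior polygon, moved outwards by one
step, must meet in a lattice point. A finite search over the coefficients leaves no fan with `n ≥
11` (`IsFan.lt_eleven`).

Conversely, for `3 ≤ n ≤ 10` an explicit triangulation with integer heights is given for each `n`. A
simplex argument (`curveVertices_subset_of_closed`) shows that a list of unimodular cells closed
under adjacency contains all vertices of the curve, so that smoothness and the shape of the skeleton
become finite computations (`PrismData.tropicallyPlanar`). -/

namespace TropicalPolynomial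

/-! ### Cells of a tropical polynomial along lines -/

/-- The pairing of an exponent with a direction in the plane. -/
def dot (a : ℤ × ℤ) (d : ℝ × ℝ) : ℝ := (a.1 : ℝ) * d.1 + (a.2 : ℝ) * d.2

/-- The direction of the edges of the curve that are dual to the segment from `a` to `b`. -/
def edgeDir (a b : ℤ × ℤ) : ℝ × ℝ := (-((b.2 : ℝ) - a.2), (b.1 : ℝ) - a.1)

/-- Along `edgeDir a b` the monomial of `c` changes relative to that of `a` at the rate of the
signed area. So orientations decide which exponents take over when an edge is followed: those of
negative area. -/
theorem dot_edgeDir (a b c : ℤ × ℤ) :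
    dot c (edgeDir a b) - dot a (edgeDir a b) = (doubleArea a b c : ℝ) := by
  simp only [dot, edgeDir, doubleArea]; push_cast; ring

theorem dot_edgeDir_right (a b : ℤ × ℤ) : dot b (edgeDir a b) = dot a (edgeDir a b) := by
  simp only [dot, edgeDir]; ring

theorem monomialValue_add (f : TropicalPolynomial) (a : ℤ × ℤ) (x d : ℝ × ℝ) (t : ℝ) :
    f.monomialValue a (x + t • d) = f.monomialValue a x + t * dot a d := by
  simp only [monomialValue, dot, Prod.fst_add, Prod.snd_add, Prod.smul_fst, Prod.smul_snd,
    smul_eq_mul]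
  ring

theorem monomialValue_eq_dot (f : TropicalPolynomial) (a : ℤ × ℤ) (x : ℝ × ℝ) :
    f.monomialValue a x = f.coeff a + dot a x := by
  simp only [monomialValue, dot]; ring

variable {f : TropicalPolynomial}

theorem cell_subset (f : TropicalPolynomial) (x : ℝ × ℝ) : f.cell x ⊆ f.support := fun _ h => h.1

theorem finite_cell (f : TropicalPolynomial) (x : ℝ × ℝ) : (f.cell x).Finite :=
  f.support.finite_toSet.subset (cell_subset f x)

theorem value_eq_of_mem_cell {a b : ℤ × ℤ} {x : ℝ × ℝ} (ha : a ∈ f.cell x) (hb : b ∈ f.cell x) :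
    f.monomialValue a x = f.monomialValue b x := le_antisymm (ha.2 b hb.1) (hb.2 a ha.1)

theorem lt_value_of_notMem_cell {a b : ℤ × ℤ} {x : ℝ × ℝ} (ha : a ∈ f.cell x)
    (hb : b ∈ f.support) (hb' : b ∉ f.cell x) : f.monomialValue a x < f.monomialValue b x := by
  by_contra h
  exact hb' ⟨hb, fun c hc => (not_lt.1 h).trans (ha.2 c hc)⟩

theorem mem_cell_of_value_eq {a b : ℤ × ℤ} {x : ℝ × ℝ} (ha : a ∈ f.cell x)
    (hb : b ∈ f.support) (h : f.monomialValue b x = f.monomialValue a x) : b ∈ f.cell x :=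
  ⟨hb, fun c hc => h.le.trans (ha.2 c hc)⟩

theorem cell_nonempty (hS : f.support.Nonempty) (x : ℝ × ℝ) : (f.cell x).Nonempty := by
  obtain ⟨a, ha, h⟩ := f.support.exists_min_image (fun a => f.monomialValue a x) hS
  exact ⟨a, ha, h⟩

theorem IsTwoDimensional.nonempty_support (h : IsTwoDimensional (f.support : Set (ℤ × ℤ))) :
    f.support.Nonempty := by
  obtain ⟨a, ha, -⟩ := h
  exact ⟨a, ha⟩

/-- The cell after a move for which no new exponent becomes minimal. -/
theorem cell_add_smul {a : ℤ × ℤ} {x d : ℝ × ℝ} {t : ℝ} (ha : a ∈ f.cell x) (ht : 0 < t)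
    (hle : ∀ b ∈ f.cell x, dot a d ≤ dot b d)
    (hlt : ∀ e ∈ f.support, e ∉ f.cell x →
      f.monomialValue a x + t * dot a d < f.monomialValue e x + t * dot e d) :
    f.cell (x + t • d) = {b ∈ f.cell x | dot b d = dot a d} := by
  have key : a ∈ f.cell (x + t • d) := by
    refine ⟨ha.1, fun e he => ?_⟩
    rw [monomialValue_add, monomialValue_add]
    by_cases hc : e ∈ f.cell x
    · rw [value_eq_of_mem_cell ha hc]
      have := mul_le_mul_of_nonneg_left (hle e hc) ht.le
      linarith
    · exact (hlt e he hc).le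
  ext b
  constructor
  · intro hb
    have h1 := value_eq_of_mem_cell hb key
    rw [monomialValue_add, monomialValue_add] at h1
    by_cases hc : b ∈ f.cell x
    · refine ⟨hc, ?_⟩
      rw [value_eq_of_mem_cell hc ha] at h1
      have : t * dot b d = t * dot a d := by linarith
      exact mul_left_cancel₀ ht.ne' this
    · have := hlt b hb.1 hc
      linarith
  · rintro ⟨hb, hd⟩
    refine mem_cell_of_value_eq key hb.1 ?_
    rw [monomialValue_add, monomialValue_add, hd, value_eq_of_mem_cell hb ha]

/-- Moving in a direction in which some exponent decreases relative to the cell, a new exponent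
becomes minimal after a finite time. -/
theorem exists_cell_change {a e₀ : ℤ × ℤ} {x d : ℝ × ℝ} (ha : a ∈ f.cell x)
    (hle : ∀ b ∈ f.cell x, dot a d ≤ dot b d) (he₀ : e₀ ∈ f.support) (h₀ : dot e₀ d < dot a d) :
    ∃ τ : ℝ, 0 < τ ∧ (∃ e ∈ f.cell (x + τ • d), dot e d < dot a d) ∧
      (∀ b ∈ f.cell x, dot b d = dot a d → b ∈ f.cell (x + τ • d)) ∧
      ∀ t, 0 < t → t < τ → f.cell (x + t • d) = {b ∈ f.cell x | dot b d = dot a d} := by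
  classical
  set F := f.support.filter (fun e => dot e d < dot a d) with hF
  have hFn : F.Nonempty := ⟨e₀, by simp [hF, he₀, h₀]⟩
  -- The quotient is the time at which an exponent catches up with `a`; the earliest such time is
  -- `τ`.
  obtain ⟨e, heF, hmin⟩ := F.exists_min_image
    (fun e => (f.monomialValue e x - f.monomialValue a x) / (dot a d - dot e d)) hFn
  have hF' : ∀ b ∈ F, b ∈ f.support ∧ dot b d < dot a d := fun b hb => by simpa [hF] using hb
  have hnot : ∀ b ∈ F, b ∉ f.cell x := fun b hb hc => by
    have := hle b hc
    linarith [(hF' b hb).2]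
  have hgap : ∀ b ∈ F, 0 < f.monomialValue b x - f.monomialValue a x := fun b hb => by
    linarith [lt_value_of_notMem_cell ha (hF' b hb).1 (hnot b hb)]
  set τ := (f.monomialValue e x - f.monomialValue a x) / (dot a d - dot e d) with hτ
  have hpos : 0 < dot a d - dot e d := by linarith [(hF' e heF).2]
  have hτ0 : 0 < τ := div_pos (hgap e heF) hpos
  have hge : ∀ t, 0 < t → t ≤ τ → ∀ b ∈ f.support, 
      f.monomialValue a x + t * dot a d ≤ f.monomialValue b x + t * dot b d := by
    intro t ht htτ b hb
    by_cases hbF : dot b d < dot a d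
    · have hbF' : b ∈ F := by simp [hF, hb, hbF]
      have h1 := htτ.trans (hmin b hbF')
      rw [le_div_iff₀ (by linarith)] at h1
      linarith
    · have := ha.2 b hb
      nlinarith [not_lt.1 hbF]
  have haτ : a ∈ f.cell (x + τ • d) := by
    refine ⟨ha.1, fun b hb => ?_⟩
    rw [monomialValue_add, monomialValue_add]
    exact hge τ hτ0 le_rfl b hb
  refine ⟨τ, hτ0, ⟨e, ?_, (hF' e heF).2⟩, ?_, ?_⟩
  · refine mem_cell_of_value_eq haτ (hF' e heF).1 ?_
    rw [monomialValue_add, monomialValue_add]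
    have : τ * (dot a d - dot e d) = f.monomialValue e x - f.monomialValue a x :=
      div_mul_cancel₀ _ hpos.ne'
    linarith
  · intro b hb hbd
    refine mem_cell_of_value_eq haτ hb.1 ?_
    rw [monomialValue_add, monomialValue_add, hbd, value_eq_of_mem_cell hb ha]
  · intro t ht htτ
    refine cell_add_smul ha ht hle ?_
    intro b hb hbc
    by_cases hbF : dot b d < dot a d
    · have hbF' : b ∈ F := by simp [hF, hb, hbF]
      have h1 := htτ.trans_le (hmin b hbF')
      rw [lt_div_iff₀ (by linarith)] at h1
      linarith
    · have := lt_value_of_notMem_cell ha hb hbc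
      nlinarith [not_lt.1 hbF]

/-- Moving in a direction in which no exponent decreases relative to the cell. -/
theorem cell_ray {a : ℤ × ℤ} {x d : ℝ × ℝ} (ha : a ∈ f.cell x)
    (hle : ∀ b ∈ f.support, dot a d ≤ dot b d) {t : ℝ} (ht : 0 < t) :
    f.cell (x + t • d) = {b ∈ f.cell x | dot b d = dot a d} := by
  refine cell_add_smul ha ht (fun b hb => hle b hb.1) fun e he hc => ?_
  have := lt_value_of_notMem_cell ha he hc
  nlinarith [hle e he]

theorem edgeDir_ne_zero {a b : ℤ × ℤ} (h : a ≠ b) : edgeDir a b ≠ 0 := by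
  intro h0
  apply h
  simp only [edgeDir, Prod.mk_eq_zero, neg_eq_zero, sub_eq_zero, Int.cast_inj] at h0
  exact Prod.ext h0.2.symm h0.1.symm

/-- Two points that share two exponents of their cells differ by a multiple of the direction of the
dual edge. -/
theorem exists_eq_add_smul_edgeDir {a b : ℤ × ℤ} {x y : ℝ × ℝ} (hab : a ≠ b) (hax : a ∈ f.cell x)
    (hbx : b ∈ f.cell x) (hay : a ∈ f.cell y) (hby : b ∈ f.cell y) :
    ∃ t : ℝ, y = x + t • edgeDir a b := by
  have h1 := value_eq_of_mem_cell hax hbx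
  have h2 := value_eq_of_mem_cell hay hby
  simp only [monomialValue] at h1 h2
  set u : ℝ := (b.1 : ℝ) - a.1 with hu
  set v : ℝ := (b.2 : ℝ) - a.2 with hv
  have h3 : u * (y.1 - x.1) + v * (y.2 - x.2) = 0 := by simp only [hu, hv]; linarith
  have hne : u ^ 2 + v ^ 2 ≠ 0 := by
    intro h0
    have hu0 : u = 0 := by nlinarith [sq_nonneg u, sq_nonneg v]
    have hv0 : v = 0 := by nlinarith [sq_nonneg u, sq_nonneg v]
    rw [hu, sub_eq_zero, Int.cast_inj] at hu0
    rw [hv, sub_eq_zero, Int.cast_inj] at hv0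
    exact hab (Prod.ext hu0.symm hv0.symm)
  -- By `h3` the displacement is orthogonal to `b - a`; the coefficient is its projection to the
  -- perpendicular `(-v, u)`.
  refine ⟨(-v * (y.1 - x.1) + u * (y.2 - x.2)) / (u ^ 2 + v ^ 2), Prod.ext ?_ ?_⟩
  · simp only [edgeDir, Prod.fst_add, Prod.smul_fst, smul_eq_mul, ← hv]
    field_simp
    linear_combination u * h3
  · simp only [edgeDir, Prod.snd_add, Prod.smul_snd, smul_eq_mul, ← hu]
    field_simp
    linear_combination v * h3

theorem doubleArea_ne_zero_left {a b c : ℤ × ℤ} (h : doubleArea a b c ≠ 0) : a ≠ b := by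
  rintro rfl
  simp [doubleArea] at h

/-- Two vertices on a common edge lie on different sides of it. -/
theorem doubleArea_mul_neg {a b c e : ℤ × ℤ} {x y : ℝ × ℝ} (hxy : x ≠ y) (hax : a ∈ f.cell x)
    (hbx : b ∈ f.cell x) (hay : a ∈ f.cell y) (hby : b ∈ f.cell y) (hc : c ∈ f.cell x)
    (he : e ∈ f.cell y) (hc0 : doubleArea a b c ≠ 0) (he0 : doubleArea a b e ≠ 0) :
    doubleArea a b c * doubleArea a b e < 0 := by
  obtain ⟨t, ht⟩ := exists_eq_add_smul_edgeDir (doubleArea_ne_zero_left hc0) hax hbx hay hby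
  have ht0 : t ≠ 0 := by
    rintro rfl
    simp at ht
    exact hxy ht.symm
  have h1 : 0 ≤ t * (doubleArea a b c : ℝ) := by
    have h := hay.2 c hc.1
    rw [ht, monomialValue_add, monomialValue_add, value_eq_of_mem_cell hax hc] at h
    rw [← dot_edgeDir]; linarith
  have h2 : t * (doubleArea a b e : ℝ) ≤ 0 := by
    have h := hax.2 e he.1
    have h' := value_eq_of_mem_cell hay he
    rw [ht, monomialValue_add, monomialValue_add] at h'
    rw [← dot_edgeDir]; linarith
  have hc0' : (doubleArea a b c : ℝ) ≠ 0 := by exact_mod_cast hc0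
  have he0' : (doubleArea a b e : ℝ) ≠ 0 := by exact_mod_cast he0
  have h3 : (doubleArea a b c : ℝ) * doubleArea a b e < 0 := by
    have h4 : 0 < t * (doubleArea a b c : ℝ) := lt_of_le_of_ne h1 (mul_ne_zero ht0 hc0').symm
    have h5 : t * (doubleArea a b e : ℝ) < 0 := lt_of_le_of_ne h2 (mul_ne_zero ht0 he0')
    have h6 := mul_neg_of_pos_of_neg h4 h5
    have h7 : 0 < t ^ 2 := by positivity
    by_contra hcon
    nlinarith [not_lt.1 hcon]
  exact_mod_cast h3

/-- A point is determined by three non-collinear exponents of its cell. -/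
theorem eq_of_mem_cells {a b c : ℤ × ℤ} {x y : ℝ × ℝ} (h : doubleArea a b c ≠ 0)
    (hax : a ∈ f.cell x) (hbx : b ∈ f.cell x) (hcx : c ∈ f.cell x) (hay : a ∈ f.cell y)
    (hby : b ∈ f.cell y) (hcy : c ∈ f.cell y) : x = y := by
  by_contra hxy
  have := doubleArea_mul_neg hxy hax hbx hay hby hcx hcy h h
  nlinarith [mul_self_nonneg (doubleArea a b c)]

end TropicalPolynomial

/-! ### Unimodular cells and the simplex method -/

theorem doubleArea_rotate (a b c : ℤ × ℤ) : doubleArea b c a = doubleArea a b c := by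
  simp only [doubleArea]; ring

theorem doubleArea_swap (a b c : ℤ × ℤ) : doubleArea b a c = -doubleArea a b c := by
  simp only [doubleArea]; ring

theorem doubleArea_swap' (a b c : ℤ × ℤ) : doubleArea a c b = -doubleArea a b c := by
  simp only [doubleArea]; ring

@[simp] theorem doubleArea_self_left (a b : ℤ × ℤ) : doubleArea a b a = 0 := by
  simp [doubleArea]

theorem ne_of_doubleArea_ne_zero {a b c : ℤ × ℤ} (h : doubleArea a b c ≠ 0) :
    a ≠ b ∧ b ≠ c ∧ a ≠ c := by
  refine ⟨?_, ?_, ?_⟩ <;> rintro rfl <;> simp [doubleArea] at h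
  exact h (by ring)

namespace TropicalPolynomial

variable {f : TropicalPolynomial}

/-- The cell of `x` is a unimodular triangle. -/
def IsUnimodularAt (f : TropicalPolynomial) (x : ℝ × ℝ) : Prop :=
  ∃ a b c, f.cell x = {a, b, c} ∧ |doubleArea a b c| = 1

theorem IsUnimodularAt.mem_curveVertices {x : ℝ × ℝ} (h : f.IsUnimodularAt x) :
    x ∈ f.curveVertices := by
  obtain ⟨a, b, c, hx, hd⟩ := h
  refine ⟨a, by simp [hx], b, by simp [hx], c, by simp [hx], ?_⟩
  intro h0
  simp [h0] at hd

/-- The triangle can be oriented positively, beginning with a given edge. -/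
theorem IsUnimodularAt.exists_third {x : ℝ × ℝ} (h : f.IsUnimodularAt x) {a b : ℤ × ℤ}
    (ha : a ∈ f.cell x) (hb : b ∈ f.cell x) (hab : a ≠ b) :
    ∃ c, f.cell x = {a, b, c} ∧ |doubleArea a b c| = 1 := by
  obtain ⟨p, q, r, hx, hd⟩ := h
  rw [hx] at ha hb
  have hr : |doubleArea q r p| = 1 := by rw [doubleArea_rotate]; exact hd
  have hr' : |doubleArea r p q| = 1 := by rw [doubleArea_rotate]; exact hr
  have hs : ∀ u v w : ℤ × ℤ, |doubleArea u v w| = 1 → |doubleArea v u w| = 1 := fun u v w h => by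
    rw [doubleArea_swap, abs_neg]; exact h
  simp only [Set.mem_insert_iff, Set.mem_singleton_iff] at ha hb
  rcases ha with rfl | rfl | rfl <;> rcases hb with rfl | rfl | rfl
  · exact absurd rfl hab
  · exact ⟨r, hx, hd⟩
  · exact ⟨q, by rw [hx]; ext; simp; tauto, hs _ _ _ hr'⟩
  · exact ⟨r, by rw [hx]; ext; simp; tauto, hs _ _ _ hd⟩
  · exact absurd rfl hab
  · exact ⟨p, by rw [hx]; ext; simp; tauto, hr⟩
  · exact ⟨q, by rw [hx]; ext; simp; tauto, hr'⟩
  · exact ⟨p, by rw [hx]; ext; simp; tauto, hs _ _ _ hr⟩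
  · exact absurd rfl hab

theorem IsUnimodularAt.exists_others {x : ℝ × ℝ} (h : f.IsUnimodularAt x) {a : ℤ × ℤ}
    (ha : a ∈ f.cell x) : ∃ b c, f.cell x = {a, b, c} ∧ doubleArea a b c = 1 := by
  have : ∃ b ∈ f.cell x, a ≠ b := by
    obtain ⟨p, q, r, hx, hd⟩ := h
    by_cases hp : a = p
    · refine ⟨q, by simp [hx], ?_⟩
      rintro rfl
      subst hp
      simp [doubleArea] at hd
    · exact ⟨p, by simp [hx], hp⟩
  obtain ⟨b, hb, hab⟩ := this
  obtain ⟨c, hc, hd⟩ := h.exists_third ha hb hab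
  rcases (abs_eq zero_le_one).1 hd with h | h
  · exact ⟨b, c, hc, h⟩
  · refine ⟨c, b, by rw [hc]; ext; simp; tauto, ?_⟩
    rw [doubleArea_swap', h, neg_neg]

/-- An edge of the curve with exponents on both sides ends in a vertex. -/
theorem exists_edge_end {a b c e₀ : ℤ × ℤ} {x : ℝ × ℝ} (hx : f.cell x = {a, b, c})
    (hc : 0 < doubleArea a b c) (he₀ : e₀ ∈ f.support) (h₀ : doubleArea a b e₀ < 0) :
    ∃ τ : ℝ, 0 < τ ∧ a ∈ f.cell (x + τ • edgeDir a b) ∧ b ∈ f.cell (x + τ • edgeDir a b) ∧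
      (∃ e ∈ f.cell (x + τ • edgeDir a b), doubleArea a b e < 0) ∧
      ∀ t, 0 < t → t < τ → f.cell (x + t • edgeDir a b) = {a, b} := by
  have ha : a ∈ f.cell x := by simp [hx]
  have hb : b ∈ f.cell x := by simp [hx]
  have hd : ∀ e, (doubleArea a b e < 0 ↔ dot e (edgeDir a b) < dot a (edgeDir a b)) := by
    intro e
    rw [← sub_neg (a := dot e (edgeDir a b)), dot_edgeDir]
    exact_mod_cast Iff.rfl
  have hcd : dot a (edgeDir a b) < dot c (edgeDir a b) := by
    rw [← sub_pos, dot_edgeDir]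
    exact_mod_cast hc
  have hbd := dot_edgeDir_right a b
  have hset : {b' ∈ f.cell x | dot b' (edgeDir a b) = dot a (edgeDir a b)} = {a, b} := by
    rw [hx]
    ext u
    simp only [Set.mem_insert_iff, Set.mem_singleton_iff, Set.mem_ofPred_eq]
    constructor
    · rintro ⟨rfl | rfl | rfl, h⟩
      · simp
      · simp
      · exact absurd h hcd.ne'
    · rintro (rfl | rfl)
      · simp
      · simp [hbd]
  obtain ⟨τ, hτ, ⟨e, he, hed⟩, hold, hlt⟩ := exists_cell_change ha
    (by
      rw [hx]
      rintro u (rfl | rfl | rfl)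
      · exact le_rfl
      · exact hbd.ge
      · exact hcd.le) he₀ ((hd e₀).1 h₀)
  refine ⟨τ, hτ, hold a ha rfl, hold b hb hbd, ⟨e, he, (hd e).2 hed⟩, fun t h1 h2 => ?_⟩
  rw [hlt t h1 h2, hset]

/-- Cramer's rule with determinant 1, hence integral coordinates. The total weight `m` is 3 for a
sum of three exponents and 1 for a single lattice point. -/
theorem exists_barycentric {a b c : ℤ × ℤ} (h : doubleArea a b c = 1) (t : ℤ × ℤ) (m : ℤ) :
    ∃ u v w : ℤ, u = m - v - w ∧
      v = (c.2 - a.2) * (t.1 - m * a.1) - (c.1 - a.1) * (t.2 - m * a.2) ∧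
      w = (b.1 - a.1) * (t.2 - m * a.2) - (b.2 - a.2) * (t.1 - m * a.1) ∧
      t.1 = u * a.1 + v * b.1 + w * c.1 ∧ t.2 = u * a.2 + v * b.2 + w * c.2 := by
  refine ⟨_, _, _, rfl, rfl, rfl, ?_, ?_⟩
  · simp only [doubleArea] at h
    linear_combination (-(t.1 - m * a.1)) * h
  · simp only [doubleArea] at h
    linear_combination (-(t.2 - m * a.2)) * h

/-- The objective function of the simplex method: for an element `a₀` of the cell of `x` this is
three times the difference between the tropical polynomial and the linear function given by the
barycenter of a triangle. -/
theorem objective_le {x y : ℝ × ℝ} {p q r a b c : ℤ × ℤ} (hy : {p, q, r} ⊆ f.cell y)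
    (hx : {a, b, c} ⊆ f.cell x) :
    3 * f.monomialValue p y - (dot p y + dot q y + dot r y) ≥
      3 * f.monomialValue a x - (dot p x + dot q x + dot r x) ∧
    (3 * f.monomialValue p y - (dot p y + dot q y + dot r y) ≤
      3 * f.monomialValue a x - (dot p x + dot q x + dot r x) → {p, q, r} ⊆ f.cell x) := by
  simp only [Set.insert_subset_iff, Set.singleton_subset_iff] at hy hx ⊢
  obtain ⟨hp, hq, hr⟩ := hy
  obtain ⟨ha, hb, hc⟩ := hx
  have e1 := value_eq_of_mem_cell hp hq
  have e2 := value_eq_of_mem_cell hp hr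
  have i1 := ha.2 p hp.1
  have i2 := ha.2 q hq.1
  have i3 := ha.2 r hr.1
  have s1 := fun h => mem_cell_of_value_eq (b := p) ha hp.1 h
  have s2 := fun h => mem_cell_of_value_eq (b := q) ha hq.1 h
  have s3 := fun h => mem_cell_of_value_eq (b := r) ha hr.1 h
  simp only [monomialValue_eq_dot] at *
  refine ⟨by linarith, fun h => ⟨s1 (by linarith), s2 (by linarith), s3 (by linarith)⟩⟩

/-- The simplex method: a finite nonempty set of points with unimodular cells that contains, with
a point, the other end of each edge that ends there, contains all vertices of the curve. -/
theorem curveVertices_subset_of_closed {L : Set (ℝ × ℝ)} (hfin : L.Finite) (hne : L.Nonempty)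
    (huni : ∀ x ∈ L, f.IsUnimodularAt x)
    (hclosed : ∀ x ∈ L, ∀ a b c e, f.cell x = {a, b, c} → e ∈ f.support →
      doubleArea a b c = 1 → doubleArea a b e < 0 →
      ∃ y ∈ L, y ≠ x ∧ a ∈ f.cell y ∧ b ∈ f.cell y) :
    f.curveVertices ⊆ L := by
  rintro y ⟨p, hp, q, hq, r, hr, hpqr⟩
  set H : ℝ × ℝ → ℝ := fun x => 3 * sInf ((fun a => f.monomialValue a x) '' f.cell x) -
    (dot p x + dot q x + dot r x) with hH
  have hHeq : ∀ x, ∀ a ∈ f.cell x, H x =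
      3 * f.monomialValue a x - (dot p x + dot q x + dot r x) := by
    intro x a ha
    have : (fun a => f.monomialValue a x) '' f.cell x = {f.monomialValue a x} := by
      ext v
      simp only [Set.mem_image, Set.mem_singleton_iff]
      constructor
      · rintro ⟨b, hb, rfl⟩
        exact value_eq_of_mem_cell hb ha
      · rintro rfl
        exact ⟨a, ha, rfl⟩
    simp only [hH, this, csInf_singleton]
  -- `H` is concave with its only maximum at `y`. The claim to prove is that a maximum over `L` is
  -- already a global one.
  obtain ⟨x, hxL, hmax⟩ := hfin.exists_maximalFor H L hne
  have hmax' : ∀ z ∈ L, H z ≤ H x := fun z hz => by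
    rcases le_total (H z) (H x) with h | h
    · exact h
    · exact hmax hz h
  have hsub : {p, q, r} ⊆ f.cell y := by
    simp only [Set.insert_subset_iff, Set.singleton_subset_iff]; exact ⟨hp, hq, hr⟩
  -- If the barycenter of `p`, `q`, `r` lay beyond the side `a b`, then `H` would grow along the
  -- dual edge, whose other end belongs to `L`.
  have step : ∀ a b c, f.cell x = {a, b, c} → doubleArea a b c = 1 →
      0 ≤ doubleArea a b p + doubleArea a b q + doubleArea a b r := by
    intro a b c hx hd
    by_contra hneg
    have : ∃ e ∈ f.support, doubleArea a b e < 0 := by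
      by_contra hcon
      push Not at hcon
      have h1 := hcon p hp.1
      have h2 := hcon q hq.1
      have h3 := hcon r hr.1
      omega
    obtain ⟨e, he, hed⟩ := this
    obtain ⟨z, hzL, hzx, haz, hbz⟩ := hclosed x hxL a b c e hx he hd hed
    have hax : a ∈ f.cell x := by simp [hx]
    have hbx : b ∈ f.cell x := by simp [hx]
    have hcx : c ∈ f.cell x := by simp [hx]
    obtain ⟨t, ht⟩ := exists_eq_add_smul_edgeDir
      (doubleArea_ne_zero_left (by rw [hd]; decide)) hax hbx haz hbz
    have ht0 : t ≠ 0 := by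
      rintro rfl
      simp at ht
      exact hzx ht
    have ht1 : 0 ≤ t := by
      have h := haz.2 c hcx.1
      rw [ht, monomialValue_add, monomialValue_add, value_eq_of_mem_cell hax hcx] at h
      have := dot_edgeDir a b c
      rw [hd] at this
      push_cast at this
      have h5 : dot c (edgeDir a b) = dot a (edgeDir a b) + 1 := by linarith
      rw [h5] at h
      linarith
    have htp : 0 < t := lt_of_le_of_ne ht1 ht0.symm
    have hle := hmax' z hzL
    rw [hHeq x a hax, hHeq z a haz, ht, monomialValue_add] at hle
    have hdot : ∀ u : ℤ × ℤ, dot u (x + t • edgeDir a b) = dot u x + t * dot u (edgeDir a b) := by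
      intro u
      simp only [dot, Prod.fst_add, Prod.snd_add, Prod.smul_fst, Prod.smul_snd, smul_eq_mul]
      ring
    rw [hdot, hdot, hdot] at hle
    have e1 := dot_edgeDir a b p
    have e2 := dot_edgeDir a b q
    have e3 := dot_edgeDir a b r
    have hn : ((doubleArea a b p : ℝ) + doubleArea a b q + doubleArea a b r) < 0 := by
      exact_mod_cast not_le.1 hneg
    nlinarith
  obtain ⟨a, b, c, hx, hd⟩ : ∃ a b c, f.cell x = {a, b, c} ∧ doubleArea a b c = 1 := by
    obtain ⟨a, b, c, hx, hd⟩ := huni x hxL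
    obtain ⟨b, c, h⟩ := (huni x hxL).exists_others (a := a) (by simp [hx])
    exact ⟨a, b, c, h⟩
  have k1 := step a b c hx hd
  have k2 := step b c a (by rw [hx]; ext; simp; tauto) (by rw [doubleArea_rotate]; exact hd)
  have k3 := step c a b (by rw [hx]; ext; simp; tauto)
    (by rw [doubleArea_rotate, doubleArea_rotate]; exact hd)
  have hax : a ∈ f.cell x := by simp [hx]
  have hbx : b ∈ f.cell x := by simp [hx]
  have hcx : c ∈ f.cell x := by simp [hx]
  -- The barycenter of `p`, `q`, `r` lies in the triangle `a b c`. The value at `y` is at most the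
  -- corresponding mean of the monomials of `a`, `b`, `c`, while at `x` these three agree with the
  -- value.
  have hsub2 : {p, q, r} ⊆ f.cell x := by
    refine (objective_le hsub (by rw [hx])).2 ?_
    have i1 := hp.2 a hax.1
    have i2 := hp.2 b hbx.1
    have i3 := hp.2 c hcx.1
    have e1 := value_eq_of_mem_cell hax hbx
    have e2 := value_eq_of_mem_cell hax hcx
    simp only [monomialValue_eq_dot] at *
    obtain ⟨u, v, w, h1, h2, h3, h4, h5⟩ := exists_barycentric hd
      (p.1 + q.1 + r.1, p.2 + q.2 + r.2) 3
    have hw : 0 ≤ w := by rw [h3]; simp only [doubleArea] at k1; linarith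
    have hv : 0 ≤ v := by rw [h2]; simp only [doubleArea] at k3; linarith
    have hu : 0 ≤ u := by
      rw [h1, h2, h3]
      simp only [doubleArea] at k2 hd
      linear_combination k2 + 3 * hd
    have hu' : (0 : ℝ) ≤ u := by exact_mod_cast hu
    have hv' : (0 : ℝ) ≤ v := by exact_mod_cast hv
    have hw' : (0 : ℝ) ≤ w := by exact_mod_cast hw
    have hsum : (u : ℝ) + v + w = 3 := by
      have : u + v + w = 3 := by omega
      exact_mod_cast this
    have hdot : ∀ z, dot p z + dot q z + dot r z = u * dot a z + v * dot b z + w * dot c z := by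
      intro z
      have h4' : ((p.1 + q.1 + r.1 : ℤ) : ℝ) = ((u * a.1 + v * b.1 + w * c.1 : ℤ) : ℝ) := by
        exact_mod_cast h4
      have h5' : ((p.2 + q.2 + r.2 : ℤ) : ℝ) = ((u * a.2 + v * b.2 + w * c.2 : ℤ) : ℝ) := by
        exact_mod_cast h5
      push_cast at h4' h5'
      simp only [dot]
      linear_combination z.1 * h4' + z.2 * h5'
    rw [hdot, hdot]
    have m1 := mul_le_mul_of_nonneg_left i1 hu'
    have m2 := mul_le_mul_of_nonneg_left i2 hv'
    have m3 := mul_le_mul_of_nonneg_left i3 hw'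
    have hu2 : (u : ℝ) = 3 - v - w := by linarith
    rw [hu2] at m1 ⊢
    have q1 : (v : ℝ) * (f.coeff b + dot b x) = v * (f.coeff a + dot a x) := by rw [e1]
    have q2 : (w : ℝ) * (f.coeff c + dot c x) = w * (f.coeff a + dot a x) := by rw [e2]
    linarith
  simp only [Set.insert_subset_iff, Set.singleton_subset_iff] at hsub2
  rw [eq_of_mem_cells hpqr hp hq hr hsub2.1 hsub2.2.1 hsub2.2.2]
  exact hxL

/-- A vertex is determined by its cell, which is a subset of a finite set. -/
theorem finite_of_unimodular {L : Set (ℝ × ℝ)} (h : ∀ x ∈ L, x ∈ f.curveVertices) : L.Finite := by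
  classical
  refine Set.Finite.of_finite_image (f := f.cell) ?_ ?_
  · refine (f.support.finite_toSet.finite_subsets).subset ?_
    rintro _ ⟨x, -, rfl⟩
    exact cell_subset f x
  · intro x hx y hy hxy
    obtain ⟨a, ha, b, hb, c, hc, hd⟩ := h x hx
    have : f.cell x = f.cell y := hxy
    exact eq_of_mem_cells hd ha hb hc (this ▸ ha) (this ▸ hb) (this ▸ hc)

theorem finite_curveVertices (f : TropicalPolynomial) : f.curveVertices.Finite :=
  finite_of_unimodular fun _ h => h

end TropicalPolynomial

/-! ### Vertices, edges and interior exponents of smooth curves -/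

theorem doubleArea_eq_zero_of_dot {p q r : ℤ × ℤ} {d : ℝ × ℝ} (hd : d ≠ 0)
    (hq : TropicalPolynomial.dot q d = TropicalPolynomial.dot p d)
    (hr : TropicalPolynomial.dot r d = TropicalPolynomial.dot p d) : doubleArea p q r = 0 := by
  simp only [TropicalPolynomial.dot] at hq hr
  have h1 : ((q.1 : ℝ) - p.1) * d.1 + ((q.2 : ℝ) - p.2) * d.2 = 0 := by linarith
  have h2 : ((r.1 : ℝ) - p.1) * d.1 + ((r.2 : ℝ) - p.2) * d.2 = 0 := by linarith
  have e1 : (doubleArea p q r : ℝ) * d.1 = 0 := by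
    simp only [doubleArea]; push_cast
    linear_combination ((r.2 : ℝ) - p.2) * h1 - ((q.2 : ℝ) - p.2) * h2
  have e2 : (doubleArea p q r : ℝ) * d.2 = 0 := by
    simp only [doubleArea]; push_cast
    linear_combination -((r.1 : ℝ) - p.1) * h1 + ((q.1 : ℝ) - p.1) * h2
  rcases mul_eq_zero.1 e1 with h | h
  · exact_mod_cast h
  · rcases mul_eq_zero.1 e2 with h' | h'
    · exact_mod_cast h'
    · exact absurd (Prod.ext h h') hd

namespace TropicalPolynomial

variable {f : TropicalPolynomial}

theorem dot_neg (a : ℤ × ℤ) (d : ℝ × ℝ) : dot a (-d) = -dot a d := by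
  simp only [dot, Prod.fst_neg, Prod.snd_neg]; ring

theorem dot_smul (a : ℤ × ℤ) (t : ℝ) (d : ℝ × ℝ) : dot a (t • d) = t * dot a d := by
  simp only [dot, Prod.smul_fst, Prod.smul_snd, smul_eq_mul]; ring

theorem dot_add (a : ℤ × ℤ) (x d : ℝ × ℝ) : dot a (x + d) = dot a x + dot a d := by
  simp only [dot, Prod.fst_add, Prod.snd_add]; ring

theorem IsTwoDimensional.exists_dot_ne (hS : IsTwoDimensional (f.support : Set (ℤ × ℤ)))
    (a : ℤ × ℤ) {d : ℝ × ℝ} (hd : d ≠ 0) : ∃ e ∈ f.support, dot e d ≠ dot a d := by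
  by_contra hcon
  push Not at hcon
  obtain ⟨p, hp, q, hq, r, hr, h⟩ := hS
  exact h (doubleArea_eq_zero_of_dot hd ((hcon q hq).trans (hcon p hp).symm)
    ((hcon r hr).trans (hcon p hp).symm))

/-- As `d` is constant on the cell, moving along `d` or `-d` keeps the cell until a new exponent
joins. This must happen for one of the two signs because `d` is not constant on the support. -/
theorem exists_cell_growth (hS : IsTwoDimensional (f.support : Set (ℤ × ℤ))) {a : ℤ × ℤ}
    {x d : ℝ × ℝ} (ha : a ∈ f.cell x) (hd : d ≠ 0) (hc : ∀ b ∈ f.cell x, dot b d = dot a d) :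
    ∃ y, f.cell x ⊆ f.cell y ∧ ∃ e ∈ f.cell y, dot e d ≠ dot a d := by
  obtain ⟨e, he, hne⟩ := IsTwoDimensional.exists_dot_ne hS a hd
  rcases lt_or_gt_of_ne hne with h | h
  · obtain ⟨τ, -, ⟨e', he', hlt⟩, hold, -⟩ := exists_cell_change ha (fun b hb => (hc b hb).ge) he h
    exact ⟨_, fun b hb => hold b hb (hc b hb), e', he', hlt.ne⟩
  · obtain ⟨τ, -, ⟨e', he', hlt⟩, hold, -⟩ := exists_cell_change (d := -d) ha
      (fun b hb => by rw [dot_neg, dot_neg, hc b hb]) he (by rw [dot_neg, dot_neg]; linarith)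
    refine ⟨_, fun b hb => hold b hb (by rw [dot_neg, dot_neg, hc b hb]), e', he', ?_⟩
    rw [dot_neg, dot_neg] at hlt
    exact fun h' => by linarith

theorem exists_vertex_of_pair (hS : IsTwoDimensional (f.support : Set (ℤ × ℤ))) {a b : ℤ × ℤ}
    {x : ℝ × ℝ} (ha : a ∈ f.cell x) (hb : b ∈ f.cell x) (hab : a ≠ b) :
    ∃ y ∈ f.curveVertices, f.cell x ⊆ f.cell y := by
  by_cases hx : x ∈ f.curveVertices
  · exact ⟨x, hx, subset_rfl⟩
  have hcol : ∀ c ∈ f.cell x, doubleArea a b c = 0 := fun c hc => by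
    by_contra h
    exact hx ⟨a, ha, b, hb, c, hc, h⟩
  obtain ⟨y, hxy, e, he, hne⟩ := exists_cell_growth hS ha (edgeDir_ne_zero hab) fun c hc => by
    have := dot_edgeDir a b c
    rw [hcol c hc] at this
    push_cast at this
    linarith
  refine ⟨y, ⟨a, hxy ha, b, hxy hb, e, he, fun h => hne ?_⟩, hxy⟩
  have := dot_edgeDir a b e
  rw [h] at this
  push_cast at this
  linarith

/-- Every cell is contained in a two-dimensional cell. -/
theorem exists_vertex_cell_subset (hS : IsTwoDimensional (f.support : Set (ℤ × ℤ))) (x : ℝ × ℝ) :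
    ∃ y ∈ f.curveVertices, f.cell x ⊆ f.cell y := by
  obtain ⟨a, ha⟩ := cell_nonempty (IsTwoDimensional.nonempty_support hS) x
  by_cases h : ∃ b ∈ f.cell x, a ≠ b
  · obtain ⟨b, hb, hab⟩ := h
    exact exists_vertex_of_pair hS ha hb hab
  · push Not at h
    obtain ⟨y, hxy, e, he, hne⟩ := exists_cell_growth hS (d := (1, 0)) ha (by simp) fun b hb => by
      rw [h b hb]
    have hae : a ≠ e := by rintro rfl; exact hne rfl
    obtain ⟨z, hz, hyz⟩ := exists_vertex_of_pair hS (hxy ha) he hae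
    exact ⟨z, hz, hxy.trans hyz⟩

/-- The exponents in the interior of the Newton polygon. -/
def interiorExponents (f : TropicalPolynomial) : Set (ℤ × ℤ) :=
  {a | ∀ d : ℝ × ℝ, d ≠ 0 → ∃ b ∈ f.support, dot b d < dot a d}

theorem IsSmooth.unimodular (hf : f.IsSmooth) {x : ℝ × ℝ} (hx : x ∈ f.curveVertices) :
    f.IsUnimodularAt x := hf.2 x hx

theorem mem_curveVertices_of_mem {x : ℝ × ℝ} {a b c : ℤ × ℤ} (ha : a ∈ f.cell x)
    (hb : b ∈ f.cell x) (hc : c ∈ f.cell x) (h : doubleArea a b c ≠ 0) : x ∈ f.curveVertices :=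
  ⟨a, ha, b, hb, c, hc, h⟩

/-- The exponent `e` beyond the side `a b` keeps the dual edge from being a ray. -/
theorem exists_adj_of_neg {x : ℝ × ℝ} {a b c e : ℤ × ℤ}
    (hx : f.cell x = {a, b, c}) (hd : 0 < doubleArea a b c) (he : e ∈ f.support)
    (hneg : doubleArea a b e < 0) :
    ∃ y, f.curveGraph.Adj x y ∧ a ∈ f.cell y ∧ b ∈ f.cell y ∧
      (∃ τ : ℝ, 0 < τ ∧ y = x + τ • edgeDir a b) ∧
      ∀ t : ℝ, 0 < t → t < 1 → f.cell (x + t • (y - x)) = {a, b} := by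
  obtain ⟨τ, hτ, ha, hb, ⟨e', he', hlt⟩, hbet⟩ := exists_edge_end hx hd he hneg
  have hab := doubleArea_ne_zero_left hd.ne'
  refine ⟨_, ⟨?_, ?_, ?_, ?_⟩, ha, hb, ⟨τ, hτ, rfl⟩, ?_⟩
  · intro h
    have h0 : τ • edgeDir a b = 0 := by simpa using h.symm
    rcases smul_eq_zero.1 h0 with h0 | h0
    · exact hτ.ne' h0
    · exact edgeDir_ne_zero hab h0
  · exact mem_curveVertices_of_mem (by simp [hx]) (by simp [hx]) (by simp [hx]) hd.ne'
  · exact mem_curveVertices_of_mem ha hb he' hlt.ne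
  · exact ⟨a, ⟨by simp [hx], ha⟩, b, ⟨by simp [hx], hb⟩, hab⟩
  · intro t h0 h1
    rw [add_sub_cancel_left, smul_smul]
    exact hbet _ (by positivity) (by nlinarith)

theorem IsSmooth.exists_third (hf : f.IsSmooth) {x : ℝ × ℝ} (hx : x ∈ f.curveVertices)
    {a b : ℤ × ℤ} (ha : a ∈ f.cell x) (hb : b ∈ f.cell x) (hab : a ≠ b) :
    ∃ c, f.cell x = {a, b, c} ∧ |doubleArea a b c| = 1 :=
  (hf.unimodular hx).exists_third ha hb hab

/-- An edge at a vertex has at most one other end. -/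
theorem IsSmooth.eq_of_mem (hf : f.IsSmooth) {x y z : ℝ × ℝ} {a b : ℤ × ℤ} (hab : a ≠ b)
    (hx : x ∈ f.curveVertices) (hy : y ∈ f.curveVertices) (hz : z ∈ f.curveVertices)
    (hxy : x ≠ y) (hxz : x ≠ z)
    (hax : a ∈ f.cell x) (hbx : b ∈ f.cell x) (hay : a ∈ f.cell y) (hby : b ∈ f.cell y)
    (haz : a ∈ f.cell z) (hbz : b ∈ f.cell z) : y = z := by
  by_contra hyz
  obtain ⟨p, hp, hp'⟩ := hf.exists_third hx hax hbx hab
  obtain ⟨q, hq, hq'⟩ := hf.exists_third hy hay hby hab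
  obtain ⟨r, hr, hr'⟩ := hf.exists_third hz haz hbz hab
  have n : ∀ k : ℤ, |k| = 1 → k ≠ 0 := by rintro k hk rfl; simp at hk
  have h1 := doubleArea_mul_neg hxy hax hbx hay hby (c := p) (e := q) (by simp [hp]) (by simp [hq])
    (n _ hp') (n _ hq')
  have h2 := doubleArea_mul_neg hxz hax hbx haz hbz (c := p) (e := r) (by simp [hp]) (by simp [hr])
    (n _ hp') (n _ hr')
  have h3 := doubleArea_mul_neg hyz hay hby haz hbz (c := q) (e := r) (by simp [hq]) (by simp [hr])
    (n _ hq') (n _ hr')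
  have := mul_pos_of_neg_of_neg h1 h2
  nlinarith [mul_self_nonneg (doubleArea a b p)]

/-- The two cells at an edge of the curve. -/
theorem IsSmooth.exists_cells_of_adj (hf : f.IsSmooth) {x y : ℝ × ℝ} (h : f.curveGraph.Adj x y) :
    ∃ a b c e, f.cell x = {a, b, c} ∧ f.cell y = {a, b, e} ∧ doubleArea a b c = 1 ∧
      doubleArea a b e = -1 ∧ f.cell x ∩ f.cell y = {a, b} ∧
      (∃ τ : ℝ, 0 < τ ∧ y = x + τ • edgeDir a b) ∧
      ∀ t : ℝ, 0 < t → t < 1 → f.cell (x + t • (y - x)) = {a, b} := by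
  have main : ∀ a b : ℤ × ℤ, a ≠ b → a ∈ f.cell x → b ∈ f.cell x → a ∈ f.cell y → b ∈ f.cell y →
      ∀ c, f.cell x = {a, b, c} → doubleArea a b c = 1 → 
      ∃ a b c e, f.cell x = {a, b, c} ∧ f.cell y = {a, b, e} ∧ doubleArea a b c = 1 ∧
      doubleArea a b e = -1 ∧ f.cell x ∩ f.cell y = {a, b} ∧
      (∃ τ : ℝ, 0 < τ ∧ y = x + τ • edgeDir a b) ∧
      ∀ t : ℝ, 0 < t → t < 1 → f.cell (x + t • (y - x)) = {a, b} := by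
    intro a b hab hax hbx hay hby c hc hd
    obtain ⟨hne, hx, hy, -⟩ := h
    obtain ⟨e, he, he'⟩ := hf.exists_third hy hay hby hab
    have hneg := doubleArea_mul_neg hne hax hbx hay hby (c := c) (e := e) (by simp [hc])
      (by simp [he]) (by rw [hd]; decide) (by intro h0; simp [h0] at he')
    have hee : doubleArea a b e = -1 := by
      rcases (abs_eq zero_le_one).1 he' with h' | h'
      · rw [hd, h'] at hneg; omega
      · exact h'
    have hec : e ∈ f.support := by
      have : e ∈ f.cell y := by simp [he]
      exact this.1
    obtain ⟨z, hz, haz, hbz, hτ, hbet⟩ := exists_adj_of_neg hc (by rw [hd]; decide) hec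
      (by rw [hee]; decide)
    have hyz := hf.eq_of_mem hab hx hy hz.2.2.1 hne hz.1 hax hbx hay hby haz hbz
    subst hyz
    refine ⟨a, b, c, e, hc, he, hd, hee, ?_, hτ, hbet⟩
    have hce : c ≠ e := by rintro rfl; rw [hd] at hee; omega
    have n1 := ne_of_doubleArea_ne_zero (a := a) (b := b) (c := c) (by rw [hd]; decide)
    have n2 := ne_of_doubleArea_ne_zero (a := a) (b := b) (c := e) (by rw [hee]; decide)
    rw [hc, he]
    ext u
    simp only [Set.mem_inter_iff, Set.mem_insert_iff, Set.mem_singleton_iff]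
    constructor
    · rintro ⟨rfl | rfl | rfl, h2⟩
      · simp
      · simp
      · rcases h2 with h2 | h2 | h2
        · exact absurd h2.symm n1.2.2
        · exact absurd h2.symm n1.2.1
        · exact absurd h2 hce
    · rintro (rfl | rfl) <;> simp
  obtain ⟨hne, hx, hy, a, ⟨hax, hay⟩, b, ⟨hbx, hby⟩, hab⟩ := id h
  obtain ⟨c, hc, hd⟩ := hf.exists_third hx hax hbx hab
  rcases (abs_eq zero_le_one).1 hd with h' | h'
  · exact main a b hab hax hbx hay hby c hc h'
  · refine main b a hab.symm hbx hax hby hay c (by rw [hc]; ext; simp; tauto) ?_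
    rw [doubleArea_swap, h', neg_neg]

/-- An edge with an interior exponent on one side is bounded. -/
theorem IsSmooth.exists_adj_of_interior (hf : f.IsSmooth) {x : ℝ × ℝ} (hx : x ∈ f.curveVertices)
    {a b : ℤ × ℤ} (ha : a ∈ f.cell x) (hb : b ∈ f.cell x) (hab : a ≠ b)
    (hI : a ∈ f.interiorExponents) :
    ∃ y, f.curveGraph.Adj x y ∧ a ∈ f.cell y ∧ b ∈ f.cell y := by
  obtain ⟨c, hc, hd⟩ := hf.exists_third hx ha hb hab
  rcases (abs_eq zero_le_one).1 hd with h' | h'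
  · obtain ⟨e, he, hlt⟩ := hI _ (edgeDir_ne_zero hab)
    obtain ⟨y, hy, hay, hby, -⟩ := exists_adj_of_neg hc (by rw [h']; decide) he (by
      have := dot_edgeDir a b e
      have h2 : (doubleArea a b e : ℝ) < 0 := by linarith
      exact_mod_cast h2)
    exact ⟨y, hy, hay, hby⟩
  · obtain ⟨e, he, hlt⟩ := hI _ (edgeDir_ne_zero hab.symm)
    have hc' : f.cell x = {b, a, c} := by rw [hc]; ext; simp; tauto
    obtain ⟨y, hy, hby, hay, -⟩ := exists_adj_of_neg (e := e) hc'
      (by rw [doubleArea_swap, h']; decide) he (by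
      have := dot_edgeDir b a e
      have h3 := dot_edgeDir_right b a
      have h2 : (doubleArea b a e : ℝ) < 0 := by linarith
      exact_mod_cast h2)
    exact ⟨y, hy, hay, hby⟩

/-- The tropical curve is connected. -/
theorem IsSmooth.reachable (hf : f.IsSmooth) {x y : ℝ × ℝ} (hx : x ∈ f.curveVertices)
    (hy : y ∈ f.curveVertices) : f.curveGraph.Reachable x y := by
  set L : Set (ℝ × ℝ) := {z | z ∈ f.curveVertices ∧ f.curveGraph.Reachable x z} with hL
  have := curveVertices_subset_of_closed (f := f) (L := L)
    (finite_of_unimodular fun z hz => hz.1) ⟨x, hx, SimpleGraph.Reachable.refl x⟩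
    (fun z hz => hf.unimodular hz.1) fun z hz a b c e hc he hd hneg => by
      obtain ⟨w, hw, haw, hbw, -⟩ := exists_adj_of_neg hc (by rw [hd]; decide) he hneg
      exact ⟨w, ⟨hw.2.2.1, hz.2.trans hw.reachable⟩, hw.1.symm, haw, hbw⟩
  exact (this hy).2

theorem IsSmooth.nonempty_curveVertices (hf : f.IsSmooth) : f.curveVertices.Nonempty := by
  obtain ⟨y, hy, -⟩ := exists_vertex_cell_subset hf.1 0
  exact ⟨y, hy⟩

/-- Every lattice point in the interior of the Newton polygon is a vertex of the subdivision. -/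
theorem IsSmooth.exists_vertex_of_interior (hf : f.IsSmooth) {w : ℤ × ℤ}
    (hw : w ∈ f.interiorExponents) : ∃ x ∈ f.curveVertices, w ∈ f.cell x := by
  set H : ℝ × ℝ → ℝ := fun x => sInf ((fun a => f.monomialValue a x) '' f.cell x) - dot w x with hH
  have hHeq : ∀ x, ∀ a ∈ f.cell x, H x = f.monomialValue a x - dot w x := by
    intro x a ha
    have : (fun a => f.monomialValue a x) '' f.cell x = {f.monomialValue a x} := by
      ext v
      simp only [Set.mem_image, Set.mem_singleton_iff]
      constructor
      · rintro ⟨b, hb, rfl⟩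
        exact value_eq_of_mem_cell hb ha
      · rintro rfl
        exact ⟨a, ha, rfl⟩
    simp only [hH, this, csInf_singleton]
  obtain ⟨x, hxV, hmax⟩ := (finite_curveVertices f).exists_maximalFor H _ hf.nonempty_curveVertices
  -- At a maximum of the tropical polynomial minus the linear form `w` no edge leads uphill, so `w`
  -- lies on the inner side of each side of the dual triangle.
  have step : ∀ a b c, f.cell x = {a, b, c} → doubleArea a b c = 1 → 0 ≤ doubleArea a b w := by
    intro a b c hx hd
    by_contra hneg
    push Not at hneg
    have hab := doubleArea_ne_zero_left (a := a) (b := b) (c := c) (by rw [hd]; decide)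
    have e1 := dot_edgeDir a b w
    have e1' : (doubleArea a b w : ℝ) < 0 := by exact_mod_cast hneg
    obtain ⟨e, he, hlt⟩ := hw _ (edgeDir_ne_zero hab)
    obtain ⟨y, hy, hay, -, ⟨τ, hτ, rfl⟩, -⟩ := exists_adj_of_neg hx (by rw [hd]; decide) he (by
      have := dot_edgeDir a b e
      have h2 : (doubleArea a b e : ℝ) < 0 := by linarith
      exact_mod_cast h2)
    have hax : a ∈ f.cell x := by simp [hx]
    have hlt : H x < H (x + τ • edgeDir a b) := by
      rw [hHeq x a hax, hHeq _ a hay, monomialValue_add, dot_add, dot_smul]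
      nlinarith
    exact absurd (hmax hy.2.2.1 hlt.le) (not_le.2 hlt)
  obtain ⟨a, ha⟩ : (f.cell x).Nonempty :=
    cell_nonempty (IsTwoDimensional.nonempty_support hf.1) x
  obtain ⟨b, c, hx, hd⟩ := (hf.unimodular hxV).exists_others ha
  have k1 := step a b c hx hd
  have k2 := step b c a (by rw [hx]; ext; simp; tauto) (by rw [doubleArea_rotate]; exact hd)
  have k3 := step c a b (by rw [hx]; ext; simp; tauto)
    (by rw [doubleArea_rotate, doubleArea_rotate]; exact hd)
  obtain ⟨u, v, z, h1, h2, h3, h4, h5⟩ := exists_barycentric hd w 1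
  have hz : 0 ≤ z := by rw [h3]; simp only [doubleArea] at k1; linarith
  have hv : 0 ≤ v := by rw [h2]; simp only [doubleArea] at k3; linarith
  have hu : 0 ≤ u := by
    rw [h1, h2, h3]
    simp only [doubleArea] at k2 hd
    linear_combination k2 + hd
  refine ⟨x, hxV, ?_⟩
  rw [hx]
  -- Nonnegative integral weights with sum 1: a lattice point of a unimodular triangle is a corner.
  rcases (by omega : (u = 1 ∧ v = 0 ∧ z = 0) ∨ (u = 0 ∧ v = 1 ∧ z = 0) ∨ (u = 0 ∧ v = 0 ∧ z = 1))
    with ⟨hu, hv, hz⟩ | ⟨hu, hv, hz⟩ | ⟨hu, hv, hz⟩ <;> rw [hu, hv, hz] at h4 h5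
  · left; exact Prod.ext (by linarith) (by linarith)
  · right; left; exact Prod.ext (by linarith) (by linarith)
  · right; right; exact Prod.ext (by linarith) (by linarith)

theorem IsSmooth.interiorExponents_subset (hf : f.IsSmooth) :
    f.interiorExponents ⊆ f.support := fun _ hw => by
  obtain ⟨x, -, h⟩ := hf.exists_vertex_of_interior hw
  exact h.1

/-- Lattice points that are convex combinations of exponents, with a positive weight at an interior
one, are interior. -/
theorem mem_interiorExponents_of_combination {w u v z : ℤ × ℤ} {k α β γ : ℤ}
    (hu : u ∈ f.interiorExponents) (hv : v ∈ f.support) (hz : z ∈ f.support) (hα : 0 < α)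
    (hβ : 0 ≤ β) (hγ : 0 ≤ γ) (hk : k = α + β + γ) (h1 : k * w.1 = α * u.1 + β * v.1 + γ * z.1)
    (h2 : k * w.2 = α * u.2 + β * v.2 + γ * z.2) : w ∈ f.interiorExponents := by
  intro d hd
  by_contra hcon
  push Not at hcon
  obtain ⟨b, hb, hlt⟩ := hu d hd
  have i1 := hcon b hb
  have i2 := hcon v hv
  have i3 := hcon z hz
  have h1' : (k : ℝ) * w.1 = α * u.1 + β * v.1 + γ * z.1 := by exact_mod_cast h1
  have h2' : (k : ℝ) * w.2 = α * u.2 + β * v.2 + γ * z.2 := by exact_mod_cast h2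
  have hk' : (k : ℝ) = α + β + γ := by exact_mod_cast hk
  have hα' : (0 : ℝ) < α := by exact_mod_cast hα
  have hβ' : (0 : ℝ) ≤ β := by exact_mod_cast hβ
  have hγ' : (0 : ℝ) ≤ γ := by exact_mod_cast hγ
  have key : (k : ℝ) * dot w d = α * dot u d + β * dot v d + γ * dot z d := by
    simp only [dot]; linear_combination d.1 * h1' + d.2 * h2'
  have m1 := mul_le_mul_of_nonneg_left i2 hβ'
  have m2 := mul_le_mul_of_nonneg_left i3 hγ'
  have m3 := mul_lt_mul_of_pos_left (i1.trans_lt hlt) hα'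
  rw [hk'] at key
  linarith

end TropicalPolynomial

/-! ### Core, chains and subdivisions -/

namespace SimpleGraph.Walk

variable {V : Type*} {G : SimpleGraph V} {u v : V}

theorem mem_edges_iff_getVert (p : G.Walk u v) (e : Sym2 V) :
    e ∈ p.edges ↔ ∃ i, i < p.length ∧ e = s(p.getVert i, p.getVert (i + 1)) := by
  rw [edges, List.mem_map]
  constructor
  · rintro ⟨d, hd, rfl⟩
    obtain ⟨i, hi, rfl⟩ := List.getElem_of_mem hd
    refine ⟨i, by simpa using hi, ?_⟩
    rw [darts_getElem_eq_getVert]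
    rfl
  · rintro ⟨i, hi, rfl⟩
    have hi' : i < p.darts.length := by simpa using hi
    refine ⟨p.darts[i], List.getElem_mem hi', ?_⟩
    rw [darts_getElem_eq_getVert]
    rfl

theorem IsTrail.edge_inj {p : G.Walk u v} (hp : p.IsTrail) {i j : ℕ} (hi : i < p.length)
    (hj : j < p.length)
    (h : s(p.getVert i, p.getVert (i + 1)) = s(p.getVert j, p.getVert (j + 1))) : i = j := by
  have key : ∀ k (hk : k < p.edges.length), p.edges[k] = s(p.getVert k, p.getVert (k + 1)) := by
    intro k hk
    simp only [edges, List.getElem_map]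
    rw [darts_getElem_eq_getVert]
    rfl
  have hi' : i < p.edges.length := by simpa using hi
  have hj' : j < p.edges.length := by simpa using hj
  exact (List.Nodup.getElem_inj_iff hp.edges_nodup).1
    ((key i hi').trans (h.trans (key j hj').symm))

theorem mem_interior_iff (p : G.Walk u v) (w : V) :
    w ∈ p.support.tail.dropLast ↔ ∃ i, 0 < i ∧ i < p.length ∧ w = p.getVert i := by
  have hl : p.support.tail.dropLast.length = p.length - 1 := by simp
  constructor
  · intro h
    obtain ⟨i, hi, rfl⟩ := List.getElem_of_mem h
    rw [hl] at hi
    refine ⟨i + 1, by omega, by omega, ?_⟩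
    rw [List.getElem_dropLast, List.getElem_tail, support_getElem_eq_getVert]
  · rintro ⟨i, h0, hi, rfl⟩
    have h2 : i - 1 < p.support.tail.dropLast.length := by rw [hl]; omega
    have : p.support.tail.dropLast[i - 1] = p.getVert i := by
      rw [List.getElem_dropLast, List.getElem_tail, support_getElem_eq_getVert]
      congr 1; omega
    rw [← this]
    exact List.getElem_mem h2

end SimpleGraph.Walk

namespace TropicalPolynomial

variable {f : TropicalPolynomial}

theorem coreVertices_subset (f : TropicalPolynomial) : f.coreVertices ⊆ f.curveVertices :=
  fun _ hx => hx 0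

/-- A vertex of a bounded region of the complement of the curve has two neighbours on it. -/
theorem IsSmooth.exists_two_adj (hf : f.IsSmooth) {x : ℝ × ℝ} (hx : x ∈ f.curveVertices)
    {a : ℤ × ℤ} (ha : a ∈ f.cell x) (hI : a ∈ f.interiorExponents) :
    ∃ y z, y ≠ z ∧ f.curveGraph.Adj x y ∧ f.curveGraph.Adj x z ∧ a ∈ f.cell y ∧ a ∈ f.cell z := by
  obtain ⟨b, c, hc, hd⟩ := (hf.unimodular hx).exists_others ha
  have hne := ne_of_doubleArea_ne_zero (a := a) (b := b) (c := c) (by rw [hd]; decide)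
  obtain ⟨y, hy, hay, hby⟩ := hf.exists_adj_of_interior hx ha (b := b) (by simp [hc]) hne.1 hI
  obtain ⟨z, hz, haz, hcz⟩ := hf.exists_adj_of_interior hx ha (b := c) (by simp [hc]) hne.2.2 hI
  refine ⟨y, z, ?_, hy, hz, hay, haz⟩
  rintro rfl
  exact hy.1 (eq_of_mem_cells (a := a) (b := b) (c := c) (by rw [hd]; decide) (by simp [hc])
    (by simp [hc]) (by simp [hc]) hay hby hcz)

/-- The two neighbours of `x` along the boundary of the region of `a` have `a` in their cells as
well. By induction on the rounds they survive together with `x`, which therefore never becomes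
1-valent. -/
theorem IsSmooth.mem_coreVertices_of_interior (hf : f.IsSmooth) {x : ℝ × ℝ}
    (hx : x ∈ f.curveVertices) {a : ℤ × ℤ} (ha : a ∈ f.cell x) (hI : a ∈ f.interiorExponents) :
    x ∈ f.coreVertices := by
  intro k
  induction k generalizing x with
  | zero => exact hx
  | succ k ih =>
    obtain ⟨y, z, hyz, hy, hz, hay, haz⟩ := hf.exists_two_adj hx ha hI
    refine ⟨ih hx ha, ?_⟩
    rintro ⟨w, -, hw⟩
    exact hyz ((hw y ⟨ih hy.2.2.1 hay, hy⟩).trans (hw z ⟨ih hz.2.2.1 haz, hz⟩).symm)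

/-- The core of the tropical curve is connected. -/
theorem IsSmooth.reachable_core (hf : f.IsSmooth) {x y : ℝ × ℝ} (hx : x ∈ f.coreVertices)
    (hy : y ∈ f.coreVertices) : f.coreGraph.Reachable x y := by
  obtain ⟨p, hp⟩ := (hf.reachable (coreVertices_subset f hx)
    (coreVertices_subset f hy)).exists_isPath
  have hmem : ∀ k, ∀ i ≤ p.length, p.getVert i ∈ f.pruned k := by
    intro k
    induction k with
    | zero =>
      intro i hi
      rcases Nat.eq_zero_or_pos i with rfl | h0
      · rw [p.getVert_zero]; exact hx 0
      · have := p.adj_getVert_succ (i := i - 1) (by omega)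
        rw [Nat.sub_add_cancel h0] at this
        exact this.2.2.1
    | succ k ih =>
      intro i hi
      rcases Nat.eq_zero_or_pos i with rfl | h0
      · rw [p.getVert_zero]; exact hx _
      rcases hi.eq_or_lt with rfl | hlt
      · rw [p.getVert_length]; exact hy _
      -- An inner vertex of a path keeps its two distinct neighbours on the path.
      refine ⟨ih i hi, ?_⟩
      rintro ⟨w, -, hw⟩
      have h1 := p.adj_getVert_succ (i := i - 1) (by omega)
      rw [Nat.sub_add_cancel h0] at h1
      have h2 := p.adj_getVert_succ hlt
      have e := (hw _ ⟨ih (i - 1) (by omega), h1.symm⟩).trans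
        (hw _ ⟨ih (i + 1) (by omega), h2⟩).symm
      have := hp.getVert_injOn (by simp; omega) (by simp; omega) e
      omega
  have hcore : ∀ i ≤ p.length, p.getVert i ∈ f.coreVertices := fun i hi k => hmem k i hi
  refine (p.transfer f.coreGraph fun e he => ?_).reachable
  obtain ⟨i, hi, rfl⟩ := (p.mem_edges_iff_getVert e).1 he
  exact ⟨hcore i hi.le, hcore (i + 1) hi, p.adj_getVert_succ hi⟩

theorem finite_core_neighborSet (f : TropicalPolynomial) (x : ℝ × ℝ) :
    (f.coreGraph.neighborSet x).Finite :=
  (finite_curveVertices f).subset fun _ hy => coreVertices_subset f hy.2.1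

/-- The vertices of the curve have at most three neighbours. -/
theorem IsSmooth.ncard_core_neighborSet_le (hf : f.IsSmooth) (x : ℝ × ℝ) :
    (f.coreGraph.neighborSet x).ncard ≤ 3 := by
  by_cases hx : x ∈ f.curveVertices
  swap
  · have : f.coreGraph.neighborSet x = ∅ := by
      ext y
      simp only [SimpleGraph.mem_neighborSet, Set.mem_empty_iff_false, iff_false]
      exact fun h => hx (coreVertices_subset f h.1)
    simp [this]
  have h3 : (f.cell x).ncard ≤ 3 := by
    obtain ⟨a, b, c, hc, -⟩ := hf.unimodular hx
    rw [hc]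
    exact (Set.ncard_insert_le _ _).trans
      (Nat.succ_le_succ ((Set.ncard_insert_le _ _).trans (by simp)))
  have hch : ∀ y, f.coreGraph.Adj x y → ∃ c, c ∈ f.cell x ∧ c ∉ f.cell y := by
    intro y hy
    by_contra hcon
    push Not at hcon
    obtain ⟨a, b, c, hc, hd⟩ := hf.unimodular hx
    exact hy.2.2.1 (eq_of_mem_cells (a := a) (b := b) (c := c) (by rintro h; simp [h] at hd)
      (by simp [hc]) (by simp [hc]) (by simp [hc]) (hcon a (by simp [hc]))
      (hcon b (by simp [hc])) (hcon c (by simp [hc])))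
  -- `g` sends a neighbour to the corner opposite to the common side. The other two corners
  -- determine the edge, so `g` is injective on the neighbours.
  choose! g hg hg' using hch
  refine (Set.ncard_le_ncard_of_injOn g (fun y hy => hg y hy) ?_ (finite_cell f x)).trans h3
  intro y hy z hz hyz
  obtain ⟨a, b, hab, hd⟩ := (hf.unimodular hx).exists_others (hg y hy)
  have hne := ne_of_doubleArea_ne_zero (a := g y) (b := a) (c := b) (by rw [hd]; decide)
  have key : ∀ w, f.coreGraph.Adj x w → g w = g y → a ∈ f.cell w ∧ b ∈ f.cell w := by
    intro w hw hgw
    obtain ⟨p, ⟨hp, hp'⟩, q, ⟨hq, hq'⟩, hpq⟩ := hw.2.2.2.2.2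
    have h1 : p ≠ g y := fun h => hg' w hw (by rw [hgw, ← h]; exact hp')
    have h2 : q ≠ g y := fun h => hg' w hw (by rw [hgw, ← h]; exact hq')
    rw [hab] at hp hq
    simp only [Set.mem_insert_iff, Set.mem_singleton_iff] at hp hq
    rcases hp with hp | rfl | rfl
    · exact absurd hp h1
    · rcases hq with hq | rfl | rfl
      · exact absurd hq h2
      · exact absurd rfl hpq
      · exact ⟨hp', hq'⟩
    · rcases hq with hq | rfl | rfl
      · exact absurd hq h2
      · exact ⟨hq', hp'⟩
      · exact absurd rfl hpq
  have k1 := key y hy rfl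
  have k2 := key z hz hyz.symm
  exact hf.eq_of_mem (a := a) (b := b) hne.2.1 hx hy.2.2.2.2.1 hz.2.2.2.2.1 hy.2.2.1 hz.2.2.1
    (by simp [hab]) (by simp [hab]) k1.1 k1.2 k2.1 k2.2

/-- A chain that passes through a `2`-valent vertex contains both edges at it. -/
theorem IsChain.mem_of_isTwoValent {e : Set (Sym2 (ℝ × ℝ))} {u v x y z : ℝ × ℝ}
    (h : f.IsChain e u v) (hx : f.IsTwoValent x) (hy : s(x, y) ∈ e) (hz : f.coreGraph.Adj x z) :
    s(x, z) ∈ e := by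
  obtain ⟨hu, hv, p, hp, hl, hi, rfl⟩ := h
  have hxs := p.fst_mem_support_of_mem_edges hy
  obtain ⟨i, rfl, hle⟩ := SimpleGraph.Walk.mem_support_iff_exists_getVert.1 hxs
  have h0 : 0 < i := by
    rcases Nat.eq_zero_or_pos i with rfl | h
    · rw [p.getVert_zero] at hx; exact absurd hx hu.2
    · exact h
  have h1 : i < p.length := by
    rcases hle.eq_or_lt with rfl | h
    · rw [p.getVert_length] at hx; exact absurd hx hv.2
    · exact h
  have a1 := p.adj_getVert_succ (i := i - 1) (by omega)
  rw [Nat.sub_add_cancel h0] at a1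
  have a2 := p.adj_getVert_succ h1
  have hne : p.getVert (i - 1) ≠ p.getVert (i + 1) := by
    intro h
    have := hp.edge_inj (i := i - 1) (j := i) (by omega) h1 (by
      rw [Nat.sub_add_cancel h0, h, Sym2.eq_swap])
    omega
  have hset : {p.getVert (i - 1), p.getVert (i + 1)} = f.coreGraph.neighborSet (p.getVert i) := by
    refine Set.eq_of_subset_of_ncard_le ?_ ?_ (finite_core_neighborSet f _)
    · rintro w (rfl | rfl)
      · exact a1.symm
      · exact a2
    · rw [Set.ncard_pair hne]; exact hx.le
  have hz' : z ∈ f.coreGraph.neighborSet (p.getVert i) := hz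
  rw [← hset] at hz'
  rcases hz' with rfl | rfl
  · refine (p.mem_edges_iff_getVert _).2 ⟨i - 1, by omega, ?_⟩
    rw [Nat.sub_add_cancel h0, Sym2.eq_swap]
  · exact (p.mem_edges_iff_getVert _).2 ⟨i, h1, rfl⟩

theorem IsChain.adj {e : Set (Sym2 (ℝ × ℝ))} {u v x y : ℝ × ℝ} (h : f.IsChain e u v)
    (hxy : s(x, y) ∈ e) : f.coreGraph.Adj x y := by
  obtain ⟨-, -, p, -, -, -, rfl⟩ := h
  exact p.adj_of_mem_edges hxy

/-- A property of the vertices on a chain that is passed on through `2`-valent vertices. -/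
theorem IsChain.induction {e : Set (Sym2 (ℝ × ℝ))} {u v x y : ℝ × ℝ} (h : f.IsChain e u v)
    (hxy : s(x, y) ∈ e) {P : Sym2 (ℝ × ℝ) → Prop} (hP : P s(x, y))
    (hstep : ∀ a b c, f.IsTwoValent b → s(a, b) ∈ e → s(b, c) ∈ e → P s(a, b) → P s(b, c)) :
    ∀ d ∈ e, P d := by
  obtain ⟨hu, hv, p, hp, hl, hi, rfl⟩ := h
  have hmem : ∀ i < p.length, s(p.getVert i, p.getVert (i + 1)) ∈ {d | d ∈ p.edges} :=
    fun i hi => (p.mem_edges_iff_getVert _).2 ⟨i, hi, rfl⟩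
  have h2 : ∀ i, 0 < i → i < p.length → f.IsTwoValent (p.getVert i) := fun i h0 h1 =>
    hi _ ((p.mem_interior_iff _).2 ⟨i, h0, h1, rfl⟩)
  obtain ⟨j, hj, hjxy⟩ := (p.mem_edges_iff_getVert _).1 hxy
  rw [hjxy] at hP
  have up : ∀ k, j + k < p.length → P s(p.getVert (j + k), p.getVert (j + k + 1)) := by
    intro k
    induction k with
    | zero => exact fun _ => hP
    | succ k ih =>
      intro hk
      exact hstep _ _ _ (h2 (j + k + 1) (by omega) (by omega)) (hmem (j + k) (by omega))
        (hmem (j + k + 1) (by omega)) (ih (by omega))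
  have down : ∀ k, k ≤ j → P s(p.getVert (j - k), p.getVert (j - k + 1)) := by
    intro k
    induction k with
    | zero => exact fun _ => hP
    | succ k ih =>
      intro hk
      have e1 : j - (k + 1) + 1 = j - k := by omega
      have m1 := hmem (j - k) (by omega)
      have m2 := hmem (j - (k + 1)) (by omega)
      have := ih (by omega)
      rw [e1] at m2 ⊢
      rw [Sym2.eq_swap] at m1 m2 this ⊢
      exact hstep _ _ _ (h2 (j - k) (by omega) (by omega)) m1 m2 this
  rintro d hd
  obtain ⟨i, hi, rfl⟩ := (p.mem_edges_iff_getVert _).1 hd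
  rcases le_total j i with hji | hji
  · have := up (i - j) (by omega)
    rwa [Nat.add_sub_cancel' hji] at this
  · have := down (j - i) (by omega)
    rwa [Nat.sub_sub_self hji] at this

/-- Two chains with a common edge coincide. -/
theorem IsChain.eq_of_mem {e e' : Set (Sym2 (ℝ × ℝ))} {u v u' v' x y : ℝ × ℝ}
    (h : f.IsChain e u v) (h' : f.IsChain e' u' v') (hxy : s(x, y) ∈ e) (hxy' : s(x, y) ∈ e') :
    e = e' := by
  have key : ∀ {e e' : Set (Sym2 (ℝ × ℝ))} {u v u' v' : ℝ × ℝ}, f.IsChain e u v →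
      f.IsChain e' u' v' → s(x, y) ∈ e → s(x, y) ∈ e' → e ⊆ e' := by
    intro e e' u v u' v' h h' hxy hxy'
    refine h.induction hxy (P := fun d => d ∈ e') hxy' fun a b c hb _ hbc hab => ?_
    rw [Sym2.eq_swap] at hab
    exact h'.mem_of_isTwoValent hb hab (h.adj hbc)
  exact (key h h' hxy hxy').antisymm (key h' h hxy' hxy)

theorem IsChain.eq_or_eq_of_mem {e : Set (Sym2 (ℝ × ℝ))} {u v x y : ℝ × ℝ} (h : f.IsChain e u v)
    (hxy : s(x, y) ∈ e) (hx : x ∈ f.skeletonVertices) : x = u ∨ x = v := by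
  obtain ⟨hu, hv, p, hp, hl, hi, rfl⟩ := h
  obtain ⟨i, rfl, hle⟩ := SimpleGraph.Walk.mem_support_iff_exists_getVert.1
    (p.fst_mem_support_of_mem_edges hxy)
  rcases Nat.eq_zero_or_pos i with rfl | h0
  · exact Or.inl p.getVert_zero
  rcases hle.eq_or_lt with rfl | h1
  · exact Or.inr p.getVert_length
  · exact absurd (hi _ ((p.mem_interior_iff _).2 ⟨i, h0, h1, rfl⟩)) hx.2

theorem IsChain.exists_first {e : Set (Sym2 (ℝ × ℝ))} {u v : ℝ × ℝ} (h : f.IsChain e u v) :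
    ∃ y, s(u, y) ∈ e := by
  obtain ⟨hu, hv, p, hp, hl, hi, rfl⟩ := h
  refine ⟨p.getVert 1, (p.mem_edges_iff_getVert _).2 ⟨0, hl, ?_⟩⟩
  rw [p.getVert_zero]

/-- The chain does not return to `u`: its inner vertices are 2-valent, which `u` is not, and its
last vertex is `v ≠ u`. -/
theorem IsChain.first_unique {e : Set (Sym2 (ℝ × ℝ))} {u v y z : ℝ × ℝ} (h : f.IsChain e u v)
    (huv : u ≠ v) (hy : s(u, y) ∈ e) (hz : s(u, z) ∈ e) : y = z := by
  obtain ⟨hu, hv, p, hp, hl, hi, rfl⟩ := h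
  have h2 : ∀ i, i ≤ p.length → p.getVert i = u → i = 0 := fun i h1 he => by
    by_contra h0
    rcases h1.eq_or_lt with rfl | h1
    · rw [p.getVert_length] at he; exact huv he.symm
    · exact hu.2 (he ▸ hi _ ((p.mem_interior_iff _).2 ⟨i, by omega, h1, rfl⟩))
  have key : ∀ w, s(u, w) ∈ p.edges → w = p.getVert 1 := by
    intro w hw
    obtain ⟨i, hi, he⟩ := (p.mem_edges_iff_getVert _).1 hw
    rcases Sym2.eq_iff.1 he with ⟨e1, e2⟩ | ⟨e1, e2⟩
    · have := h2 i hi.le e1.symm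
      subst this
      exact e2
    · have := h2 (i + 1) hi e1.symm
      omega
  rw [key y hy, key z hz]

end TropicalPolynomial

/-! ### The core as a subdivision of the skeleton -/

namespace TropicalPolynomial

variable {f : TropicalPolynomial} {W : Type*} {G : SimpleGraph W}

/-- The core of the curve is a subdivision of the simple graph `G`: the vertex `v` is drawn at `σ v`
and the edge from `v` to `w` as the chain `c v w`. -/
structure IsSubdivision (f : TropicalPolynomial) (G : SimpleGraph W) (σ : W → ℝ × ℝ)
    (c : W → W → Set (Sym2 (ℝ × ℝ))) : Prop where
  injective : Function.Injective σ
  range_eq : Set.range σ = f.skeletonVertices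
  isChain : ∀ v w, G.Adj v w → f.IsChain (c v w) (σ v) (σ w)
  symm : ∀ v w, G.Adj v w → c v w = c w v
  eq_of_eq : ∀ v w v' w', G.Adj v w → G.Adj v' w' → c v w = c v' w' → s(v, w) = s(v', w')
  cover : ∀ x y, f.coreGraph.Adj x y → ∃ v w, G.Adj v w ∧ s(x, y) ∈ c v w

theorem IsSubdivision.mem {σ : W → ℝ × ℝ} {c : W → W → Set (Sym2 (ℝ × ℝ))}
    (h : f.IsSubdivision G σ c) (v : W) : σ v ∈ f.skeletonVertices :=
  h.range_eq ▸ Set.mem_range_self v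

/-- An arbitrary chain shares its first edge with some `c v w` and hence coincides with it, so the
skeleton has no edges besides those of `G`. -/
theorem IsSubdivision.hasSkeleton {σ : W → ℝ × ℝ} {c : W → W → Set (Sym2 (ℝ × ℝ))}
    (h : f.IsSubdivision G σ c) : f.HasSkeleton G := by
  have link : ∀ e x y, f.IsChain e x y → ∃ v w, G.Adj v w ∧ e = c v w ∧ x = σ v ∧ y = σ w := by
    intro e x y he
    obtain ⟨z, hz⟩ := he.exists_first
    obtain ⟨v, w, hvw, hm⟩ := h.cover _ _ (he.adj hz)
    have hc := h.isChain v w hvw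
    have hec := he.eq_of_mem hc hz hm
    have h1 := he.left_eq_or_eq (hec ▸ hc : f.IsChain e (σ v) (σ w))
    have h2 := he.symm.left_eq_or_eq (hec ▸ hc : f.IsChain e (σ v) (σ w))
    have h3 := hc.left_eq_or_eq (hec ▸ he : f.IsChain (c v w) x y)
    have h4 := hc.symm.left_eq_or_eq (hec ▸ he : f.IsChain (c v w) x y)
    have hne : σ v ≠ σ w := fun he => hvw.ne (h.injective he)
    rcases h1 with h1 | h1
    · refine ⟨v, w, hvw, hec, h1, ?_⟩
      rcases h4 with h4 | h4
      · exact absurd (h1.symm.trans h4.symm) hne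
      · exact h4.symm
    · refine ⟨w, v, hvw.symm, hec.trans (h.symm v w hvw), h1, ?_⟩
      rcases h3 with h3 | h3
      · exact absurd (h3.trans h1) hne
      · exact h3.symm
  have hinj := h.injective
  refine ⟨{ not_isLoopAt := ?_, eq_of_isLink := ?_ }, ⟨?_⟩⟩
  · intro e x he
    obtain ⟨v, w, hvw, -, h1, h2⟩ := link e x x he
    exact hvw.ne (hinj (h1.symm.trans h2))
  · intro e e' x y he he'
    obtain ⟨v, w, hvw, rfl, rfl, rfl⟩ := link e x y he
    obtain ⟨v', w', hvw', rfl, h1, h2⟩ := link e' _ _ he'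
    rw [hinj h1, hinj h2]
  · have hbij : Function.Bijective (fun v => (⟨σ v, h.mem v⟩ : f.skeleton.vertexSet)) := by
      constructor
      · intro v w hvw
        exact hinj (congrArg Subtype.val hvw)
      · rintro ⟨x, hx⟩
        have hx' : x ∈ f.skeletonVertices := hx
        rw [← h.range_eq] at hx'
        obtain ⟨v, rfl⟩ := hx'
        exact ⟨v, rfl⟩
    refine SimpleGraph.Iso.symm ⟨Equiv.ofBijective _ hbij, ?_⟩
    intro v w
    constructor
    · rintro ⟨-, e, he⟩
      obtain ⟨v', w', hvw, -, h1, h2⟩ := link e _ _ he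
      rw [hinj (show σ v = σ v' from h1), hinj (show σ w = σ w' from h2)]
      exact hvw
    · intro hvw
      exact ⟨fun he => hvw.ne (hbij.1 he), c v w, h.isChain v w hvw⟩

/-- If the skeleton is a cubic graph, the core is a subdivision of it. -/
theorem IsSmooth.exists_isSubdivision (hf : f.IsSmooth) (hs : f.skeleton.Simple)
    (φ : f.skeleton.toSimpleGraph ≃g G) (hG : ∀ v, 3 ≤ (G.neighborSet v).ncard) (v₀ : W) :
    ∃ c, f.IsSubdivision G (fun v => ((φ.symm v : f.skeleton.vertexSet) : ℝ × ℝ)) c := by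
  classical
  set σ : W → ℝ × ℝ := fun v => ((φ.symm v : f.skeleton.vertexSet) : ℝ × ℝ) with hσ
  have hσi : Function.Injective σ := fun v w h => φ.symm.injective (Subtype.ext h)
  have hlink : ∀ v w, G.Adj v w → ∃ e, f.IsChain e (σ v) (σ w) := by
    intro v w hvw
    obtain ⟨-, e, he⟩ := (φ.symm.map_adj_iff.2 hvw : f.skeleton.toSimpleGraph.Adj _ _)
    exact ⟨e, he⟩
  choose! c hc using hlink
  have hr : Set.range σ = f.skeletonVertices := by
    ext x
    constructor
    · rintro ⟨v, rfl⟩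
      exact (φ.symm v).2
    · intro hx
      refine ⟨φ ⟨x, hx⟩, ?_⟩
      simp [hσ]
  have hinj : ∀ v w v' w', G.Adj v w → G.Adj v' w' → c v w = c v' w' → s(v, w) = s(v', w') := by
    intro v w v' w' h h' he
    have k1 := (hc v w h).left_eq_or_eq (he ▸ hc v' w' h' : f.IsChain (c v w) _ _)
    have k2 := (hc v w h).symm.left_eq_or_eq (he ▸ hc v' w' h' : f.IsChain (c v w) _ _)
    rw [Sym2.eq_iff]
    rcases k1 with k1 | k1 <;> rcases k2 with k2 | k2
    · exact absurd (hσi (k1.trans k2.symm)) h.ne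
    · exact Or.inl ⟨hσi k1, hσi k2⟩
    · exact Or.inr ⟨hσi k1, hσi k2⟩
    · exact absurd (hσi (k1.trans k2.symm)) h.ne
  refine ⟨c, hσi, hr, hc, fun v w h => hs.eq_of_isLink (hc v w h) (hc w v h.symm).symm, hinj, ?_⟩
  set Q : ℝ × ℝ → Prop := fun x => ∀ z, f.coreGraph.Adj x z → ∃ v w, G.Adj v w ∧ s(x, z) ∈ c v w
    with hQ
  have hsk : ∀ x ∈ f.skeletonVertices, Q x := by
    intro x hx
    rw [← hr] at hx
    obtain ⟨v, rfl⟩ := hx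
    have hfirst : ∀ w ∈ G.neighborSet v, ∃ y, s(σ v, y) ∈ c v w :=
      fun w hw => (hc v w hw).exists_first
    choose! g hg using hfirst
    intro z hz
    -- At least three chains leave `σ v` through different edges, and the core has at most three
    -- edges there, so none is left out.
    obtain ⟨w, hw, hwz⟩ := Set.surj_on_of_inj_on_of_ncard_le (s := G.neighborSet v)
      (t := f.coreGraph.neighborSet (σ v)) (fun w _ => g w)
      (fun w hw => (hc v w hw).adj (hg w hw)) (fun w w' hw hw' he => by
        have h1 := hg w hw
        have h2 := hg w' hw'
        rw [show g w = g w' from he] at h1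
        have := hinj v w v w' hw hw' ((hc v w hw).eq_of_mem (hc v w' hw') h1 h2)
        rcases Sym2.eq_iff.1 this with ⟨-, h⟩ | ⟨h, -⟩
        · exact h
        · exact absurd h hw'.ne) ((hf.ncard_core_neighborSet_le _).trans (hG v))
      (finite_core_neighborSet f _) z hz
    exact ⟨v, w, hw, hwz ▸ hg w hw⟩
  have hall : ∀ x ∈ f.coreVertices, Q x := by
    intro x hx
    have hv₀ : σ v₀ ∈ f.skeletonVertices := (φ.symm v₀).2
    obtain ⟨p⟩ := hf.reachable_core hv₀.1 hx
    -- Coverage spreads over the connected core: a chain that enters a 2-valent vertex contains its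
    -- other edge too, and skeleton vertices are settled by `hsk`.
    have hstep : ∀ a b, f.coreGraph.Adj a b → Q a → Q b := by
      intro a b hab ha
      by_cases hb : f.IsTwoValent b
      · obtain ⟨v, w, hvw, hm⟩ := ha b hab
        rw [Sym2.eq_swap] at hm
        exact fun z hz => ⟨v, w, hvw, (hc v w hvw).mem_of_isTwoValent hb hm hz⟩
      · exact hsk b ⟨hab.2.1, hb⟩
    have : ∀ {a b} (p : f.coreGraph.Walk a b), Q a → Q b := by
      intro a b p
      induction p with
      | nil => exact id
      | cons h _ ih => exact fun ha => ih (hstep _ _ h ha)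
    exact this p (hsk _ hv₀)
  exact fun x y hxy => hall x hxy.1 y hxy

end TropicalPolynomial

/-! ### Crossing parity, a polygonal Jordan curve argument -/

namespace TropicalPolynomial

/-- A linear functional that is not constant on any segment of rational slope. -/
noncomputable def level (x : ℝ × ℝ) : ℝ := x.1 + √2 * x.2

theorem level_add (x y : ℝ × ℝ) : level (x + y) = level x + level y := by
  simp only [level, Prod.fst_add, Prod.snd_add]; ring

theorem level_smul (t : ℝ) (x : ℝ × ℝ) : level (t • x) = t * level x := by
  simp only [level, Prod.smul_fst, Prod.smul_snd, smul_eq_mul]; ring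

theorem level_sub (x y : ℝ × ℝ) : level (x - y) = level x - level y := by
  simp only [level, Prod.fst_sub, Prod.snd_sub]; ring

/-- A direction in which the functional `level` is constant. -/
noncomputable def levelDir : ℝ × ℝ := (-√2, 1)

theorem level_levelDir : level levelDir = 0 := by simp [level, levelDir]

theorem int_sqrt_two {p q : ℤ} (h : (p : ℝ) + √2 * q = 0) : p = 0 ∧ q = 0 := by
  by_cases hq : q = 0
  · subst hq
    simp at h
    exact ⟨h, rfl⟩
  · exfalso
    refine irrational_sqrt_two ⟨-(p : ℚ) / q, ?_⟩
    have hq' : (q : ℝ) ≠ 0 := by exact_mod_cast hq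
    push_cast
    rw [div_eq_iff hq']
    linarith

/-- Edge directions are integral and `√2` is irrational. So no edge of the curve is parallel to the
rays on which crossings are counted, and no degenerate position has to be treated. -/
theorem level_edgeDir_ne_zero {a b : ℤ × ℤ} (h : a ≠ b) : level (edgeDir a b) ≠ 0 := by
  intro h0
  simp only [level, edgeDir] at h0
  have := int_sqrt_two (p := -(b.2 - a.2)) (q := b.1 - a.1) (by push_cast; linarith)
  exact h (Prod.ext (by omega) (by omega))

theorem dot_levelDir_ne {a b : ℤ × ℤ} (h : a ≠ b) : dot a levelDir ≠ dot b levelDir := by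
  intro h0
  simp only [dot, levelDir] at h0
  have := int_sqrt_two (p := b.2 - a.2) (q := a.1 - b.1) (by push_cast; linarith)
  exact h (Prod.ext (by omega) (by omega))

/-- The ray that leaves `z` upward in the direction of constant level meets the segment from `x`
to `y` (where `level x < level y`, and the segment is half-open). -/
def Crosses (x y z : ℝ × ℝ) : Prop :=
  level x ≤ level z ∧ level z < level y ∧
    (level y - level x) * (z.2 - x.2) - (level z - level x) * (y.2 - x.2) < 0

/-- The region between the rays of constant level above `z` and above `z'`. -/
def IsAbove (z z' w : ℝ × ℝ) : Prop :=
  level z < level w ∧ level w ≤ level z' ∧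
    0 < (level z' - level z) * (w.2 - z.2) - (level w - level z) * (z'.2 - z.2)

theorem eq_of_level_eq {x y : ℝ × ℝ} (h : level x = level y) (h2 : x.2 = y.2) : x = y := by
  simp only [level, h2] at h
  exact Prod.ext (by linarith) h2

/-- If only one of the two rays met the segment from `x` to `y`, the meeting point would lie between
`z` and `z'`, contrary to `hdis`. -/
theorem crosses_iff_of_level_eq {x y z z' : ℝ × ℝ} (hzz : level z = level z')
    (hdis : ∀ s t : ℝ, 0 ≤ s → s ≤ 1 → 0 ≤ t → t ≤ 1 → x + s • (y - x) ≠ z + t • (z' - z)) :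
    Crosses x y z ↔ Crosses x y z' := by
  have key : ∀ z z' : ℝ × ℝ, level z = level z' →
      (∀ s t : ℝ, 0 ≤ s → s ≤ 1 → 0 ≤ t → t ≤ 1 → x + s • (y - x) ≠ z + t • (z' - z)) →
      Crosses x y z → Crosses x y z' := by
    rintro z z' hzz hdis ⟨h1, h2, h3⟩
    refine ⟨hzz ▸ h1, hzz ▸ h2, ?_⟩
    by_contra h4
    rw [← hzz] at h4
    push Not at h4
    set s := (level z - level x) / (level y - level x) with hs
    have hpos : 0 < level y - level x := by linarith
    have hs' : s * (level y - level x) = level z - level x := div_mul_cancel₀ _ hpos.ne'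
    have hs0 : 0 ≤ s := div_nonneg (by linarith) hpos.le
    have hs1 : s ≤ 1 := (div_le_one hpos).2 (by linarith)
    rw [← hs'] at h3 h4
    have g3 : z.2 < x.2 + s * (y.2 - x.2) := by
      by_contra hc
      push Not at hc
      nlinarith
    have g4 : x.2 + s * (y.2 - x.2) ≤ z'.2 := by
      by_contra hc
      push Not at hc
      nlinarith
    have hpos' : 0 < z'.2 - z.2 := by linarith
    set t := (x.2 + s * (y.2 - x.2) - z.2) / (z'.2 - z.2) with ht
    have ht' : t * (z'.2 - z.2) = x.2 + s * (y.2 - x.2) - z.2 := div_mul_cancel₀ _ hpos'.ne'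
    refine hdis s t hs0 hs1 (div_nonneg (by linarith) hpos'.le)
      ((div_le_one hpos').2 (by linarith)) (eq_of_level_eq ?_ ?_)
    · rw [level_add, level_add, level_smul, level_smul, level_sub, level_sub, hs', ← hzz]
      ring
    · simp only [Prod.snd_add, Prod.smul_snd, Prod.snd_sub, smul_eq_mul, ht']
      ring
  refine ⟨key z z' hzz hdis, key z' z hzz.symm fun s t h0 h1 h2 h3 h => ?_⟩
  refine hdis s (1 - t) h0 h1 (by linarith) (by linarith) (h.trans ?_)
  module

open Classical in
-- The segments are disjoint, so one is above the other over their whole common range of levels. If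
-- `x y` is above, both sides count ends of one level interval inside the other, and these numbers
-- agree mod 2; if it is below, all terms vanish.
theorem crosses_add_crosses {x y z z' : ℝ × ℝ} (hxy : level x < level y)
    (hzz : level z < level z')
    (hdis : ∀ s t : ℝ, 0 ≤ s → s ≤ 1 → 0 ≤ t → t ≤ 1 → x + s • (y - x) ≠ z + t • (z' - z)) :
    ((if Crosses x y z then 1 else 0) + (if Crosses x y z' then 1 else 0) : ZMod 2) =
      (if IsAbove z z' x then 1 else 0) + (if IsAbove z z' y then 1 else 0) := by
  have hp : 0 < level y - level x := by linarith
  have hq : 0 < level z' - level z := by linarith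
  -- the vertical distance between the two segments at a level, up to a positive factor
  set D : ℝ → ℝ := fun t => (level z' - level z) * ((level y - level x) * x.2 +
    (t - level x) * (y.2 - x.2)) - (level y - level x) * ((level z' - level z) * z.2 +
    (t - level z) * (z'.2 - z.2)) with hD
  have hne : ∀ t, level x ≤ t → t ≤ level y → level z ≤ t → t ≤ level z' → D t ≠ 0 := by
    intro t h1 h2 h3 h4 h0
    have e1 : (t - level x) / (level y - level x) * (level y - level x) = t - level x :=
      div_mul_cancel₀ _ hp.ne'
    have e2 : (t - level z) / (level z' - level z) * (level z' - level z) = t - level z :=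
      div_mul_cancel₀ _ hq.ne'
    refine hdis ((t - level x) / (level y - level x)) ((t - level z) / (level z' - level z))
      (div_nonneg (by linarith) hp.le) ((div_le_one hp).2 (by linarith))
      (div_nonneg (by linarith) hq.le) ((div_le_one hq).2 (by linarith)) (eq_of_level_eq ?_ ?_)
    · rw [level_add, level_add, level_smul, level_smul, level_sub, level_sub, e1, e2]
      ring
    · simp only [Prod.snd_add, Prod.smul_snd, Prod.snd_sub, smul_eq_mul]
      simp only [hD] at h0
      field_simp
      linarith
  have hsign : (∀ t, level x ≤ t → t ≤ level y → level z ≤ t → t ≤ level z' → 0 < D t) ∨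
      (∀ t, level x ≤ t → t ≤ level y → level z ≤ t → t ≤ level z' → D t < 0) := by
    by_contra hcon
    push Not at hcon
    obtain ⟨⟨t, h1, h2, h3, h4, h5⟩, ⟨u, g1, g2, g3, g4, g5⟩⟩ := hcon
    have hcont : Continuous D := by simp only [hD]; fun_prop
    obtain ⟨w, ⟨⟨hw1, hw2⟩, hw3, hw4⟩, hw⟩ :=
      (((Set.ordConnected_Icc (a := level x) (b := level y)).inter
        (Set.ordConnected_Icc (a := level z) (b := level z'))).isPreconnected).intermediate_value
        (a := t) (b := u) ⟨⟨h1, h2⟩, h3, h4⟩ ⟨⟨g1, g2⟩, g3, g4⟩ hcont.continuousOn ⟨h5, g5⟩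
    exact hne w hw1 hw2 hw3 hw4 hw
  have c1 : ∀ w : ℝ × ℝ, w = z ∨ w = z' → D (level w) = -(level z' - level z) *
      ((level y - level x) * (w.2 - x.2) - (level w - level x) * (y.2 - x.2)) := by
    rintro w (rfl | rfl) <;> simp only [hD] <;> ring
  have c2 : ∀ w : ℝ × ℝ, w = x ∨ w = y → D (level w) = (level y - level x) *
      ((level z' - level z) * (w.2 - z.2) - (level w - level z) * (z'.2 - z.2)) := by
    rintro w (rfl | rfl) <;> simp only [hD] <;> ring
  rcases hsign with hs | hs
  · have i1 : ∀ w, w = z ∨ w = z' → (Crosses x y w ↔ level x ≤ level w ∧ level w < level y) := by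
      intro w hw
      refine ⟨fun h => ⟨h.1, h.2.1⟩, fun h => ⟨h.1, h.2, ?_⟩⟩
      have := hs (level w) h.1 h.2.le (by rcases hw with rfl | rfl <;> linarith)
        (by rcases hw with rfl | rfl <;> linarith)
      rw [c1 w hw] at this
      by_contra hc
      push Not at hc
      nlinarith
    have i2 : ∀ w, w = x ∨ w = y → (IsAbove z z' w ↔ level z < level w ∧ level w ≤ level z') := by
      intro w hw
      refine ⟨fun h => ⟨h.1, h.2.1⟩, fun h => ⟨h.1, h.2, ?_⟩⟩
      have := hs (level w) (by rcases hw with rfl | rfl <;> linarith)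
        (by rcases hw with rfl | rfl <;> linarith) h.1.le h.2
      rw [c2 w hw] at this
      exact (mul_pos_iff_of_pos_left hp).1 this
    simp only [i1 z (Or.inl rfl), i1 z' (Or.inr rfl), i2 x (Or.inl rfl), i2 y (Or.inr rfl)]
    rcases le_or_gt (level x) (level z) with h1 | h1 <;>
    rcases le_or_gt (level y) (level z) with h2 | h2 <;>
    rcases le_or_gt (level x) (level z') with h3 | h3 <;>
    rcases le_or_gt (level y) (level z') with h4 | h4 <;>
    first
      | (exfalso; linarith)
      | (simp [h1, h2, h3, h4, not_le.2, not_lt.2]; try decide)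
  · have i1 : ∀ w, w = z ∨ w = z' → ¬ Crosses x y w := by
      rintro w hw ⟨h1, h2, h3⟩
      have := hs (level w) h1 h2.le (by rcases hw with rfl | rfl <;> linarith)
        (by rcases hw with rfl | rfl <;> linarith)
      rw [c1 w hw] at this
      nlinarith
    have i2 : ∀ w, w = x ∨ w = y → ¬ IsAbove z z' w := by
      rintro w hw ⟨h1, h2, h3⟩
      have := hs (level w) (by rcases hw with rfl | rfl <;> linarith)
        (by rcases hw with rfl | rfl <;> linarith) h1.le h2
      rw [c2 w hw] at this
      nlinarith
    simp [i1 z (Or.inl rfl), i1 z' (Or.inr rfl), i2 x (Or.inl rfl), i2 y (Or.inr rfl)]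

end TropicalPolynomial

namespace TropicalPolynomial

variable {f : TropicalPolynomial}

theorem mem_cell_segment {a : ℤ × ℤ} {x y : ℝ × ℝ} (hx : a ∈ f.cell x) (hy : a ∈ f.cell y) {t : ℝ}
    (h0 : 0 ≤ t) (h1 : t ≤ 1) : a ∈ f.cell (x + t • (y - x)) := by
  refine ⟨hx.1, fun b hb => ?_⟩
  have e : ∀ c, f.monomialValue c (x + t • (y - x)) =
      (1 - t) * f.monomialValue c x + t * f.monomialValue c y := by
    intro c
    simp only [monomialValue, Prod.fst_add, Prod.snd_add, Prod.smul_fst, Prod.smul_snd,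
      Prod.fst_sub, Prod.snd_sub, smul_eq_mul]
    ring
  rw [e, e]
  have i1 := mul_le_mul_of_nonneg_left (hx.2 b hb) (by linarith : 0 ≤ 1 - t)
  have i2 := mul_le_mul_of_nonneg_left (hy.2 b hb) h0
  linarith

/-- The points with the single minimal exponent `a` form a convex set. -/
theorem cell_segment_eq_singleton {a : ℤ × ℤ} {x y : ℝ × ℝ} (hx : f.cell x = {a})
    (hy : a ∈ f.cell y) {t : ℝ} (h0 : 0 ≤ t) (h1 : t < 1) : f.cell (x + t • (y - x)) = {a} := by
  have hax : a ∈ f.cell x := by simp [hx]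
  have ha := mem_cell_segment hax hy h0 h1.le
  ext b
  simp only [Set.mem_singleton_iff]
  refine ⟨fun hb => ?_, fun h => h ▸ ha⟩
  by_contra hba
  have h := value_eq_of_mem_cell ha hb
  have e : ∀ c, f.monomialValue c (x + t • (y - x)) =
      (1 - t) * f.monomialValue c x + t * f.monomialValue c y := by
    intro c
    simp only [monomialValue, Prod.fst_add, Prod.snd_add, Prod.smul_fst, Prod.smul_snd,
      Prod.fst_sub, Prod.snd_sub, smul_eq_mul]
    ring
  rw [e, e] at h
  have hlt := lt_value_of_notMem_cell hax hb.1 (by simp [hx, hba])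
  have i1 := mul_lt_mul_of_pos_left hlt (by linarith : 0 < 1 - t)
  have i2 := mul_le_mul_of_nonneg_left (hy.2 b hb.1) h0
  linarith

theorem exists_cell_nearby {a : ℤ × ℤ} {x d : ℝ × ℝ} (ha : a ∈ f.cell x)
    (hle : ∀ b ∈ f.cell x, dot a d ≤ dot b d) : ∃ ε : ℝ, 0 < ε ∧ ∀ t, 0 < t → t < ε →
      f.cell (x + t • d) = {b ∈ f.cell x | dot b d = dot a d} := by
  by_cases h : ∃ e ∈ f.support, dot e d < dot a d
  · obtain ⟨e, he, hlt⟩ := h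
    obtain ⟨τ, hτ, -, -, h⟩ := exists_cell_change ha hle he hlt
    exact ⟨τ, hτ, h⟩
  · push Not at h
    exact ⟨1, one_pos, fun t ht _ => cell_ray ha h ht⟩

open Classical in
/-- The parity of the number of edges of `H` above the point `z`. -/
noncomputable def crossingParity (f : TropicalPolynomial) (H : SimpleGraph (ℝ × ℝ)) (z : ℝ × ℝ) :
    ZMod 2 :=
  ∑ x ∈ (finite_curveVertices f).toFinset, ∑ y ∈ (finite_curveVertices f).toFinset,
    if H.Adj x y ∧ level x < level y then (if Crosses x y z then 1 else 0) else 0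

open Classical in
/-- Counting the ends of the edges of a graph with even degrees. -/
theorem sum_ends_eq_zero {H : SimpleGraph (ℝ × ℝ)} {V : Finset (ℝ × ℝ)}
    (hV : ∀ x y, H.Adj x y → y ∈ V) (hl : ∀ x y, H.Adj x y → level x ≠ level y)
    (heven : ∀ x, Even (H.neighborSet x).ncard) (R : ℝ × ℝ → Prop) :
    ∑ x ∈ V, ∑ y ∈ V, (if H.Adj x y ∧ level x < level y then
      ((if R x then 1 else 0) + (if R y then 1 else 0) : ZMod 2) else 0) = 0 := by
  have e1 : ∑ x ∈ V, ∑ y ∈ V, (if H.Adj x y ∧ level x < level y then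
      ((if R x then 1 else 0) + (if R y then 1 else 0) : ZMod 2) else 0) =
      ∑ x ∈ V, ∑ y ∈ V, (if H.Adj x y ∧ level x < level y then (if R x then 1 else 0) else 0) +
      ∑ x ∈ V, ∑ y ∈ V, (if H.Adj x y ∧ level x < level y then (if R y then 1 else 0) else 0) := by
    rw [← Finset.sum_add_distrib]
    refine Finset.sum_congr rfl fun x _ => ?_
    rw [← Finset.sum_add_distrib]
    refine Finset.sum_congr rfl fun y _ => ?_
    split_ifs <;> simp
  rw [e1, Finset.sum_comm (f := fun x y => if H.Adj x y ∧ level x < level y then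
    (if R y then (1 : ZMod 2) else 0) else 0), ← Finset.sum_add_distrib]
  refine Finset.sum_eq_zero fun x _ => ?_
  rw [← Finset.sum_add_distrib]
  have e2 : ∀ y ∈ V, ((if H.Adj x y ∧ level x < level y then (if R x then 1 else 0) else 0) +
      (if H.Adj y x ∧ level y < level x then (if R x then 1 else 0) else 0) : ZMod 2) =
      if H.Adj x y then (if R x then 1 else 0) else 0 := by
    intro y _
    by_cases h : H.Adj x y
    · rcases lt_or_gt_of_ne (hl x y h) with h' | h' <;> simp [h, h.symm, h', not_lt.2 h'.le]
    · have h' : ¬ H.Adj y x := fun h' => h h'.symm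
      simp [h, h']
  rw [Finset.sum_congr rfl e2, ← Finset.sum_filter, Finset.sum_const]
  have e3 : (H.neighborSet x).ncard = (V.filter (fun y => H.Adj x y)).card := by
    rw [← Set.ncard_coe_finset]
    congr 1
    ext y
    simp only [SimpleGraph.mem_neighborSet, Finset.coe_filter, Set.mem_ofPred_eq]
    exact ⟨fun h => ⟨hV x y h, h⟩, fun h => h.2⟩
  rw [← e3]
  obtain ⟨k, hk⟩ := heven x
  rw [hk, add_smul, CharTwo.add_self_eq_zero]

theorem IsSmooth.level_ne_of_adj (hf : f.IsSmooth) {x y : ℝ × ℝ} (h : f.curveGraph.Adj x y) :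
    level x ≠ level y := by
  obtain ⟨a, b, c, e, -, -, hd, -, -, ⟨τ, hτ, rfl⟩, -⟩ := hf.exists_cells_of_adj h
  intro h0
  rw [level_add, level_smul] at h0
  have : τ * level (edgeDir a b) = 0 := by linarith
  rcases mul_eq_zero.1 this with h1 | h1
  · exact hτ.ne' h1
  · exact level_edgeDir_ne_zero (doubleArea_ne_zero_left (c := c) (by rw [hd]; decide)) h1

/-- A point with a single minimal exponent does not lie on an edge of the curve. -/
theorem ne_of_cell_eq_singleton {x y z : ℝ × ℝ} {a : ℤ × ℤ} (h : f.curveGraph.Adj x y)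
    (hz : f.cell z = {a}) {s : ℝ} (h0 : 0 ≤ s) (h1 : s ≤ 1) : x + s • (y - x) ≠ z := by
  rintro rfl
  obtain ⟨-, -, -, b, ⟨hbx, hby⟩, c, ⟨hcx, hcy⟩, hbc⟩ := h
  have hb := mem_cell_segment hbx hby h0 h1
  have hc := mem_cell_segment hcx hcy h0 h1
  rw [hz] at hb hc
  exact hbc (hb.trans hc.symm)

/-- The segment from `z` to `z'` stays in the region of `a` and avoids the curve. Along it the count
changes by the number of edge ends of `H` above the segment, which is even because the degrees are.
-/
theorem IsSmooth.crossingParity_eq (hf : f.IsSmooth) {H : SimpleGraph (ℝ × ℝ)}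
    (hH : H ≤ f.curveGraph) (heven : ∀ x, Even (H.neighborSet x).ncard) {a : ℤ × ℤ}
    {z z' : ℝ × ℝ} (hz : f.cell z = {a}) (hz' : f.cell z' = {a}) :
    f.crossingParity H z = f.crossingParity H z' := by
  classical
  have hdis : ∀ {w w' : ℝ × ℝ}, f.cell w = {a} → f.cell w' = {a} → ∀ x y, H.Adj x y →
      ∀ s t : ℝ, 0 ≤ s → s ≤ 1 → 0 ≤ t → t ≤ 1 → x + s • (y - x) ≠ w + t • (w' - w) := by
    intro w w' hw hw' x y hxy s t h0 h1 h2 h3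
    rcases h3.eq_or_lt with rfl | h3
    · exact ne_of_cell_eq_singleton (hH hxy) (by simpa using hw') h0 h1
    · exact ne_of_cell_eq_singleton (hH hxy)
        (cell_segment_eq_singleton hw (by simp [hw']) h2 h3) h0 h1
  have main : ∀ {w w' : ℝ × ℝ}, f.cell w = {a} → f.cell w' = {a} → level w < level w' →
      f.crossingParity H w = f.crossingParity H w' := by
    intro w w' hw hw' hlt
    rw [← sub_eq_zero, CharTwo.sub_eq_add, crossingParity, crossingParity,
      ← Finset.sum_add_distrib]
    refine Eq.trans ?_ (sum_ends_eq_zero (H := H) (V := (finite_curveVertices f).toFinset)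
      (fun x y h => by simpa using (hH h).2.2.1) (fun x y h => hf.level_ne_of_adj (hH h)) heven
      (IsAbove w w'))
    refine Finset.sum_congr rfl fun x _ => ?_
    rw [← Finset.sum_add_distrib]
    refine Finset.sum_congr rfl fun y _ => ?_
    by_cases h : H.Adj x y ∧ level x < level y
    · rw [if_pos h, if_pos h, if_pos h]
      exact crosses_add_crosses h.2 hlt (hdis hw hw' x y h.1)
    · rw [if_neg h, if_neg h, if_neg h, add_zero]
  rcases lt_trichotomy (level z) (level z') with h | h | h
  · exact main hz hz' h
  · refine Finset.sum_congr rfl fun x _ => Finset.sum_congr rfl fun y _ => ?_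
    by_cases hxy : H.Adj x y ∧ level x < level y
    · rw [if_pos hxy, if_pos hxy]
      simp only [crosses_iff_of_level_eq h (hdis hz hz' x y hxy.1)]
    · rw [if_neg hxy, if_neg hxy]
  · exact (main hz' hz h).symm

/-- The region of a non-interior exponent contains a ray. Far out on it either no edge lies above
the point, or every edge that meets its level does; in the second case the count is again a sum over
vertices of even degree. -/
theorem IsSmooth.crossingParity_eq_zero (hf : f.IsSmooth) {H : SimpleGraph (ℝ × ℝ)}
    (hH : H ≤ f.curveGraph) (heven : ∀ x, Even (H.neighborSet x).ncard) {a : ℤ × ℤ}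
    (ha : a ∉ f.interiorExponents) {z : ℝ × ℝ} (hz : f.cell z = {a}) :
    f.crossingParity H z = 0 := by
  classical
  simp only [interiorExponents, Set.mem_ofPred_eq, not_forall] at ha
  obtain ⟨d, hd, hsup⟩ := ha
  push Not at hsup
  have haz : a ∈ f.cell z := by simp [hz]
  have hray : ∀ t : ℝ, 0 < t → f.crossingParity H z = f.crossingParity H (z + t • d) := by
    intro t ht
    refine hf.crossingParity_eq hH heven hz ?_
    rw [cell_ray haz hsup ht, hz]
    ext b
    simp only [Set.mem_singleton_iff, Set.mem_ofPred_eq]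
    exact ⟨fun h => h.1, fun h => ⟨h, by rw [h]⟩⟩
  set V := (finite_curveVertices f).toFinset with hV
  have hall : ∀ P : ℝ → ℝ × ℝ → ℝ × ℝ → Prop,
      (∀ x y, ∀ᶠ t in Filter.atTop, P t x y) →
      ∃ t : ℝ, 0 < t ∧ ∀ x ∈ V, ∀ y ∈ V, P t x y := by
    intro P hP
    have h1 : ∀ᶠ t in Filter.atTop, ∀ x ∈ V, ∀ y ∈ V, P t x y :=
      (Filter.eventually_all_finset V).2 fun x _ => (Filter.eventually_all_finset V).2 fun y _ =>
        hP x y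
    obtain ⟨t, ht, ht0⟩ := (h1.and (Filter.eventually_gt_atTop 0)).exists
    exact ⟨t, ht0, ht⟩
  have hlin : ∀ k c : ℝ, 0 < k → ∀ᶠ t in Filter.atTop, c < t * k := by
    intro k c hk
    filter_upwards [Filter.eventually_gt_atTop (c / k)] with t ht
    exact (div_lt_iff₀ hk).1 ht
  have hzero : ∀ t : ℝ, 0 < t → (∀ x ∈ V, ∀ y ∈ V, level x < level y → ¬ Crosses x y (z + t • d)) →
      f.crossingParity H z = 0 := by
    intro t ht h
    rw [hray t ht]
    refine Finset.sum_eq_zero fun x hx => Finset.sum_eq_zero fun y hy => ?_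
    split_ifs with h1 h2
    · exact absurd h2 (h x hx y hy h1.2)
    · rfl
    · rfl
  rcases lt_trichotomy (level d) 0 with h | h | h
  · obtain ⟨t, ht, hP⟩ := hall (fun t x _ => level (z + t • d) < level x) fun x _ => by
      filter_upwards [hlin (-level d) (level z - level x) (by linarith)] with t ht
      rw [level_add, level_smul]
      linarith
    exact hzero t ht fun x hx y hy _ hc => by linarith [hP x hx y hy, hc.1]
  · have hd2 : d.2 ≠ 0 := by
      intro h2
      apply hd
      exact eq_of_level_eq (by simpa [level] using h) h2
    have hlev : ∀ t : ℝ, level (z + t • d) = level z := fun t => by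
      rw [level_add, level_smul, h, mul_zero, add_zero]
    rcases lt_or_gt_of_ne hd2 with h2 | h2
    · obtain ⟨t, ht, hP⟩ := hall (fun t x y => level x < level y →
          (Crosses x y (z + t • d) ↔ level x ≤ level z ∧ level z < level y)) fun x y => by
        by_cases hxy : level x < level y
        · filter_upwards [hlin ((level y - level x) * -d.2)
            ((level y - level x) * (z.2 - x.2) - (level z - level x) * (y.2 - x.2))
            (mul_pos (by linarith) (by linarith))] with t ht _
          rw [Crosses, hlev]
          refine ⟨fun h => ⟨h.1, h.2.1⟩, fun h => ⟨h.1, h.2, ?_⟩⟩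
          simp only [Prod.snd_add, Prod.smul_snd, smul_eq_mul]
          linarith
        · exact Filter.Eventually.of_forall fun t h => absurd h hxy
      rw [hray t ht, crossingParity]
      refine Eq.trans ?_ (sum_ends_eq_zero (H := H) (V := V)
        (fun x y h => by simpa [hV] using (hH h).2.2.1)
        (fun x y h => hf.level_ne_of_adj (hH h)) heven (fun w => level w ≤ level z))
      refine Finset.sum_congr rfl fun x hx => Finset.sum_congr rfl fun y hy => ?_
      by_cases hxy : H.Adj x y ∧ level x < level y
      · rw [if_pos hxy, if_pos hxy]
        simp only [hP x hx y hy hxy.2]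
        have hlt := hxy.2
        rcases le_or_gt (level x) (level z) with h1 | h1 <;>
        rcases le_or_gt (level y) (level z) with h2 | h2 <;>
        first
          | (exfalso; linarith)
          | (simp [h1, h2, not_le.2, not_lt.2]; try decide)
      · rw [if_neg hxy, if_neg hxy]
    · obtain ⟨t, ht, hP⟩ := hall (fun t x y => level x < level y → ¬ Crosses x y (z + t • d))
        fun x y => by
        by_cases hxy : level x < level y
        · filter_upwards [hlin ((level y - level x) * d.2)
            (-((level y - level x) * (z.2 - x.2) - (level z - level x) * (y.2 - x.2)))
            (mul_pos (by linarith) h2)] with t ht _ hc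
          have := hc.2.2
          rw [hlev] at this
          simp only [Prod.snd_add, Prod.smul_snd, smul_eq_mul] at this
          linarith
        · exact Filter.Eventually.of_forall fun t h => absurd h hxy
      exact hzero t ht hP
  · obtain ⟨t, ht, hP⟩ := hall (fun t _ y => level y < level (z + t • d)) fun _ y => by
      filter_upwards [hlin (level d) (level y - level z) h] with t ht
      rw [level_add, level_smul]
      linarith
    exact hzero t ht fun x hx y hy _ hc => by linarith [hP x hx y hy, hc.2.1]

/-- Crossing an edge of the curve changes the parity if and only if the edge belongs to `H`. -/
theorem IsSmooth.exists_crossing (hf : f.IsSmooth) {H : SimpleGraph (ℝ × ℝ)}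
    (hH : H ≤ f.curveGraph) {x y : ℝ × ℝ} (h : f.curveGraph.Adj x y) :
    ∃ a b z z', a ≠ b ∧ f.cell x ∩ f.cell y = {a, b} ∧ f.cell z = {a} ∧ f.cell z' = {b} ∧
      (H.Adj x y ↔ f.crossingParity H z + f.crossingParity H z' = 1) := by
  classical
  wlog hlt : level x < level y generalizing x y
  · obtain ⟨a, b, z, z', h1, h2, h3, h4, h5⟩ := this h.symm
      (lt_of_le_of_ne (not_lt.1 hlt) (hf.level_ne_of_adj h).symm)
    exact ⟨a, b, z, z', h1, by rw [Set.inter_comm]; exact h2, h3, h4, by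
      rw [H.adj_comm]; exact h5⟩
  obtain ⟨a₀, b₀, c, e, hcx, hcy, hd, he, hint₀, ⟨τ, hτ, hyx⟩, hseg₀⟩ := hf.exists_cells_of_adj h
  have hab₀ : a₀ ≠ b₀ := doubleArea_ne_zero_left (c := c) (by rw [hd]; decide)
  -- The two exponents are ordered so that the region of `a` is the one above the edge.
  obtain ⟨a, b, hab, hint, hseg, hdot⟩ : ∃ a b, a ≠ b ∧ f.cell x ∩ f.cell y = {a, b} ∧
      (∀ t : ℝ, 0 < t → t < 1 → f.cell (x + t • (y - x)) = {a, b}) ∧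
      dot a levelDir < dot b levelDir := by
    rcases lt_or_gt_of_ne (dot_levelDir_ne hab₀) with h1 | h1
    · exact ⟨a₀, b₀, hab₀, hint₀, hseg₀, h1⟩
    · exact ⟨b₀, a₀, hab₀.symm, by rw [hint₀, Set.pair_comm], fun t h0 h1 => by
        rw [hseg₀ t h0 h1, Set.pair_comm], h1⟩
  clear hseg₀ hint₀
  -- The points `z` and `z'` are chosen just above and just below the midpoint `m`, so close that `x
  -- y` is the only edge of the curve between them. Then all other edges contribute equally to both
  -- counts.
  set m := x + (1 / 2 : ℝ) • (y - x) with hm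
  have hcm : f.cell m = {a, b} := hseg _ (by norm_num) (by norm_num)
  obtain ⟨ε, hε, hε'⟩ := exists_cell_nearby (f := f) (a := a) (x := m) (d := levelDir)
    (by simp [hcm]) (by rw [hcm]; rintro u (rfl | rfl); exacts [le_rfl, hdot.le])
  obtain ⟨δ, hδ, hδ'⟩ := exists_cell_nearby (f := f) (a := b) (x := m) (d := -levelDir)
    (by simp [hcm]) (by
      rw [hcm]
      rintro u (rfl | rfl)
      · rw [dot_neg, dot_neg]; linarith
      · exact le_rfl)
  have up : ∀ t, 0 < t → t < ε → f.cell (m + t • levelDir) = {a} := by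
    intro t h0 h1
    rw [hε' t h0 h1, hcm]
    ext u
    simp only [Set.mem_insert_iff, Set.mem_singleton_iff, Set.mem_ofPred_eq]
    constructor
    · rintro ⟨rfl | rfl, h2⟩
      · rfl
      · exact absurd h2 hdot.ne'
    · rintro rfl
      simp
  have down : ∀ t, 0 < t → t < δ → f.cell (m + t • -levelDir) = {b} := by
    intro t h0 h1
    rw [hδ' t h0 h1, hcm]
    ext u
    simp only [Set.mem_insert_iff, Set.mem_singleton_iff, Set.mem_ofPred_eq, dot_neg, neg_inj]
    constructor
    · rintro ⟨rfl | rfl, h2⟩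
      · exact absurd h2 hdot.ne
      · rfl
    · rintro rfl
      simp
  set r := min ε δ / 2 with hr
  have hr0 : 0 < r := by positivity
  have hrε : r < ε := by
    have := min_le_left ε δ
    have : 0 < min ε δ := lt_min hε hδ
    rw [hr]; linarith
  have hrδ : r < δ := by
    have := min_le_right ε δ
    have : 0 < min ε δ := lt_min hε hδ
    rw [hr]; linarith
  refine ⟨a, b, m + r • levelDir, m + r • -levelDir, hab, hint, up r hr0 hrε, down r hr0 hrδ, ?_⟩
  have hlevz : level (m + r • levelDir) = level m := by
    rw [level_add, level_smul, level_levelDir, mul_zero, add_zero]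
  have hlevz' : level (m + r • -levelDir) = level m := by
    rw [smul_neg, level_add, ← neg_smul, level_smul, level_levelDir, mul_zero, add_zero]
  have hax : a ∈ f.cell x ∩ f.cell y := by rw [hint]; simp
  have hbx : b ∈ f.cell x ∩ f.cell y := by rw [hint]; simp
  have hother : ∀ p q, H.Adj p q → level p < level q → ¬ (p = x ∧ q = y) →
      (Crosses p q (m + r • levelDir) ↔ Crosses p q (m + r • -levelDir)) := by
    intro p q hpq hl hne
    refine crosses_iff_of_level_eq (hlevz.trans hlevz'.symm) fun s t h0 h1 h2 h3 heq => ?_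
    have hpt : m + r • levelDir + t • (m + r • -levelDir - (m + r • levelDir)) =
        m + (r - 2 * r * t) • levelDir := by module
    rw [hpt] at heq
    rcases lt_trichotomy (r - 2 * r * t) 0 with hs | hs | hs
    · refine ne_of_cell_eq_singleton (hH hpq) (down (-(r - 2 * r * t)) (by linarith)
        (by nlinarith)) h0 h1 (heq.trans ?_)
      rw [smul_neg, neg_smul, neg_neg]
    · rw [hs, zero_smul, add_zero] at heq
      obtain ⟨hpq', hp, hq, u, ⟨hup, huq⟩, v, ⟨hvp, hvq⟩, huv⟩ := hH hpq
      have hu := mem_cell_segment hup huq h0 h1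
      have hv := mem_cell_segment hvp hvq h0 h1
      rw [heq, hcm] at hu hv
      have hsub : a ∈ f.cell p ∧ b ∈ f.cell p ∧ a ∈ f.cell q ∧ b ∈ f.cell q := by
        rcases hu with rfl | rfl <;> rcases hv with rfl | rfl
        · exact absurd rfl huv
        · exact ⟨hup, hvp, huq, hvq⟩
        · exact ⟨hvp, hup, hvq, huq⟩
        · exact absurd rfl huv
      have key : ∀ w, w ∈ f.curveVertices → a ∈ f.cell w → b ∈ f.cell w → w = x ∨ w = y := by
        intro w hw haw hbw
        by_cases hxw : x = w
        · exact Or.inl hxw.symm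
        · exact Or.inr (hf.eq_of_mem hab h.2.1 hw h.2.2.1 hxw h.1 hax.1 hbx.1 haw hbw hax.2 hbx.2)
      rcases key p hp hsub.1 hsub.2.1 with rfl | rfl <;>
      rcases key q hq hsub.2.2.1 hsub.2.2.2 with rfl | rfl
      · exact hpq' rfl
      · exact hne ⟨rfl, rfl⟩
      · linarith
      · exact hpq' rfl
    · exact ne_of_cell_eq_singleton (hH hpq) (up (r - 2 * r * t) hs (by nlinarith)) h0 h1 heq
  have hlm : level m = level x + 1 / 2 * (level y - level x) := by
    rw [hm, level_add, level_smul, level_sub]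
  have hcz : ¬ Crosses x y (m + r • levelDir) := by
    rintro ⟨-, -, h3⟩
    rw [hlevz, hlm] at h3
    simp only [hm, levelDir, Prod.snd_add, Prod.smul_snd, Prod.snd_sub, smul_eq_mul] at h3
    nlinarith
  have hcz' : Crosses x y (m + r • -levelDir) := by
    refine ⟨?_, ?_, ?_⟩
    · rw [hlevz', hlm]; linarith
    · rw [hlevz', hlm]; linarith
    · rw [hlevz', hlm]
      simp only [hm, levelDir, Prod.snd_add, Prod.smul_snd, Prod.snd_sub, smul_eq_mul, Prod.snd_neg]
      nlinarith
  have hsum : f.crossingParity H (m + r • levelDir) + f.crossingParity H (m + r • -levelDir) =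
      if H.Adj x y then 1 else 0 := by
    rw [crossingParity, crossingParity, ← Finset.sum_add_distrib]
    rw [Finset.sum_eq_single_of_mem x (by simpa using h.2.1)]
    · rw [← Finset.sum_add_distrib, Finset.sum_eq_single_of_mem y (by simpa using h.2.2.1)]
      · simp only [hlt, and_true, if_neg hcz, if_pos hcz', ite_self, zero_add]
      · intro q _ hq
        split_ifs with h1 h2 h3 h3
        · decide
        · exact absurd ((hother x q h1.1 h1.2 (by simp [hq])).1 h2) h3
        · exact absurd ((hother x q h1.1 h1.2 (by simp [hq])).2 h3) h2
        · simp
        · simp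
    · intro p _ hp
      rw [← Finset.sum_add_distrib]
      refine Finset.sum_eq_zero fun q _ => ?_
      split_ifs with h1 h2 h3 h3
      · decide
      · exact absurd ((hother p q h1.1 h1.2 (by simp [hp])).1 h2) h3
      · exact absurd ((hother p q h1.1 h1.2 (by simp [hp])).2 h3) h2
      · simp
      · simp
  rw [hsum]
  split_ifs with h1 <;> simp [h1]

/-- A subgraph of the curve with even degrees is the boundary of a set of regions. -/
theorem IsSmooth.exists_potential (hf : f.IsSmooth) {H : SimpleGraph (ℝ × ℝ)}
    (hH : H ≤ f.curveGraph) (heven : ∀ x, Even (H.neighborSet x).ncard) :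
    ∃ T : Set (ℤ × ℤ), T ⊆ f.interiorExponents ∧ ∀ x y a b, f.curveGraph.Adj x y → a ≠ b →
      a ∈ f.cell x → a ∈ f.cell y → b ∈ f.cell x → b ∈ f.cell y →
      (H.Adj x y ↔ ¬ (a ∈ T ↔ b ∈ T)) := by
  refine ⟨{a | ∃ z, f.cell z = {a} ∧ f.crossingParity H z = 1}, ?_, ?_⟩
  · rintro a ⟨z, hz, h1⟩
    by_contra hcon
    rw [hf.crossingParity_eq_zero hH heven hcon hz] at h1
    exact absurd h1 (by decide)
  · have hT : ∀ {a z}, f.cell z = {a} →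
        ((∃ z, f.cell z = {a} ∧ f.crossingParity H z = 1) ↔ f.crossingParity H z = 1) := by
      intro a z hz
      refine ⟨fun ⟨z', hz', h⟩ => ?_, fun h => ⟨z, hz, h⟩⟩
      rw [hf.crossingParity_eq hH heven hz hz', h]
    intro x y a b h hab hax hay hbx hby
    obtain ⟨a', b', z, z', hab', hint, hz, hz', hiff⟩ := hf.exists_crossing hH h
    have ha : a ∈ f.cell x ∩ f.cell y := ⟨hax, hay⟩
    have hb : b ∈ f.cell x ∩ f.cell y := ⟨hbx, hby⟩
    rw [hint] at ha hb
    have hz2 : ∀ u v : ZMod 2, (u + v = 1 ↔ ¬ (u = 1 ↔ v = 1)) := by decide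
    rw [hiff, hz2]
    simp only [Set.mem_ofPred_eq]
    rcases ha with rfl | rfl <;> rcases hb with rfl | rfl
    · exact absurd rfl hab
    · rw [hT hz, hT hz']
    · rw [hT hz, hT hz', iff_comm (a := f.crossingParity H z' = 1)]
    · exact absurd rfl hab

/-- A set of bounded regions without boundary is empty. -/
theorem IsSmooth.eq_empty_of_closed (hf : f.IsSmooth) {T : Set (ℤ × ℤ)}
    (hT : T ⊆ f.interiorExponents)
    (h : ∀ x y a b, f.curveGraph.Adj x y → a ≠ b → a ∈ f.cell x → a ∈ f.cell y → b ∈ f.cell x →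
      b ∈ f.cell y → a ∈ T → b ∈ T) : T = ∅ := by
  by_contra hne
  obtain ⟨a₀, ha₀⟩ := Set.nonempty_iff_ne_empty.2 hne
  set L : Set (ℝ × ℝ) := {x ∈ f.curveVertices | ∃ a ∈ f.cell x, a ∈ T} with hL
  have hLf : L.Finite := (finite_curveVertices f).subset fun x hx => hx.1
  obtain ⟨x₀, hx₀, hax₀⟩ := hf.exists_vertex_of_interior (hT ha₀)
  -- At the highest vertex that touches `T` all three exponents lie in `T`, so its three edges are
  -- bounded and lead downwards. But the three directions `edgeDir` around a triangle add up to
  -- zero.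
  obtain ⟨x, ⟨hxV, a, ha, haT⟩, hmax⟩ := hLf.exists_maximalFor level L ⟨x₀, hx₀, a₀, hax₀, ha₀⟩
  obtain ⟨b, c, hc, hd⟩ := (hf.unimodular hxV).exists_others ha
  have hne3 := ne_of_doubleArea_ne_zero (a := a) (b := b) (c := c) (by rw [hd]; decide)
  have hbx : b ∈ f.cell x := by simp [hc]
  have hcx : c ∈ f.cell x := by simp [hc]
  obtain ⟨y, hy, hay, hby⟩ := hf.exists_adj_of_interior hxV ha hbx hne3.1 (hT haT)
  obtain ⟨z, hz, haz, hcz⟩ := hf.exists_adj_of_interior hxV ha hcx hne3.2.2 (hT haT)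
  have hbT : b ∈ T := h x y a b hy hne3.1 ha hay hbx hby haT
  have hcT : c ∈ T := h x z a c hz hne3.2.2 ha haz hcx hcz haT
  have hle : ∀ p q r, p ∈ T → f.cell x = {p, q, r} → doubleArea p q r = 1 →
      level (edgeDir p q) < 0 := by
    intro p q r hp hr hdr
    have hpq := doubleArea_ne_zero_left (a := p) (b := q) (c := r) (by rw [hdr]; decide)
    obtain ⟨e, he, hlt⟩ := hT hp _ (edgeDir_ne_zero hpq)
    obtain ⟨w, hw, hpw, hqw, ⟨τ, hτ, rfl⟩, -⟩ := exists_adj_of_neg hr (by rw [hdr]; decide) he (by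
      have := dot_edgeDir p q e
      have h2 : (doubleArea p q e : ℝ) < 0 := by linarith
      exact_mod_cast h2)
    refine lt_of_le_of_ne ?_ (level_edgeDir_ne_zero hpq)
    by_contra hcon
    push Not at hcon
    have hlt : level x < level (x + τ • edgeDir p q) := by
      rw [level_add, level_smul]; nlinarith
    have := hmax (j := x + τ • edgeDir p q) ⟨hw.2.2.1, p, hpw, hp⟩ hlt.le
    linarith
  have k1 := hle a b c haT hc hd
  have k2 := hle b c a hbT (by rw [hc]; ext; simp; tauto) (by rw [doubleArea_rotate]; exact hd)
  have k3 := hle c a b hcT (by rw [hc]; ext; simp; tauto)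
    (by rw [doubleArea_rotate, doubleArea_rotate]; exact hd)
  simp only [level, edgeDir] at k1 k2 k3
  linarith

end TropicalPolynomial

/-! ### Peripheral cycles and the regions they bound -/

namespace TropicalPolynomial

variable {f : TropicalPolynomial} {W : Type*} {G : SimpleGraph W} {σ : W → ℝ × ℝ}
  {c : W → W → Set (Sym2 (ℝ × ℝ))} {X : Set W}

/-- A set of vertices that induces a cycle with connected complement. -/
structure IsPeripheral (G : SimpleGraph W) (X : Set W) : Prop where
  nonempty : X.Nonempty
  ncard_eq : ∀ v ∈ X, (G.neighborSet v ∩ X).ncard = 2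
  connected : ∀ P : W → Prop, (∀ u ∈ X, ∀ w ∈ X, G.Adj u w → P u → P w) →
    ∀ u ∈ X, ∀ w ∈ X, P u → P w
  compl_connected : ∀ P : W → Prop, (∀ u ∉ X, ∀ w ∉ X, G.Adj u w → P u → P w) →
    ∀ u ∉ X, ∀ w ∉ X, P u → P w

/-- The part of the curve over the subgraph of `G` induced by `X`. -/
def inducedPart (f : TropicalPolynomial) (G : SimpleGraph W) (c : W → W → Set (Sym2 (ℝ × ℝ)))
    (X : Set W) : SimpleGraph (ℝ × ℝ) where
  Adj x y := f.coreGraph.Adj x y ∧ ∃ u ∈ X, ∃ w ∈ X, G.Adj u w ∧ s(x, y) ∈ c u w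
  symm := ⟨fun x y h => ⟨h.1.symm, by rw [Sym2.eq_swap]; exact h.2⟩⟩
  loopless := ⟨fun x h => h.1.ne rfl⟩

/-- `B` is a set of exponents whose dual region has the boundary `H`. -/
def IsBoundary (f : TropicalPolynomial) (H : SimpleGraph (ℝ × ℝ)) (B : Set (ℤ × ℤ)) : Prop :=
  ∀ x y a b, f.curveGraph.Adj x y → a ≠ b → a ∈ f.cell x → a ∈ f.cell y → b ∈ f.cell x →
    b ∈ f.cell y → (H.Adj x y ↔ ¬ (a ∈ B ↔ b ∈ B))

theorem IsBoundary.compl {H : SimpleGraph (ℝ × ℝ)} {B : Set (ℤ × ℤ)} (h : f.IsBoundary H B) :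
    f.IsBoundary H Bᶜ := by
  intro x y a b h1 h2 h3 h4 h5 h6
  rw [h x y a b h1 h2 h3 h4 h5 h6, Set.mem_compl_iff, Set.mem_compl_iff,
    not_iff_not (a := a ∈ B)]

theorem inducedPart_le : f.inducedPart G c X ≤ f.curveGraph := fun _ _ h => h.1.2.2

theorem inducedPart_adj_iff (h : f.IsSubdivision G σ c) {u w : W} (huw : G.Adj u w) {x y : ℝ × ℝ}
    (hxy : s(x, y) ∈ c u w) : (f.inducedPart G c X).Adj x y ↔ u ∈ X ∧ w ∈ X := by
  constructor
  · rintro ⟨-, u', hu', w', hw', huw', hm⟩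
    have he := (h.isChain u w huw).eq_of_mem (h.isChain u' w' huw') hxy hm
    rcases Sym2.eq_iff.1 (h.eq_of_eq u w u' w' huw huw' he) with ⟨rfl, rfl⟩ | ⟨rfl, rfl⟩
    · exact ⟨hu', hw'⟩
    · exact ⟨hw', hu'⟩
  · exact fun hX => ⟨(h.isChain u w huw).adj hxy, u, hX.1, w, hX.2, huw, hxy⟩

/-- A chain contains both edges or none at a 2-valent vertex. At `σ v` with `v ∈ X` the edges
correspond to the neighbours of `v` in `X`, of which there are two. -/
theorem inducedPart_even (h : f.IsSubdivision G σ c) (hX : IsPeripheral G X) (x : ℝ × ℝ) :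
    Even ((f.inducedPart G c X).neighborSet x).ncard := by
  by_cases hne : ((f.inducedPart G c X).neighborSet x).Nonempty
  · obtain ⟨y, hxy, u, hu, w, hw, huw, hm⟩ := hne
    have hc := h.isChain u w huw
    by_cases hx : f.IsTwoValent x
    · suffices he : (f.inducedPart G c X).neighborSet x = f.coreGraph.neighborSet x by
        rw [he, hx]; exact even_two
      ext z
      exact ⟨fun hz => hz.1, fun hz => (inducedPart_adj_iff h huw
        (hc.mem_of_isTwoValent hx hm hz)).2 ⟨hu, hw⟩⟩
    · have hxs : x ∈ f.skeletonVertices := ⟨hxy.1, hx⟩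
      obtain ⟨v, hv, rfl⟩ : ∃ v ∈ X, x = σ v := by
        rcases hc.eq_or_eq_of_mem hm hxs with rfl | rfl
        exacts [⟨u, hu, rfl⟩, ⟨w, hw, rfl⟩]
      have hfirst : ∀ w ∈ G.neighborSet v, ∃ y, s(σ v, y) ∈ c v w :=
        fun w hw => (h.isChain v w hw).exists_first
      choose! g hg using hfirst
      have himg : (f.inducedPart G c X).neighborSet (σ v) = g '' (G.neighborSet v ∩ X) := by
        ext z
        constructor
        · rintro ⟨-, u', hu', w', hw', huw', hm'⟩
          have key : ∀ w' ∈ X, G.Adj v w' → s(σ v, z) ∈ c v w' →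
              z ∈ g '' (G.neighborSet v ∩ X) := by
            intro w' hw' hvw hm'
            refine ⟨w', ⟨hvw, hw'⟩, ?_⟩
            exact (h.isChain v w' hvw).first_unique (fun he => hvw.ne (h.injective he))
              (hg w' hvw) hm'
          rcases (h.isChain u' w' huw').eq_or_eq_of_mem hm' hxs with he | he
          · have := h.injective he
            subst this
            exact key w' hw' huw' hm'
          · have := h.injective he
            subst this
            exact key u' hu' huw'.symm (by rw [h.symm _ _ huw'.symm]; exact hm')
        · rintro ⟨w', ⟨hvw, hw'⟩, rfl⟩
          exact (inducedPart_adj_iff h hvw (hg w' hvw)).2 ⟨hv, hw'⟩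
      rw [himg, Set.InjOn.ncard_image, hX.ncard_eq v hv]
      · exact even_two
      · intro w₁ h₁ w₂ h₂ he
        have m1 := hg w₁ h₁.1
        have m2 := hg w₂ h₂.1
        rw [show g w₁ = g w₂ from he] at m1
        have := h.eq_of_eq v w₁ v w₂ h₁.1 h₂.1
          ((h.isChain v w₁ h₁.1).eq_of_mem (h.isChain v w₂ h₂.1) m1 m2)
        rcases Sym2.eq_iff.1 this with ⟨-, h'⟩ | ⟨h', -⟩
        · exact h'
        · exact absurd h' h₂.1.ne
  · rw [Set.not_nonempty_iff_eq_empty.1 hne, Set.ncard_empty]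
    exact Even.zero

theorem IsSmooth.inter_eq (hf : f.IsSmooth) {x y : ℝ × ℝ} {a b : ℤ × ℤ}
    (h : f.curveGraph.Adj x y) (hab : a ≠ b) (hax : a ∈ f.cell x) (hay : a ∈ f.cell y)
    (hbx : b ∈ f.cell x) (hby : b ∈ f.cell y) : f.cell x ∩ f.cell y = {a, b} := by
  obtain ⟨p, q, -, -, -, -, -, -, hint, -⟩ := hf.exists_cells_of_adj h
  have ha : a ∈ f.cell x ∩ f.cell y := ⟨hax, hay⟩
  have hb : b ∈ f.cell x ∩ f.cell y := ⟨hbx, hby⟩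
  rw [hint] at ha hb ⊢
  rcases ha with rfl | rfl <;> rcases hb with rfl | rfl
  · exact absurd rfl hab
  · rfl
  · exact Set.pair_comm _ _
  · exact absurd rfl hab

/-- Both edges are dual to sides of the triangle at `z`, and two sides of a triangle share a corner.
-/
theorem IsSmooth.exists_common (hf : f.IsSmooth) {x y z : ℝ × ℝ} (h : f.curveGraph.Adj x z)
    (h' : f.curveGraph.Adj z y) : ∃ s, s ∈ f.cell x ∧ s ∈ f.cell z ∧ s ∈ f.cell y := by
  obtain ⟨a, b, d, e, hx, hz, -⟩ := hf.exists_cells_of_adj h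
  obtain ⟨-, -, -, p, ⟨hpz, hpy⟩, q, ⟨hqz, hqy⟩, hpq⟩ := h'
  have hpz' := hpz
  have hqz' := hqz
  rw [hz] at hpz' hqz'
  rw [hx]
  rcases hpz' with rfl | rfl | rfl
  · exact ⟨p, by simp, hpz, hpy⟩
  · exact ⟨p, by simp, hpz, hpy⟩
  · rcases hqz' with rfl | rfl | rfl
    · exact ⟨q, by simp, hqz, hqy⟩
    · exact ⟨q, by simp, hqz, hqy⟩
    · exact absurd rfl hpq

/-- Along a chain outside `H` the colour does not change. -/
theorem IsSmooth.inter_subset_of_chain (hf : f.IsSmooth) (h : f.IsSubdivision G σ c)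
    {B : Set (ℤ × ℤ)} (hB : f.IsBoundary (f.inducedPart G c X) B) {u w : W} (huw : G.Adj u w)
    (hX : ¬ (u ∈ X ∧ w ∈ X)) {x y x' y' : ℝ × ℝ} (hxy : s(x, y) ∈ c u w)
    (hxy' : s(x', y') ∈ c u w) (hsub : f.cell x ∩ f.cell y ⊆ B) : f.cell x' ∩ f.cell y' ⊆ B := by
  have hc := h.isChain u w huw
  refine hc.induction hxy (P := fun d => ∀ x y, d = s(x, y) → f.cell x ∩ f.cell y ⊆ B) ?_ ?_
    _ hxy' x' y' rfl
  · intro p q he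
    rcases Sym2.eq_iff.1 he with ⟨rfl, rfl⟩ | ⟨rfl, rfl⟩
    · exact hsub
    · rw [Set.inter_comm]; exact hsub
  · intro p z q _ hpz hzq hP
    have hP := hP p z rfl
    have key : f.cell z ∩ f.cell q ⊆ B := by
      rintro b ⟨hbz, hbq⟩
      obtain ⟨s, hsp, hsz, hsq⟩ := hf.exists_common (hc.adj hpz).2.2 (hc.adj hzq).2.2
      have hs : s ∈ B := hP ⟨hsp, hsz⟩
      by_cases hsb : s = b
      · exact hsb ▸ hs
      · have := (hB z q s b (hc.adj hzq).2.2 hsb hsz hsq hbz hbq).not.1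
          ((inducedPart_adj_iff h huw hzq).not.2 hX)
        exact (not_not.1 this).1 hs
    intro x y he
    rcases Sym2.eq_iff.1 he with ⟨rfl, rfl⟩ | ⟨rfl, rfl⟩
    · exact key
    · rw [Set.inter_comm]; exact key

theorem IsSmooth.coreGraph_adj (hf : f.IsSmooth) {x y : ℝ × ℝ} {a : ℤ × ℤ}
    (h : f.curveGraph.Adj x y) (hI : a ∈ f.interiorExponents) (hx : a ∈ f.cell x)
    (hy : a ∈ f.cell y) : f.coreGraph.Adj x y :=
  ⟨hf.mem_coreVertices_of_interior h.2.1 hx hI, hf.mem_coreVertices_of_interior h.2.2.1 hy hI, h⟩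

/-- If the cells over the complement of `X` avoid `B`, then every interior exponent in `B` is
isolated in `B`, and its region is bounded by the part of the curve over `X`. -/
theorem IsSmooth.isolated (hf : f.IsSmooth) (h : f.IsSubdivision G σ c) (hX : IsPeripheral G X)
    {B : Set (ℤ × ℤ)} (hB : f.IsBoundary (f.inducedPart G c X) B)
    (hdisj : ∀ v ∉ X, ∀ a ∈ f.cell (σ v), a ∉ B) {a : ℤ × ℤ} (ha : a ∈ B)
    (hI : a ∈ f.interiorExponents) :
    (∀ x y b, f.curveGraph.Adj x y → a ≠ b → a ∈ f.cell x → a ∈ f.cell y → b ∈ f.cell x →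
      b ∈ f.cell y → b ∉ B) ∧ (∀ v ∈ X, a ∈ f.cell (σ v)) ∧
    ∀ x y, (f.inducedPart G c X).Adj x y → a ∈ f.cell x ∧ a ∈ f.cell y := by
  -- An edge between the regions of two members of `B` does not belong to the boundary. Along its
  -- chain both exponents stay in `B`, up to an end outside `X`, contrary to `hdisj`.
  have hiso : ∀ x y b, f.curveGraph.Adj x y → a ≠ b → a ∈ f.cell x → a ∈ f.cell y →
      b ∈ f.cell x → b ∈ f.cell y → b ∉ B := by
    intro x y b hxy hab hax hay hbx hby hb
    obtain ⟨u, w, huw, hm⟩ := h.cover x y (hf.coreGraph_adj hxy hI hax hay)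
    have hnot : ¬ (u ∈ X ∧ w ∈ X) := by
      rw [← inducedPart_adj_iff h huw hm, hB x y a b hxy hab hax hay hbx hby]
      simp [ha, hb]
    have hsub : f.cell x ∩ f.cell y ⊆ B := by
      rw [hf.inter_eq hxy hab hax hay hbx hby]
      rintro d (rfl | rfl) <;> assumption
    have hend : ∀ u w, G.Adj u w → ¬ (u ∈ X ∧ w ∈ X) → s(x, y) ∈ c u w → u ∉ X → False := by
      intro u w huw hnot hm hu
      obtain ⟨z, hz⟩ := (h.isChain u w huw).exists_first
      have h1 := hf.inter_subset_of_chain h hB huw hnot hm hz hsub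
      obtain ⟨d, hd⟩ := ((h.isChain u w huw).adj hz).2.2.2.2.2.nonempty
      exact hdisj u hu d hd.1 (h1 hd)
    by_cases hu : u ∈ X
    · have hw : w ∉ X := fun hw => hnot ⟨hu, hw⟩
      exact hend w u huw.symm (fun h => hnot h.symm) (by rw [h.symm _ _ huw.symm]; exact hm) hw
    · exact hend u w huw hnot hm hu
  -- Around its region `a` is the only member of `B`, so a boundary edge at a vertex of this region
  -- has `a` on one side.
  have hstep : ∀ z y, a ∈ f.cell z → (f.inducedPart G c X).Adj z y → a ∈ f.cell y := by
    intro z y haz hzy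
    have hzy' := inducedPart_le hzy
    obtain ⟨-, -, -, p, ⟨hpz, hpy⟩, q, ⟨hqz, hqy⟩, hpq⟩ := id hzy'
    have hnot := (hB z y p q hzy' hpq hpz hpy hqz hqy).1 hzy
    have hmem : ∀ p ∈ f.cell z, p ∈ B → p = a := by
      intro p hp hpB
      by_contra hne
      obtain ⟨y', h1, h2, h3⟩ := hf.exists_adj_of_interior hzy'.2.1 haz hp (Ne.symm hne) hI
      exact hiso z y' p h1 (Ne.symm hne) haz h2 hp h3 hpB
    by_cases hp : p ∈ B
    · exact hmem p hpz hp ▸ hpy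
    · have hq : q ∈ B := by
        by_contra hq
        exact hnot ⟨fun h => absurd h hp, fun h => absurd h hq⟩
      exact hmem q hqz hq ▸ hqy
  have hchain : ∀ u ∈ X, ∀ w ∈ X, G.Adj u w → ∀ x y, s(x, y) ∈ c u w → a ∈ f.cell x →
      a ∈ f.cell y → ∀ x' y', s(x', y') ∈ c u w → a ∈ f.cell x' ∧ a ∈ f.cell y' := by
    intro u hu w hw huw x y hxy hax hay x' y' hxy'
    have hc := h.isChain u w huw
    refine hc.induction hxy (P := fun d => ∀ x y, d = s(x, y) → a ∈ f.cell x ∧ a ∈ f.cell y) ?_ ?_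
      _ hxy' x' y' rfl
    · intro p q he
      rcases Sym2.eq_iff.1 he with ⟨rfl, rfl⟩ | ⟨rfl, rfl⟩
      exacts [⟨hax, hay⟩, ⟨hay, hax⟩]
    · intro p z q _ hpz hzq hP
      have haz := (hP p z rfl).2
      have haq := hstep z q haz ((inducedPart_adj_iff h huw hzq).2 ⟨hu, hw⟩)
      intro x y he
      rcases Sym2.eq_iff.1 he with ⟨rfl, rfl⟩ | ⟨rfl, rfl⟩
      exacts [⟨haz, haq⟩, ⟨haq, haz⟩]
  have hadj : ∀ u ∈ X, ∀ w ∈ X, G.Adj u w → a ∈ f.cell (σ u) → ∀ x y, s(x, y) ∈ c u w →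
      a ∈ f.cell x ∧ a ∈ f.cell y := by
    intro u hu w hw huw hau
    obtain ⟨z, hz⟩ := (h.isChain u w huw).exists_first
    exact hchain u hu w hw huw (σ u) z hz hau
      (hstep _ _ hau ((inducedPart_adj_iff h huw hz).2 ⟨hu, hw⟩))
  -- Each edge around the region of `a` is a boundary edge. From one of them the region is followed
  -- along the connected cycle `X`.
  have hX' : ∀ v ∈ X, a ∈ f.cell (σ v) := by
    obtain ⟨x, hx, hax⟩ := hf.exists_vertex_of_interior hI
    obtain ⟨b, e, hcx, hd⟩ := (hf.unimodular hx).exists_others hax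
    have hab : a ≠ b := (ne_of_doubleArea_ne_zero (by rw [hd]; decide)).1
    have hbx : b ∈ f.cell x := by simp [hcx]
    obtain ⟨y, hxy, hay, hby⟩ := hf.exists_adj_of_interior hx hax hbx hab hI
    have hH : (f.inducedPart G c X).Adj x y := by
      rw [hB x y a b hxy hab hax hay hbx hby]
      exact fun hiff => hiso x y b hxy hab hax hay hbx hby (hiff.1 ha)
    obtain ⟨-, u, hu, w, hw, huw, hm⟩ := hH
    obtain ⟨z, hz⟩ := (h.isChain u w huw).exists_first
    have hau := (hchain u hu w hw huw x y hm hax hay _ _ hz).1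
    intro v hv
    refine hX.connected (fun v => a ∈ f.cell (σ v)) ?_ u hu v hv hau
    intro u hu w hw huw hau
    obtain ⟨z, hz⟩ := (h.isChain w u huw.symm).exists_first
    rw [h.symm _ _ huw.symm] at hz
    exact (hadj u hu w hw huw hau _ _ hz).1
  refine ⟨hiso, hX', ?_⟩
  rintro x y ⟨-, u, hu, w, hw, huw, hm⟩
  exact hadj u hu w hw huw (hX' u hu) x y hm

/-- A peripheral cycle of the skeleton bounds either a bounded region of the curve or the outer
face. -/
theorem IsSmooth.peripheral (hf : f.IsSmooth) (h : f.IsSubdivision G σ c)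
    (hX : IsPeripheral G X) :
    ∃ T ⊆ f.interiorExponents, f.IsBoundary (f.inducedPart G c X) T ∧
      ((∃ a, T = {a} ∧ ∀ v, a ∈ f.cell (σ v) ↔ v ∈ X) ∨
        (T = f.interiorExponents ∧ ∀ v, f.cell (σ v) ⊆ f.interiorExponents ↔ v ∉ X)) := by
  obtain ⟨T, hTI, hT⟩ := hf.exists_potential (H := f.inducedPart G c X) inducedPart_le
    (inducedPart_even h hX)
  have hT : f.IsBoundary (f.inducedPart G c X) T := hT
  refine ⟨T, hTI, hT, ?_⟩
  have hσV : ∀ v, σ v ∈ f.curveVertices := fun v => coreVertices_subset f (h.mem v).1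
  have hHX : ∀ v y, (f.inducedPart G c X).Adj (σ v) y → v ∈ X := by
    rintro v y ⟨-, u, hu, w, hw, huw, hm⟩
    rcases (h.isChain u w huw).eq_or_eq_of_mem hm (h.mem v) with he | he
    · exact h.injective he ▸ hu
    · exact h.injective he ▸ hw
  have hXH : ∀ v ∈ X, ∃ y, (f.inducedPart G c X).Adj (σ v) y := by
    intro v hv
    obtain ⟨w, hvw, hw⟩ : (G.neighborSet v ∩ X).Nonempty :=
      Set.nonempty_of_ncard_ne_zero (by rw [hX.ncard_eq v hv]; decide)
    obtain ⟨y, hy⟩ := (h.isChain v w hvw).exists_first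
    exact ⟨y, (inducedPart_adj_iff h hvw hy).2 ⟨hv, hw⟩⟩
  -- No boundary edge ends at `σ v`, so the exponents of its cell are all in `T` as soon as one of
  -- them is.
  have hmono : ∀ v ∉ X, ∀ p ∈ f.cell (σ v), p ∈ T → f.cell (σ v) ⊆ T := by
    intro v hv p hp hpT q hq
    by_cases hpq : p = q
    · exact hpq ▸ hpT
    · obtain ⟨y, hy, hpy, hqy⟩ := hf.exists_adj_of_interior (hσV v) hp hq hpq (hTI hpT)
      have := (hT _ y p q hy hpq hp hpy hq hqy).not.1 (fun hH => hv (hHX v y hH))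
      exact (not_not.1 this).1 hpT
  obtain ⟨v₀, hv₀⟩ := hX.nonempty
  -- The complement of `X` is connected, so its cells all avoid `T` or all lie in `T`.
  by_cases hin : ∀ v ∉ X, ∀ a ∈ f.cell (σ v), a ∉ T
  · left
    have hne : T.Nonempty := by
      obtain ⟨y, hy⟩ := hXH v₀ hv₀
      have hy' := inducedPart_le hy
      obtain ⟨-, -, -, p, ⟨hpz, hpy⟩, q, ⟨hqz, hqy⟩, hpq⟩ := id hy'
      have hnot := (hT _ y p q hy' hpq hpz hpy hqz hqy).1 hy
      by_contra hemp
      rw [Set.not_nonempty_iff_eq_empty] at hemp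
      simp [hemp] at hnot
    obtain ⟨a, ha⟩ := hne
    have hiso := hf.isolated h hX hT hin ha (hTI ha)
    refine ⟨a, ?_, fun v => ⟨fun hav => ?_, hiso.2.1 v⟩⟩
    · refine Set.eq_singleton_iff_unique_mem.2 ⟨ha, fun b hb => ?_⟩
      by_contra hne
      have hb' := (hf.isolated h hX hT hin hb (hTI hb)).2.1 v₀ hv₀
      have ha' := hiso.2.1 v₀ hv₀
      obtain ⟨y, hy, hay, hby⟩ := hf.exists_adj_of_interior (hσV v₀) ha' hb' (Ne.symm hne) (hTI ha)
      exact hiso.1 _ y b hy (Ne.symm hne) ha' hay hb' hby hb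
    · by_contra hv
      exact hin v hv a hav ha
  · right
    push Not at hin
    obtain ⟨v₁, hv₁, p, hp, hpT⟩ := hin
    have hall : ∀ v ∉ X, f.cell (σ v) ⊆ T := by
      intro v hv
      refine hX.compl_connected (fun v => f.cell (σ v) ⊆ T) ?_ v₁ hv₁ v hv
        (hmono v₁ hv₁ p hp hpT)
      intro u hu w hw huw hsub
      obtain ⟨y, hy⟩ := (h.isChain u w huw).exists_first
      obtain ⟨z, hz⟩ := (h.isChain w u huw.symm).exists_first
      rw [h.symm _ _ huw.symm] at hz
      have h1 := hf.inter_subset_of_chain h hT huw (fun h => hu h.1) hy hz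
        (Set.inter_subset_left.trans hsub)
      obtain ⟨d, hd⟩ := ((h.isChain u w huw).adj hz).2.2.2.2.2.nonempty
      exact hmono w hw d hd.1 (h1 hd)
    -- An interior exponent outside `T` would be isolated in the complement of `T`, with all
    -- boundary edges around its region. Adding it to `T` would leave a nonempty set of bounded
    -- regions without boundary.
    have hTeq : T = f.interiorExponents := by
      refine hTI.antisymm fun a haI => ?_
      by_contra haT
      have hiso := hf.isolated h hX hT.compl (fun v hv b hb hbT => hbT (hall v hv hb))
        (a := a) haT haI
      have hempty := hf.eq_empty_of_closed (T := insert a T) (Set.insert_subset haI hTI) (by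
        intro x y b d hxy hbd hbx hby hdx hdy hb
        rcases hb with rfl | hb
        · exact Or.inr (not_not.1 (hiso.1 x y d hxy hbd hbx hby hdx hdy))
        · by_cases hd : d ∈ T
          · exact Or.inr hd
          · have hH := (hT x y b d hxy hbd hbx hby hdx hdy).2 (by simp [hb, hd])
            have hax := hiso.2.2 x y hH
            have : a ∈ f.cell x ∩ f.cell y := hax
            rw [hf.inter_eq hxy hbd hbx hby hdx hdy] at this
            rcases this with rfl | rfl
            · exact absurd hb haT
            · exact Or.inl rfl)
      exact Set.notMem_empty a (hempty ▸ Set.mem_insert a T)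
    refine ⟨hTeq, fun v => ⟨fun hsub hv => ?_, fun hv => hTeq ▸ hall v hv⟩⟩
    obtain ⟨y, hy⟩ := hXH v hv
    have hy' := inducedPart_le hy
    obtain ⟨-, -, -, p, ⟨hpz, hpy⟩, q, ⟨hqz, hqy⟩, hpq⟩ := id hy'
    have hnot := (hT _ y p q hy' hpq hpz hpy hqz hqy).1 hy
    rw [← hTeq] at hsub
    exact hnot ⟨fun _ => hsub hqz, fun _ => hsub hpz⟩

/-- The interior exponents correspond to all but one of the peripheral cycles in a family that
covers every edge twice; the remaining cycle bounds the outer face. -/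
theorem IsSmooth.exists_outer (hf : f.IsSmooth) (h : f.IsSubdivision G σ c) {J : Type*}
    [Fintype J] [Nonempty J] {X : J → Set W} (hX : ∀ j, IsPeripheral G (X j))
    (hinj : Function.Injective X)
    (heven : ∀ u w, G.Adj u w → Even {j | u ∈ X j ∧ w ∈ X j}.ncard) :
    ∃ (j₀ : J) (α : J → ℤ × ℤ),
      (∀ v, f.cell (σ v) ⊆ f.interiorExponents ↔ v ∉ X j₀) ∧
      (∀ j, j ≠ j₀ → ∀ v, α j ∈ f.cell (σ v) ↔ v ∈ X j) ∧
      f.interiorExponents = α '' {j | j ≠ j₀} := by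
  classical
  choose T hTI hT hcase using fun j => hf.peripheral h (hX j)
  -- Crossing an edge changes the membership in an even number of the sets `T j`. So the exponents
  -- with an odd count form a set of bounded regions without boundary.
  have hpar : ∀ a, Even {j | a ∈ T j}.ncard := by
    by_contra hcon
    push Not at hcon
    obtain ⟨a₀, ha₀⟩ := hcon
    have hsub : {a | ¬ Even {j | a ∈ T j}.ncard} ⊆ f.interiorExponents := by
      intro a ha
      by_contra haI
      apply ha
      have : {j | a ∈ T j} = ∅ := by
        ext j
        simp only [Set.mem_ofPred_eq, Set.mem_empty_iff_false, iff_false]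
        exact fun hj => haI (hTI j hj)
      rw [this, Set.ncard_empty]
      exact Even.zero
    have := hf.eq_empty_of_closed hsub (by
      intro x y a b hxy hab hax hay hbx hby ha hb
      apply ha
      have haI : a ∈ f.interiorExponents := hsub ha
      obtain ⟨u, w, huw, hm⟩ := h.cover x y (hf.coreGraph_adj hxy haI hax hay)
      have hj : ∀ j, (u ∈ X j ∧ w ∈ X j) ↔ ¬ (a ∈ T j ↔ b ∈ T j) := fun j => by
        rw [← inducedPart_adj_iff h huw hm]
        exact hT j x y a b hxy hab hax hay hbx hby
      have hsum : ∀ s : Set J, (s.ncard : ZMod 2) = ∑ j, if j ∈ s then 1 else 0 := by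
        intro s
        rw [Set.ncard_eq_toFinset_card', Finset.sum_boole]
        congr 2
        ext
        simp
      have hzero : ∀ s : Set J, Even s.ncard ↔ (∑ j, if j ∈ s then 1 else 0 : ZMod 2) = 0 := by
        intro s
        rw [← hsum, ZMod.natCast_eq_zero_iff_even]
      rw [hzero] at hb ⊢
      have he := (hzero _).1 (heven u w huw)
      have : (∑ j, if j ∈ {j | a ∈ T j} then 1 else 0 : ZMod 2) =
          (∑ j, if j ∈ {j | b ∈ T j} then 1 else 0) +
          ∑ j, if j ∈ {j | u ∈ X j ∧ w ∈ X j} then 1 else 0 := by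
        rw [← Finset.sum_add_distrib]
        refine Finset.sum_congr rfl fun j _ => ?_
        simp only [Set.mem_ofPred_eq, hj j]
        by_cases h1 : a ∈ T j <;> by_cases h2 : b ∈ T j <;> simp [h1, h2]
        decide
      rw [this, hb, zero_add]
      convert he)
    exact Set.notMem_empty a₀ (this ▸ ha₀)
  -- If all sets `T j` were singletons that determine their cycles, each of their elements would be
  -- counted exactly once.
  have houter : ∃ j₀, T j₀ = f.interiorExponents ∧
      ∀ v, f.cell (σ v) ⊆ f.interiorExponents ↔ v ∉ X j₀ := by
    by_contra hcon
    push Not at hcon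
    have hcase' : ∀ j, ∃ a, T j = {a} ∧ ∀ v, a ∈ f.cell (σ v) ↔ v ∈ X j := fun j => by
      rcases hcase j with h1 | ⟨h1, h2⟩
      · exact h1
      · obtain ⟨v, hv⟩ := hcon j h1
        exact absurd (h2 v) (by tauto)
    choose a ha hav using hcase'
    obtain ⟨j⟩ := ‹Nonempty J›
    have : {i | a j ∈ T i} = {j} := by
      ext i
      simp only [ha, Set.mem_singleton_iff, Set.mem_ofPred_eq]
      refine ⟨fun he => hinj ?_, fun he => he ▸ rfl⟩
      ext v
      rw [← hav, ← hav, he]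
    have h1 := hpar (a j)
    rw [this, Set.ncard_singleton] at h1
    exact absurd h1 (by decide)
  obtain ⟨j₀, hj₀, hv₀⟩ := houter
  have hcase' : ∀ j, j ≠ j₀ → ∃ a, T j = {a} ∧ ∀ v, a ∈ f.cell (σ v) ↔ v ∈ X j := by
    intro j hj
    rcases hcase j with h1 | ⟨-, h2⟩
    · exact h1
    · refine absurd (hinj ?_) hj
      ext v
      rw [← not_iff_not, ← hv₀, ← h2]
  choose! a ha hav using hcase'
  refine ⟨j₀, a, hv₀, hav, ?_⟩
  ext b
  constructor
  · intro hb
    by_contra hcon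
    -- `b` already lies in `T j₀`; an even count requires one more set, which is a singleton.
    have : {j | b ∈ T j} = {j₀} := by
      ext j
      simp only [Set.mem_singleton_iff, Set.mem_ofPred_eq]
      constructor
      · intro hj
        by_contra hne
        rw [ha j hne] at hj
        exact hcon ⟨j, hne, hj.symm⟩
      · rintro rfl
        exact hj₀ ▸ hb
    have h1 := hpar b
    rw [this, Set.ncard_singleton] at h1
    exact absurd h1 (by decide)
  · rintro ⟨j, hj, rfl⟩
    exact hTI j (by rw [ha j hj]; rfl)

end TropicalPolynomial

/-! ### Peripheral cycles of the prism graph -/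

section Prism

variable {m : ℕ}

theorem Fin.add_ne_self (i : Fin (m + 4)) : i + 1 ≠ i ∧ i + 1 + 1 ≠ i ∧ i + 1 + 1 + 1 ≠ i := by
  have h1 : (1 : Fin (m + 4)) ≠ 0 := by simp
  have h2 : (1 + 1 : Fin (m + 4)) ≠ 0 := by
    simp only [ne_eq, Fin.ext_iff, Fin.val_add, Fin.val_one, Fin.val_zero]
    rw [Nat.mod_eq_of_lt (by omega : 1 + 1 < m + 4)]
    omega
  have h3 : (1 + 1 + 1 : Fin (m + 4)) ≠ 0 := by
    simp only [ne_eq, Fin.ext_iff, Fin.val_add, Fin.val_one, Fin.val_zero]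
    rw [Nat.mod_eq_of_lt (by omega : 1 + 1 < m + 4), Nat.mod_eq_of_lt (by omega)]
    omega
  refine ⟨fun h => h1 ?_, fun h => h2 ?_, fun h => h3 ?_⟩
  · exact add_eq_left.1 h
  · rw [add_assoc] at h; exact add_eq_left.1 h
  · rw [add_assoc, add_assoc] at h
    rw [add_assoc]; exact add_eq_left.1 h

theorem prismGraph_adj_iff (v w : Fin (m + 4) × Fin 2) : (prismGraph (m + 4)).Adj v w ↔
    w = (v.1 + 1, v.2) ∨ v = (w.1 + 1, w.2) ∨ w = (v.1, v.2 + 1) := by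
  obtain ⟨i, j⟩ := v
  obtain ⟨k, l⟩ := w
  have h2 : ∀ j l : Fin 2, j ≠ l ↔ l = j + 1 := by decide
  rw [prismGraph, SimpleGraph.boxProd_adj]
  simp only [SimpleGraph.cycleGraph_adj, SimpleGraph.completeGraph_eq_top, SimpleGraph.top_adj,
    Prod.mk.injEq, sub_eq_iff_eq_add, h2, add_comm (1 : Fin (m + 4))]
  constructor
  · rintro (⟨h | h, h'⟩ | h)
    · exact Or.inr (Or.inl ⟨h, h'⟩)
    · exact Or.inl ⟨h, h'.symm⟩
    · exact Or.inr (Or.inr ⟨h.2.symm, h.1⟩)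
  · rintro (h | h | h)
    · exact Or.inl ⟨Or.inr h.1, h.2.symm⟩
    · exact Or.inl ⟨Or.inl h.1, h.2⟩
    · exact Or.inr ⟨h.2, h.1.symm⟩

/-- The peripheral cycles of the prism graph: the two copies of the long cycle, and the
quadrilaterals. -/
def prismCycle (m : ℕ) : Fin (m + 4) ⊕ Fin 2 → Set (Fin (m + 4) × Fin 2)
  | .inl i => {v | v.1 = i ∨ v.1 = i + 1}
  | .inr j => {v | v.2 = j}

theorem prismCycle_injective : Function.Injective (prismCycle m) := by
  have h2 : ∀ j : Fin 2, j + 1 ≠ j := by decide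
  rintro (i | i) (k | k) h
  · have h1 : ((i, 0) : Fin (m + 4) × Fin 2) ∈ prismCycle m (.inl k) := h ▸ Or.inl rfl
    have h2 : ((i + 1, 0) : Fin (m + 4) × Fin 2) ∈ prismCycle m (.inl k) := h ▸ Or.inr rfl
    rcases h1 with h1 | h1
    · exact congrArg _ h1
    · simp only at h1
      subst h1
      rcases h2 with h2 | h2
      · exact absurd h2 (Fin.add_ne_self k).2.1
      · exact absurd h2 (Fin.add_ne_self (k + 1)).1
  · have h1 : ((i, k + 1) : Fin (m + 4) × Fin 2) ∈ prismCycle m (.inr k) := h ▸ Or.inl rfl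
    exact absurd h1 (h2 k)
  · have h1 : ((k, i + 1) : Fin (m + 4) × Fin 2) ∈ prismCycle m (.inr i) := h ▸ Or.inl rfl
    exact absurd h1 (h2 i)
  · have h1 : ((0, i) : Fin (m + 4) × Fin 2) ∈ prismCycle m (.inr k) := h ▸ rfl
    exact congrArg _ h1

theorem prismGraph_neighborSet (i : Fin (m + 4)) (j : Fin 2) :
    (prismGraph (m + 4)).neighborSet (i, j) = {(i + 1, j), (i - 1, j), (i, j + 1)} := by
  ext ⟨k, l⟩
  simp only [SimpleGraph.mem_neighborSet, prismGraph_adj_iff, Set.mem_insert_iff,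
    Set.mem_singleton_iff, Prod.mk.injEq, eq_sub_iff_add_eq, eq_comm (a := i), eq_comm (a := j)]

theorem prismGraph_ncard_neighborSet (v : Fin (m + 4) × Fin 2) :
    3 ≤ ((prismGraph (m + 4)).neighborSet v).ncard := by
  obtain ⟨i, j⟩ := v
  have h2 : ∀ j : Fin 2, j ≠ j + 1 := by decide
  rw [prismGraph_neighborSet, Set.ncard_eq_three.2]
  refine ⟨_, _, _, ?_, ?_, ?_, rfl⟩
  · simp only [ne_eq, Prod.mk.injEq, and_true, eq_sub_iff_add_eq]
    exact (Fin.add_ne_self i).2.1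
  · simp [h2]
  · simp [h2]

open Fin.CommRing in
theorem iterate_cycle {P : Fin (m + 4) → Prop} (h : ∀ i, P i → P (i + 1)) (i k : Fin (m + 4))
    (hi : P i) : P k := by
  have key : ∀ t : ℕ, P (i + (t : Fin (m + 4))) := by
    intro t
    induction t with
    | zero => simpa using hi
    | succ t ih => rw [Nat.cast_succ, ← add_assoc]; exact h _ ih
  have := key (k - i).val
  rwa [Fin.cast_val_eq_self, add_sub_cancel] at this

open Fin.CommRing in
-- Removing `i` and `i + 1` from the cyclic order leaves the arc from `i + 2` to `i - 1`, and `h` is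
-- required only for the steps inside this arc.
theorem iterate_arc {P : Fin (m + 4) → Prop} (i : Fin (m + 4))
    (h : ∀ k, k ≠ i → k ≠ i + 1 → k + 1 ≠ i → (P k ↔ P (k + 1))) {k l : Fin (m + 4)}
    (hki : k ≠ i) (hki' : k ≠ i + 1) (hli : l ≠ i) (hli' : l ≠ i + 1) : P k → P l := by
  have hval : ∀ t : ℕ, 1 < t → t < m + 4 →
      i + (t : Fin (m + 4)) ≠ i ∧ i + (t : Fin (m + 4)) ≠ i + 1 := by
    intro t h1 h2
    refine ⟨fun he => ?_, fun he => ?_⟩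
    · have := congrArg Fin.val (add_eq_left.1 he)
      rw [Fin.val_natCast, Nat.mod_eq_of_lt h2] at this
      simp at this
      omega
    · have := congrArg Fin.val (add_left_cancel he)
      rw [Fin.val_natCast, Nat.mod_eq_of_lt h2] at this
      simp at this
      omega
  have key : ∀ t : ℕ, t + 2 < m + 4 → (P (i + ((t + 2 : ℕ) : Fin (m + 4))) ↔ P (i + 1 + 1)) := by
    intro t
    induction t with
    | zero =>
      intro _
      rw [zero_add, add_assoc, Nat.cast_two, one_add_one_eq_two]
    | succ t ih =>
      intro ht
      rw [← ih (by omega), show t + 1 + 2 = (t + 2) + 1 by omega, Nat.cast_succ, ← add_assoc]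
      refine (h _ (hval (t + 2) (by omega) (by omega)).1 (hval (t + 2) (by omega) (by omega)).2
        ?_).symm
      have := (hval (t + 3) (by omega) ht).1
      rwa [show t + 3 = (t + 2) + 1 by omega, Nat.cast_succ, ← add_assoc] at this
  have hall : ∀ k, k ≠ i → k ≠ i + 1 → (P k ↔ P (i + 1 + 1)) := by
    intro k h1 h2
    have hk : k = i + (((k - i).val : ℕ) : Fin (m + 4)) := by
      rw [Fin.cast_val_eq_self, add_sub_cancel]
    have ht : 2 ≤ (k - i).val := by
      by_contra hcon
      have : (k - i).val = 0 ∨ (k - i).val = 1 := by omega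
      rcases this with h0 | h0 <;> rw [h0] at hk
      · exact h1 (by simpa using hk)
      · exact h2 (by simpa using hk)
    have := key ((k - i).val - 2) (by omega)
    rwa [Nat.sub_add_cancel ht, ← hk] at this
  intro hk
  exact (hall l hli hli').2 ((hall k hki hki').1 hk)

/-- Deleting a quadrilateral leaves the strip over an arc, and deleting one long cycle leaves the
other; both remainders are connected. -/
theorem isPeripheral_prismCycle (x : Fin (m + 4) ⊕ Fin 2) :
    TropicalPolynomial.IsPeripheral (prismGraph (m + 4)) (prismCycle m x) := by
  have h2 : ∀ j : Fin 2, j ≠ j + 1 := by decide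
  have h2' : ∀ j k : Fin 2, j ≠ k → j = k + 1 := by decide
  have h2'' : ∀ j : Fin 2, j + 1 + 1 = j := by decide
  have hrow : ∀ (i : Fin (m + 4)) (j : Fin 2), (prismGraph (m + 4)).Adj (i, j) (i + 1, j) :=
    fun i j => (prismGraph_adj_iff _ _).2 (Or.inl rfl)
  have hcol : ∀ (i : Fin (m + 4)) (j : Fin 2), (prismGraph (m + 4)).Adj (i, j) (i, j + 1) :=
    fun i j => (prismGraph_adj_iff _ _).2 (Or.inr (Or.inr rfl))
  rcases x with i | j
  · refine ⟨⟨(i, 0), Or.inl rfl⟩, ?_, ?_, ?_⟩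
    · rintro ⟨k, j⟩ (rfl | rfl)
      · rw [show (prismGraph (m + 4)).neighborSet (k, j) ∩ prismCycle m (.inl k) =
          {(k + 1, j), (k, j + 1)} by
            rw [prismGraph_neighborSet]
            ext ⟨a, b⟩
            simp only [prismCycle, Set.mem_inter_iff, Set.mem_insert_iff, Set.mem_singleton_iff,
              Prod.mk.injEq, Set.mem_ofPred_eq]
            have h1 := Fin.add_ne_self (k - 1)
            rw [sub_add_cancel] at h1
            constructor
            · rintro ⟨⟨rfl, rfl⟩ | ⟨rfl, rfl⟩ | ⟨rfl, rfl⟩, h⟩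
              · simp
              · rcases h with h | h
                · exact absurd h.symm h1.1
                · exact absurd h.symm h1.2.1
              · simp
            · rintro (⟨rfl, rfl⟩ | ⟨rfl, rfl⟩) <;> simp]
        exact Set.ncard_pair (by simp [h2])
      · rw [show (prismGraph (m + 4)).neighborSet (i + 1, j) ∩ prismCycle m (.inl i) =
          {(i, j), (i + 1, j + 1)} by
            rw [prismGraph_neighborSet]
            ext ⟨a, b⟩
            simp only [prismCycle, Set.mem_inter_iff, Set.mem_insert_iff, Set.mem_singleton_iff,
              Prod.mk.injEq, Set.mem_ofPred_eq, add_sub_cancel_right]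
            have h1 := Fin.add_ne_self i
            have h3 := Fin.add_ne_self (i + 1)
            constructor
            · rintro ⟨⟨rfl, rfl⟩ | ⟨rfl, rfl⟩ | ⟨rfl, rfl⟩, h⟩
              · rcases h with h | h
                · exact absurd h h1.2.1
                · exact absurd h h3.1
              · simp
              · simp
            · rintro (⟨rfl, rfl⟩ | ⟨rfl, rfl⟩) <;> simp]
        exact Set.ncard_pair (by simp [h2])
    · intro P hP u hu w hw hPu
      have hP' : ∀ u ∈ prismCycle m (.inl i), ∀ w ∈ prismCycle m (.inl i),
          (prismGraph (m + 4)).Adj u w → (P u ↔ P w) := fun u hu w hw h =>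
        ⟨hP u hu w hw h, hP w hw u hu h.symm⟩
      have e1 : ∀ j, P (i, j) ↔ P (i + 1, j) := fun j =>
        hP' _ (Or.inl rfl) _ (Or.inr rfl) (hrow i j)
      have e2 : P (i, 0) ↔ P (i, 1) := hP' _ (Or.inl rfl) _ (Or.inl rfl) (hcol i 0)
      have key : ∀ u ∈ prismCycle m (.inl i), (P u ↔ P (i, 0)) := by
        rintro ⟨k, j⟩ (rfl | rfl) <;> fin_cases j <;> simp [← e1, e2]
      exact (key w hw).2 ((key u hu).1 hPu)
    · intro P hP u hu w hw hPu
      have hn : ∀ (k : Fin (m + 4)) (j : Fin 2), k ≠ i → k ≠ i + 1 →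
          (k, j) ∉ prismCycle m (.inl i) := by
        rintro k j h1 h2 (h | h)
        exacts [h1 h, h2 h]
      obtain ⟨k, j⟩ := u
      obtain ⟨l, j'⟩ := w
      have hk : k ≠ i ∧ k ≠ i + 1 := ⟨fun h => hu (Or.inl h), fun h => hu (Or.inr h)⟩
      have hl : l ≠ i ∧ l ≠ i + 1 := ⟨fun h => hw (Or.inl h), fun h => hw (Or.inr h)⟩
      have h1 : P (l, j) := by
        refine iterate_arc (P := fun k => P (k, j)) i ?_ hk.1 hk.2 hl.1 hl.2 hPu
        intro k h1 h2 h3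
        have h4 : k + 1 ≠ i + 1 := fun h => h1 (add_right_cancel h)
        exact ⟨hP _ (hn _ _ h1 h2) _ (hn _ _ h3 h4) (hrow k j),
          hP _ (hn _ _ h3 h4) _ (hn _ _ h1 h2) (hrow k j).symm⟩
      by_cases hj : j' = j
      · exact hj ▸ h1
      · rw [h2' _ _ hj]
        exact hP _ (hn _ _ hl.1 hl.2) _ (hn _ _ hl.1 hl.2) (hcol l j) h1
  · have hconn : ∀ j : Fin 2, ∀ P : Fin (m + 4) × Fin 2 → Prop,
        (∀ i, P (i, j) → P (i + 1, j)) → ∀ i k, P (i, j) → P (k, j) :=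
      fun j P h i k => iterate_cycle (P := fun i => P (i, j)) h i k
    refine ⟨⟨(0, j), rfl⟩, ?_, ?_, ?_⟩
    · rintro ⟨i, k⟩ (rfl : k = j)
      rw [show (prismGraph (m + 4)).neighborSet (i, k) ∩ prismCycle m (.inr k) =
          {(i + 1, k), (i - 1, k)} by
            rw [prismGraph_neighborSet]
            ext ⟨a, b⟩
            simp only [prismCycle, Set.mem_inter_iff, Set.mem_insert_iff, Set.mem_singleton_iff,
              Prod.mk.injEq, Set.mem_ofPred_eq]
            constructor
            · rintro ⟨⟨rfl, rfl⟩ | ⟨rfl, rfl⟩ | ⟨rfl, rfl⟩, h⟩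
              · simp
              · simp
              · exact absurd h.symm (h2 k)
            · rintro (⟨rfl, rfl⟩ | ⟨rfl, rfl⟩) <;> simp]
      refine Set.ncard_pair ?_
      simp only [ne_eq, Prod.mk.injEq, and_true, eq_sub_iff_add_eq]
      exact (Fin.add_ne_self i).2.1
    · rintro P hP ⟨i, k⟩ rfl ⟨l, k'⟩ (rfl : k' = k) hi
      exact hconn k' P (fun i => hP (i, k') rfl (i + 1, k') rfl (hrow i k')) i l hi
    · rintro P hP ⟨i, k⟩ hk ⟨l, k'⟩ hk' hi
      have e1 : k = j + 1 := h2' _ _ hk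
      have e2 : k' = j + 1 := h2' _ _ hk'
      subst e1 e2
      have hn : ∀ i : Fin (m + 4), (i, j + 1) ∉ prismCycle m (.inr j) := fun i h => (h2 j) h.symm
      exact hconn _ P (fun i => hP _ (hn i) _ (hn _) (hrow i _)) i l hi

/-- An edge of a long cycle lies on this cycle and on one quadrilateral; a rung lies on two
quadrilaterals. -/
theorem even_ncard_prismCycle {u w : Fin (m + 4) × Fin 2} (h : (prismGraph (m + 4)).Adj u w) :
    Even {x | u ∈ prismCycle m x ∧ w ∈ prismCycle m x}.ncard := by
  have h2 : ∀ j : Fin 2, j ≠ j + 1 := by decide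
  have hrow : ∀ (i : Fin (m + 4)) (j : Fin 2),
      {x | (i, j) ∈ prismCycle m x ∧ (i + 1, j) ∈ prismCycle m x}.ncard = 2 := by
    intro i j
    rw [show {x | (i, j) ∈ prismCycle m x ∧ (i + 1, j) ∈ prismCycle m x} = {.inl i, .inr j} by
      ext (k | k)
      · simp only [prismCycle, Set.mem_ofPred_eq, Set.mem_insert_iff, Set.mem_singleton_iff,
          Sum.inl.injEq, reduceCtorEq, or_false]
        constructor
        · rintro ⟨rfl | rfl, h⟩
          · rfl
          · rcases h with h | h
            · exact absurd h (Fin.add_ne_self k).2.1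
            · exact absurd h (Fin.add_ne_self _).1
        · rintro rfl
          simp
      · simp only [prismCycle, Set.mem_ofPred_eq, Set.mem_insert_iff, Set.mem_singleton_iff,
          Sum.inr.injEq, reduceCtorEq, false_or, and_self]
        exact eq_comm]
    exact Set.ncard_pair (by simp)
  obtain ⟨i, j⟩ := u
  obtain ⟨k, l⟩ := w
  rcases (prismGraph_adj_iff _ _).1 h with h | h | h
  · simp only [Prod.mk.injEq] at h
    obtain ⟨rfl, rfl⟩ := h
    rw [hrow]; exact even_two
  · simp only [Prod.mk.injEq] at h
    obtain ⟨rfl, rfl⟩ := h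
    simp only [and_comm (a := (k + 1, j) ∈ _)]
    rw [hrow]; exact even_two
  · simp only [Prod.mk.injEq] at h
    obtain ⟨rfl, rfl⟩ := h
    rw [show {x | (k, j) ∈ prismCycle m x ∧ (k, j + 1) ∈ prismCycle m x} =
        {.inl k, .inl (k - 1)} by
      ext (i | i)
      · simp only [prismCycle, Set.mem_ofPred_eq, Set.mem_insert_iff, Set.mem_singleton_iff,
          Sum.inl.injEq, eq_sub_iff_add_eq, and_self, eq_comm (a := k)]
      · simp only [prismCycle, Set.mem_ofPred_eq, Set.mem_insert_iff, Set.mem_singleton_iff,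
          reduceCtorEq, or_self, iff_false]
        rintro ⟨h, h'⟩
        exact h2 j (h.trans h'.symm)]
    rw [Set.ncard_pair]
    · exact even_two
    · simp [eq_sub_iff_add_eq]

end Prism

/-! ### Topology of the faces -/

namespace TropicalPolynomial

variable {f : TropicalPolynomial}

theorem continuous_monomialValue (f : TropicalPolynomial) (a : ℤ × ℤ) :
    Continuous (f.monomialValue a) := by
  unfold monomialValue
  fun_prop

theorem isClosed_mem_cell (f : TropicalPolynomial) (a : ℤ × ℤ) : IsClosed {x | a ∈ f.cell x} := by
  by_cases ha : a ∈ f.support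
  · have : {x | a ∈ f.cell x} =
        ⋂ b ∈ f.support, {x | f.monomialValue a x ≤ f.monomialValue b x} := by
      ext x
      simp [cell, ha]
    rw [this]
    exact isClosed_biInter fun b _ =>
      isClosed_le (continuous_monomialValue f a) (continuous_monomialValue f b)
  · have : {x | a ∈ f.cell x} = ∅ := by
      ext x
      simp [cell, ha]
    rw [this]
    exact isClosed_empty

theorem isClosed_cell_inter_nonempty (f : TropicalPolynomial) (s : Set (ℤ × ℤ)) :
    IsClosed {x | ∃ a ∈ s, a ∈ f.cell x} := by
  have : {x | ∃ a ∈ s, a ∈ f.cell x} = ⋃ a ∈ s ∩ f.support, {x | a ∈ f.cell x} := by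
    ext x
    simp only [Set.mem_ofPred_eq, Set.mem_iUnion, Set.mem_inter_iff, exists_prop]
    exact ⟨fun ⟨a, h1, h2⟩ => ⟨a, ⟨h1, h2.1⟩, h2⟩, fun ⟨a, h1, h2⟩ => ⟨a, h1.1, h2⟩⟩
  rw [this]
  exact (f.support.finite_toSet.inter_of_right s).isClosed_biUnion
    fun a _ => isClosed_mem_cell f a

/-- The open region where the exponent `a` is the only minimal one. -/
def region (f : TropicalPolynomial) (a : ℤ × ℤ) : Set (ℝ × ℝ) := {x | f.cell x = {a}}

/-- The points at which no interior exponent is minimal. -/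
def outerRegion (f : TropicalPolynomial) : Set (ℝ × ℝ) :=
  {x | ∀ a ∈ f.cell x, a ∉ f.interiorExponents}

theorem isOpen_region (hS : f.support.Nonempty) (a : ℤ × ℤ) : IsOpen (f.region a) := by
  have : f.region a = {x | ∃ b ∈ ({a}ᶜ : Set (ℤ × ℤ)), b ∈ f.cell x}ᶜ := by
    ext x
    simp only [region, Set.mem_ofPred_eq, Set.mem_compl_iff, Set.mem_singleton_iff, not_exists,
      not_and]
    rw [Set.eq_singleton_iff_nonempty_unique_mem]
    constructor
    · exact fun h b hb hbx => hb (h.2 b hbx)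
    · exact fun h => ⟨cell_nonempty hS x, fun b hb => by_contra fun hne => h b hne hb⟩
  rw [this]
  exact (isClosed_cell_inter_nonempty f _).isOpen_compl

theorem outerRegion_eq (f : TropicalPolynomial) :
    f.outerRegion = {x | ∃ b ∈ f.interiorExponents, b ∈ f.cell x}ᶜ := by
  ext x
  simp only [outerRegion, Set.mem_ofPred_eq, Set.mem_compl_iff, not_exists, not_and]
  exact ⟨fun h b hb hbx => h b hbx hb, fun h b hb hbx => h b hbx hb⟩

theorem isOpen_outerRegion (f : TropicalPolynomial) : IsOpen f.outerRegion := by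
  rw [outerRegion_eq]
  exact (isClosed_cell_inter_nonempty f _).isOpen_compl

theorem convex_region (f : TropicalPolynomial) (a : ℤ × ℤ) : Convex ℝ (f.region a) := by
  rw [convex_iff_segment_subset]
  intro x hx y hy z hz
  rw [segment_eq_image'] at hz
  obtain ⟨t, ⟨h0, h1⟩, rfl⟩ := hz
  rcases h1.eq_or_lt with rfl | h1
  · simpa [region] using hy
  · exact cell_segment_eq_singleton hx (by rw [show f.cell y = {a} from hy]; rfl) h0 h1

/-- For interior `a` the largest difference `dot a d - dot b d` over the support is positive for
every unit vector `d`, hence at least some `δ > 0` by compactness. Minimality of `a` at `x` then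
bounds `δ * ‖x‖` by a difference of coefficients. -/
theorem exists_bound_of_interior {a : ℤ × ℤ} (ha : a ∈ f.interiorExponents)
    (hS : f.support.Nonempty) : ∃ M : ℝ, ∀ x, a ∈ f.cell x → ‖x‖ ≤ M := by
  have hg : Continuous fun d : ℝ × ℝ => f.support.sup' hS (fun b => dot a d - dot b d) := by
    refine Continuous.finset_sup'_apply hS fun b _ => ?_
    unfold dot
    fun_prop
  obtain ⟨d₀, hd₀, hmin⟩ := (isCompact_sphere (0 : ℝ × ℝ) 1).exists_isMinOn
    ⟨(1, 0), by simp [Prod.norm_def]⟩ hg.continuousOn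
  set δ := f.support.sup' hS (fun b => dot a d₀ - dot b d₀) with hδ
  have hδ0 : 0 < δ := by
    obtain ⟨b, hb, hlt⟩ := ha d₀ (by rintro rfl; simp at hd₀)
    exact lt_of_lt_of_le (sub_pos.2 hlt) (Finset.le_sup' (fun b => dot a d₀ - dot b d₀) hb)
  refine ⟨f.support.sup' hS (fun b => f.coeff b - f.coeff a) / δ, fun x hx => ?_⟩
  rw [le_div_iff₀ hδ0]
  by_cases hx0 : x = 0
  · rw [hx0, norm_zero, zero_mul]
    refine le_trans ?_ (Finset.le_sup' (fun b => f.coeff b - f.coeff a) hx.1)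
    simp
  · have hn : 0 < ‖x‖ := norm_pos_iff.2 hx0
    have hd : (‖x‖⁻¹ • x) ∈ Metric.sphere (0 : ℝ × ℝ) 1 := by
      simp [norm_smul, hn.ne']
    obtain ⟨b, hb, hbe⟩ := f.support.exists_mem_eq_sup' hS
      (fun b => dot a (‖x‖⁻¹ • x) - dot b (‖x‖⁻¹ • x))
    have h1 : δ ≤ dot a (‖x‖⁻¹ • x) - dot b (‖x‖⁻¹ • x) := by
      have : δ ≤ f.support.sup' hS (fun b => dot a (‖x‖⁻¹ • x) - dot b (‖x‖⁻¹ • x)) := hmin hd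
      rwa [hbe] at this
    rw [dot_smul, dot_smul, ← mul_sub, inv_mul_eq_div, le_div_iff₀ hn] at h1
    have h2 := hx.2 b hb
    rw [monomialValue_eq_dot, monomialValue_eq_dot] at h2
    have h3 := Finset.le_sup' (fun b => f.coeff b - f.coeff a) hb
    linarith

theorem IsSmooth.nonempty_support (hf : f.IsSmooth) : f.support.Nonempty :=
  IsTwoDimensional.nonempty_support hf.1

theorem IsSmooth.exists_bound (hf : f.IsSmooth) :
    ∃ M : ℝ, ∀ a ∈ f.interiorExponents, ∀ x, a ∈ f.cell x → ‖x‖ ≤ M := by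
  have hfin : f.interiorExponents.Finite :=
    f.support.finite_toSet.subset hf.interiorExponents_subset
  choose! M hM using fun a (ha : a ∈ f.interiorExponents) =>
    exists_bound_of_interior ha hf.nonempty_support
  obtain ⟨B, hB⟩ := (hfin.image M).bddAbove
  exact ⟨B, fun a ha x hx => (hM a ha x hx).trans (hB ⟨a, ha, rfl⟩)⟩

/-- For the maximum norm the set is a union of four half-planes, added one at a time with a corner
point in common. -/
theorem isPreconnected_norm_gt (M : ℝ) : IsPreconnected {x : ℝ × ℝ | M < ‖x‖} := by
  have hs : {x : ℝ × ℝ | M < ‖x‖} = (({x | M < x.1} ∪ {x | M < x.2}) ∪ {x | M < -x.1}) ∪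
      {x | M < -x.2} := by
    ext x
    simp only [Prod.norm_def, Real.norm_eq_abs, Set.mem_ofPred_eq, lt_sup_iff, lt_abs,
      Set.mem_union]
    tauto
  have hc : ∀ g : ℝ × ℝ →ₗ[ℝ] ℝ, IsPreconnected {x | M < g x} := fun g =>
    (convex_halfSpace_gt g.isLinear M).isPreconnected
  have h1 := hc (LinearMap.fst ℝ ℝ ℝ)
  have h2 := hc (LinearMap.snd ℝ ℝ ℝ)
  have h3 := hc (-LinearMap.fst ℝ ℝ ℝ)
  have h4 := hc (-LinearMap.snd ℝ ℝ ℝ)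
  simp only [LinearMap.fst_apply, LinearMap.snd_apply, LinearMap.neg_apply] at h1 h2 h3 h4
  rw [hs]
  refine ((h1.union (M + 1, M + 1) ?_ ?_ h2).union (-(M + 1), M + 1) ?_ ?_ h3).union
    (-(M + 1), -(M + 1)) ?_ ?_ h4 <;> simp

/-- From each point of the region there is a ray on which no new exponent becomes minimal. It stays
in the region and reaches the complement of a large ball, which is connected. -/
theorem IsSmooth.isPreconnected_outerRegion (hf : f.IsSmooth) : IsPreconnected f.outerRegion := by
  obtain ⟨M, hM⟩ := hf.exists_bound
  have hout : {x : ℝ × ℝ | M < ‖x‖} ⊆ f.outerRegion := fun x hx a ha hI =>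
    not_lt.2 (hM a hI x ha) hx
  refine isPreconnected_of_forall (|M| + 1, 0) fun y hy => ?_
  obtain ⟨a, ha⟩ := cell_nonempty hf.nonempty_support y
  have haI := hy a ha
  simp only [interiorExponents, Set.mem_ofPred_eq, not_forall] at haI
  obtain ⟨d, hd, hsup⟩ := haI
  push Not at hsup
  set r : ℝ → ℝ × ℝ := fun t => y + t • d with hr
  have hrU : r '' Set.Ici 0 ⊆ f.outerRegion := by
    rintro _ ⟨t, ht, rfl⟩
    rcases (show (0 : ℝ) ≤ t from ht).eq_or_lt with rfl | ht
    · simpa [hr] using hy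
    · intro b hb
      simp only [hr] at hb
      rw [cell_ray ha hsup ht] at hb
      exact hy b hb.1
  have hdn : 0 < ‖d‖ := norm_pos_iff.2 hd
  have hT : 0 ≤ (|M| + ‖y‖ + 1) / ‖d‖ := by positivity
  have hfar : M < ‖r ((|M| + ‖y‖ + 1) / ‖d‖)‖ := by
    have h1 : ‖((|M| + ‖y‖ + 1) / ‖d‖) • d‖ = |M| + ‖y‖ + 1 := by
      rw [norm_smul, Real.norm_eq_abs, abs_of_nonneg hT, div_mul_cancel₀ _ hdn.ne']
    have h2 := norm_sub_norm_le (((|M| + ‖y‖ + 1) / ‖d‖) • d) (-y)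
    rw [norm_neg, sub_neg_eq_add, add_comm _ y, h1] at h2
    have := le_abs_self M
    simp only [hr]
    linarith
  refine ⟨{x | M < ‖x‖} ∪ r '' Set.Ici 0, Set.union_subset hout hrU, Or.inl ?_,
    Or.inr ⟨0, Set.self_mem_Ici, by simp [hr]⟩, ?_⟩
  · simp only [Prod.norm_def, Set.mem_ofPred_eq, lt_sup_iff]
    left
    rw [Real.norm_eq_abs, abs_of_nonneg (by positivity)]
    have := le_abs_self M
    linarith
  · refine (isPreconnected_norm_gt M).union _ hfar ⟨_, hT, rfl⟩ ?_
    exact isPreconnected_Ici.image r (by fun_prop)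

theorem IsSmooth.outerRegion_unbounded (hf : f.IsSmooth) :
    ¬ Bornology.IsBounded f.outerRegion := by
  obtain ⟨M, hM⟩ := hf.exists_bound
  intro hb
  obtain ⟨C, hC⟩ := hb.exists_norm_le
  have hmem : ((|M| + |C| + 1, 0) : ℝ × ℝ) ∈ f.outerRegion := by
    intro a ha hI
    have := hM a hI _ ha
    simp only [Prod.norm_def, norm_zero, Real.norm_eq_abs] at this
    rw [abs_of_nonneg (by positivity)] at this
    have h1 := le_max_left (|M| + |C| + 1) 0
    have := le_abs_self M
    have := abs_nonneg C
    linarith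
  have := hC _ hmem
  simp only [Prod.norm_def, norm_zero, Real.norm_eq_abs] at this
  rw [abs_of_nonneg (by positivity)] at this
  have h1 := le_max_left (|M| + |C| + 1) 0
  have := le_abs_self C
  have := abs_nonneg M
  linarith

theorem IsSmooth.region_bounded (hf : f.IsSmooth) {a : ℤ × ℤ} (ha : a ∈ f.interiorExponents) :
    Bornology.IsBounded (f.region a) := by
  obtain ⟨M, hM⟩ := hf.exists_bound
  refine isBounded_iff_forall_norm_le.2 ⟨M, fun x hx => hM a ha x ?_⟩
  rw [show f.cell x = {a} from hx]
  rfl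

/-- Arbitrarily close to a vertex of the curve, every exponent of its cell is the only minimal one
somewhere. -/
theorem IsUnimodularAt.mem_closure_region {x : ℝ × ℝ} (hx : f.IsUnimodularAt x) {a : ℤ × ℤ}
    (ha : a ∈ f.cell x) : x ∈ closure (f.region a) := by
  obtain ⟨b, c, hc, hd⟩ := hx.exists_others ha
  -- In this direction `b` and `c` both grow at rate 1 relative to `a`, so it points into the region
  -- of `a`.
  set d : ℝ × ℝ := edgeDir a b - edgeDir a c with hd'
  have hb : dot b d - dot a d = 1 := by
    have h1 := dot_edgeDir a c b
    have h2 := dot_edgeDir_right a b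
    rw [doubleArea_swap', hd] at h1
    simp only [hd', dot, Prod.fst_sub, Prod.snd_sub] at *
    push_cast at h1
    linarith
  have hc' : dot c d - dot a d = 1 := by
    have h1 := dot_edgeDir a b c
    have h2 := dot_edgeDir_right a c
    rw [hd] at h1
    simp only [hd', dot, Prod.fst_sub, Prod.snd_sub] at *
    push_cast at h1
    linarith
  obtain ⟨ε, hε, h⟩ := exists_cell_nearby (f := f) (x := x) (d := d) ha (by
    rw [hc]
    rintro e (rfl | rfl | rfl) <;> linarith)
  have hlim : Filter.Tendsto (fun t : ℝ => x + t • d) (nhdsWithin 0 (Set.Ioi 0)) (nhds x) := by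
    have : Continuous fun t : ℝ => x + t • d := by fun_prop
    have := (this.tendsto 0).mono_left (nhdsWithin_le_nhds (s := Set.Ioi 0))
    simpa using this
  refine mem_closure_of_tendsto hlim ?_
  filter_upwards [Ioo_mem_nhdsGT hε] with t ht
  show f.cell _ = _
  rw [h t ht.1 ht.2, hc]
  ext e
  simp only [Set.mem_insert_iff, Set.mem_singleton_iff, Set.mem_ofPred_eq]
  constructor
  · rintro ⟨rfl | rfl | rfl, h⟩
    · rfl
    · linarith
    · linarith
  · rintro rfl
    exact ⟨Or.inl rfl, rfl⟩

theorem IsSmooth.region_nonempty (hf : f.IsSmooth) {a : ℤ × ℤ} (ha : a ∈ f.interiorExponents) :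
    (f.region a).Nonempty := by
  obtain ⟨x, hx, hax⟩ := hf.exists_vertex_of_interior ha
  exact closure_nonempty_iff.1 ⟨x, (hf.unimodular hx).mem_closure_region hax⟩

theorem IsSmooth.mem_frontier_region (hf : f.IsSmooth) {x : ℝ × ℝ} (hx : x ∈ f.curveVertices)
    (a : ℤ × ℤ) : x ∈ frontier (f.region a) ↔ a ∈ f.cell x := by
  rw [(isOpen_region hf.nonempty_support a).frontier_eq]
  constructor
  · rintro ⟨h, -⟩
    exact closure_minimal (fun y hy => by
      show a ∈ f.cell y
      rw [show f.cell y = {a} from hy]; rfl) (isClosed_mem_cell f a) h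
  · refine fun h => ⟨(hf.unimodular hx).mem_closure_region h, fun hr => ?_⟩
    obtain ⟨p, hp, q, hq, r, hr', hne⟩ := hx
    rw [show f.cell x = {a} from hr] at hp hq hr'
    rw [Set.mem_singleton_iff.1 hp, Set.mem_singleton_iff.1 hq, Set.mem_singleton_iff.1 hr', doubleArea_self_left] at hne
    exact hne rfl

theorem IsSmooth.mem_frontier_outerRegion (hf : f.IsSmooth) {x : ℝ × ℝ}
    (hx : x ∈ f.curveVertices) (hI : ∃ a ∈ f.cell x, a ∈ f.interiorExponents) :
    x ∈ frontier f.outerRegion ↔ ¬ f.cell x ⊆ f.interiorExponents := by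
  rw [(isOpen_outerRegion f).frontier_eq]
  constructor
  · rintro ⟨h, -⟩ hsub
    have hcl : x ∈ {x | ∃ a ∈ f.interiorExponentsᶜ, a ∈ f.cell x} :=
      closure_minimal (fun y hy => by
        obtain ⟨b, hb⟩ := cell_nonempty hf.nonempty_support y
        exact ⟨b, hy b hb, hb⟩) (isClosed_cell_inter_nonempty f _) h
    obtain ⟨b, hb, hbx⟩ := hcl
    exact hb (hsub hbx)
  · intro h
    obtain ⟨b, hb, hbI⟩ := Set.not_subset.1 h
    refine ⟨closure_mono (fun y hy => ?_) ((hf.unimodular hx).mem_closure_region hb), ?_⟩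
    · intro c hc
      rw [show f.cell y = {b} from hy] at hc
      rw [hc]
      exact hbI
    · obtain ⟨a, ha, haI⟩ := hI
      exact fun h => h a ha haI

/-- A tie between an interior exponent and another one occurs on a bounded edge, which survives the
pruning since it borders a bounded region. For the converse, `hcore` supplies the interior exponent
on a core edge. -/
theorem IsSmooth.skeletonSupport_eq (hf : f.IsSmooth)
    (hcore : ∀ x y, f.coreGraph.Adj x y → ∃ a ∈ f.interiorExponents, a ∈ f.cell x ∧ a ∈ f.cell y) :
    f.skeletonSupport = {z | ∃ a ∈ f.interiorExponents, a ∈ f.cell z ∧ f.cell z ≠ {a}} := by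
  ext z
  constructor
  · rintro ⟨x, y, hxy, hz⟩
    rw [segment_eq_image'] at hz
    obtain ⟨t, ⟨h0, h1⟩, rfl⟩ := hz
    obtain ⟨a, haI, hax, hay⟩ := hcore x y hxy
    refine ⟨a, haI, mem_cell_segment hax hay h0 h1, fun h => ?_⟩
    exact ne_of_cell_eq_singleton hxy.2.2 h h0 h1 rfl
  · rintro ⟨a, haI, haz, hne⟩
    obtain ⟨b, hbz, hba⟩ : ∃ b ∈ f.cell z, b ≠ a := by
      by_contra hcon
      push Not at hcon
      exact hne (Set.eq_singleton_iff_unique_mem.2 ⟨haz, hcon⟩)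
    obtain ⟨x, hx, hsub⟩ := exists_vertex_of_pair hf.1 haz hbz hba.symm
    obtain ⟨y, hxy, hay, hby⟩ := hf.exists_adj_of_interior hx (hsub haz) (hsub hbz) hba.symm haI
    refine ⟨x, y, hf.coreGraph_adj hxy haI (hsub haz) hay, ?_⟩
    obtain ⟨p, q, c, e, hcx, hcy, hdc, hde, hint, ⟨τ, hτ, hy⟩, -⟩ := hf.exists_cells_of_adj hxy
    have hpq : p ≠ q := doubleArea_ne_zero_left (c := c) (by rw [hdc]; decide)
    have hset : ({p, q} : Set (ℤ × ℤ)) = {a, b} := by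
      rw [← hint, hf.inter_eq hxy hba.symm (hsub haz) hay (hsub hbz) hby]
    have hpz : p ∈ f.cell z := by
      have : p ∈ ({a, b} : Set (ℤ × ℤ)) := hset ▸ Or.inl rfl
      rcases this with rfl | rfl <;> assumption
    have hqz : q ∈ f.cell z := by
      have : q ∈ ({a, b} : Set (ℤ × ℤ)) := hset ▸ Or.inr rfl
      rcases this with rfl | rfl <;> assumption
    have hpx : p ∈ f.cell x := by simp [hcx]
    have hqx : q ∈ f.cell x := by simp [hcx]
    have hpy : p ∈ f.cell y := by simp [hcy]
    -- The point `z` lies on the line of the edge; the exponents `c` and `e` opposite to the common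
    -- side confine it to the segment.
    obtain ⟨t, ht⟩ := exists_eq_add_smul_edgeDir hpq hpx hqx hpz hqz
    have hcx' : c ∈ f.cell x := by simp [hcx]
    have hey : e ∈ f.cell y := by simp [hcy]
    have hdc' := dot_edgeDir p q c
    have hde' := dot_edgeDir p q e
    rw [hdc] at hdc'
    rw [hde] at hde'
    push_cast at hdc' hde'
    have k1 := value_eq_of_mem_cell hpx hcx'
    have k2 := hpz.2 c hcx'.1
    have k3 := value_eq_of_mem_cell hpy hey
    have k4 := hpz.2 e hey.1
    rw [ht, monomialValue_add, monomialValue_add] at k2 k4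
    rw [hy, monomialValue_add, monomialValue_add] at k3
    have t0 : 0 ≤ t := by nlinarith
    have t1 : t ≤ τ := by nlinarith
    rw [segment_eq_image']
    refine ⟨t / τ, ⟨by positivity, (div_le_one hτ).2 t1⟩, ?_⟩
    simp only [hy, ht, add_sub_cancel_left, smul_smul, div_mul_cancel₀ _ hτ.ne']

theorem connectedComponentIn_eq_of_isOpen {α : Type*} [TopologicalSpace α] {s u v : Set α} {x : α}
    (hs : s = u ∪ v) (hu : IsOpen u) (hv : IsOpen v) (hd : Disjoint u v) (hx : x ∈ u)
    (hc : IsPreconnected u) : connectedComponentIn s x = u := by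
  subst hs
  refine Set.Subset.antisymm ?_ (hc.subset_connectedComponentIn hx Set.subset_union_left)
  exact isPreconnected_connectedComponentIn.subset_left_of_subset_union hu hv hd
    (connectedComponentIn_subset _ _) ⟨x, mem_connectedComponentIn (Or.inl hx), hx⟩

/-- The faces of the embedded skeleton are the bounded regions and the outer region. -/
theorem IsSmooth.isFace_iff (hf : f.IsSmooth)
    (hcore : ∀ x y, f.coreGraph.Adj x y → ∃ a ∈ f.interiorExponents, a ∈ f.cell x ∧ a ∈ f.cell y)
    (F : Set (ℝ × ℝ)) :
    f.IsFace F ↔ F = f.outerRegion ∨ ∃ a ∈ f.interiorExponents, F = f.region a := by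
  have hsupp := hf.skeletonSupport_eq hcore
  have hcompl : f.skeletonSupportᶜ = f.outerRegion ∪ ⋃ a ∈ f.interiorExponents, f.region a := by
    ext z
    rw [hsupp]
    simp only [Set.mem_compl_iff, Set.mem_ofPred_eq, not_exists, not_and, not_not, Set.mem_union,
      Set.mem_iUnion, exists_prop]
    constructor
    · intro h
      by_cases hz : z ∈ f.outerRegion
      · exact Or.inl hz
      · simp only [outerRegion, Set.mem_ofPred_eq] at hz
        push Not at hz
        obtain ⟨a, ha, haI⟩ := hz
        exact Or.inr ⟨a, haI, h a haI ha⟩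
    · rintro (h | ⟨a, haI, ha⟩) b hbI hb
      · exact absurd hbI (h b hb)
      · have ha : f.cell z = {a} := ha
        rw [ha] at hb ⊢
        rw [hb]
  have hdisj : ∀ {a b}, a ≠ b → Disjoint (f.region a) (f.region b) := by
    intro a b hab
    rw [Set.disjoint_left]
    intro z hz hz'
    exact hab (Set.singleton_injective ((show f.cell z = {a} from hz).symm.trans hz'))
  have hdisjU : ∀ {a}, a ∈ f.interiorExponents → Disjoint f.outerRegion (f.region a) := by
    intro a ha
    rw [Set.disjoint_left]
    intro z hz hz'
    exact hz a (by rw [show f.cell z = {a} from hz']; rfl) ha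
  have hU : ∀ z ∈ f.outerRegion, connectedComponentIn f.skeletonSupportᶜ z = f.outerRegion :=
    fun z hz => connectedComponentIn_eq_of_isOpen hcompl (isOpen_outerRegion f)
      (isOpen_biUnion fun a _ => isOpen_region hf.nonempty_support a)
      (Set.disjoint_iUnion₂_right.2 fun a ha => hdisjU ha) hz hf.isPreconnected_outerRegion
  have hR : ∀ a ∈ f.interiorExponents, ∀ z ∈ f.region a,
      connectedComponentIn f.skeletonSupportᶜ z = f.region a := by
    intro a ha z hz
    refine connectedComponentIn_eq_of_isOpen
      (v := f.outerRegion ∪ ⋃ b ∈ f.interiorExponents \ {a}, f.region b) ?_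
      (isOpen_region hf.nonempty_support a) ((isOpen_outerRegion f).union
        (isOpen_biUnion fun a _ => isOpen_region hf.nonempty_support a))
      (Set.disjoint_union_right.2 ⟨(hdisjU ha).symm,
        Set.disjoint_iUnion₂_right.2 fun b hb => hdisj (Ne.symm hb.2)⟩) hz
      (convex_region f a).isPreconnected
    rw [hcompl]
    ext y
    simp only [Set.mem_union, Set.mem_iUnion, exists_prop, Set.mem_sdiff, Set.mem_singleton_iff]
    constructor
    · rintro (h | ⟨b, hb, h⟩)
      · exact Or.inr (Or.inl h)
      · by_cases hba : b = a
        · exact Or.inl (hba ▸ h)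
        · exact Or.inr (Or.inr ⟨b, ⟨hb, hba⟩, h⟩)
    · rintro (h | h | ⟨b, hb, h⟩)
      · exact Or.inr ⟨a, ha, h⟩
      · exact Or.inl h
      · exact Or.inr ⟨b, hb.1, h⟩
  constructor
  · rintro ⟨p, hp, rfl⟩
    rw [hcompl] at hp
    rcases hp with hp | hp
    · exact Or.inl (hU p hp)
    · simp only [Set.mem_iUnion, exists_prop] at hp
      obtain ⟨a, ha, hpa⟩ := hp
      exact Or.inr ⟨a, ha, hR a ha p hpa⟩
  · rintro (rfl | ⟨a, ha, rfl⟩)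
    · have hne : f.outerRegion.Nonempty := by
        by_contra h
        rw [Set.not_nonempty_iff_eq_empty] at h
        exact hf.outerRegion_unbounded (h ▸ Bornology.isBounded_empty)
      obtain ⟨z, hz⟩ := hne
      exact ⟨z, hcompl ▸ Or.inl hz, (hU z hz).symm⟩
    · obtain ⟨z, hz⟩ := hf.region_nonempty ha
      refine ⟨z, hcompl ▸ Or.inr ?_, (hR a ha z hz).symm⟩
      simp only [Set.mem_iUnion, exists_prop]
      exact ⟨a, ha, hz⟩

end TropicalPolynomial

/-! ### Labellings of curves with prism skeleton -/

namespace TropicalPolynomial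

variable {f : TropicalPolynomial}

/-- Every edge over a peripheral cycle borders a bounded region. -/
theorem IsSmooth.exists_interior_of_mem {W : Type*} {G : SimpleGraph W} {σ : W → ℝ × ℝ}
    {c : W → W → Set (Sym2 (ℝ × ℝ))} {X : Set W} (hf : f.IsSmooth) (h : f.IsSubdivision G σ c)
    (hX : IsPeripheral G X) {u w : W} (hu : u ∈ X) (hw : w ∈ X) (huw : G.Adj u w) {x y : ℝ × ℝ}
    (hxy : s(x, y) ∈ c u w) : ∃ a ∈ f.interiorExponents, a ∈ f.cell x ∧ a ∈ f.cell y := by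
  obtain ⟨T, hTI, hT, -⟩ := hf.peripheral h hX
  have hH := (inducedPart_adj_iff h huw hxy).2 ⟨hu, hw⟩
  obtain ⟨-, -, -, p, ⟨hpx, hpy⟩, q, ⟨hqx, hqy⟩, hpq⟩ := inducedPart_le hH
  have hnot := (hT x y p q (inducedPart_le hH) hpq hpx hpy hqx hqy).1 hH
  by_cases hp : p ∈ T
  · exact ⟨p, hTI hp, hpx, hpy⟩
  · have hq : q ∈ T := by
      by_contra hq
      exact hnot ⟨fun h => absurd h hp, fun h => absurd h hq⟩
    exact ⟨q, hTI hq, hqx, hqy⟩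

/-- The combinatorial description of a smooth curve whose skeleton is a prism graph: `α j` is the
exponent of the bounded region inside the peripheral cycle `j`, and `j₀` bounds the outer face. -/
structure IsPrismLabelling {m : ℕ} (f : TropicalPolynomial) (σ : Fin (m + 4) × Fin 2 → ℝ × ℝ)
    (j₀ : Fin (m + 4) ⊕ Fin 2) (α : Fin (m + 4) ⊕ Fin 2 → ℤ × ℤ) : Prop where
  injective : Function.Injective σ
  mem_curveVertices : ∀ v, σ v ∈ f.curveVertices
  cell_subset_iff : ∀ v, f.cell (σ v) ⊆ f.interiorExponents ↔ v ∉ prismCycle m j₀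
  mem_cell_iff : ∀ j, j ≠ j₀ → ∀ v, α j ∈ f.cell (σ v) ↔ v ∈ prismCycle m j
  interiorExponents_eq : f.interiorExponents = α '' {j | j ≠ j₀}
  exists_interior : ∀ x y, f.coreGraph.Adj x y →
    ∃ a ∈ f.interiorExponents, a ∈ f.cell x ∧ a ∈ f.cell y

/-- All vertices of the prism have three neighbours, so the core is a subdivision of it. Every edge
lies on a peripheral cycle and therefore borders a bounded region. -/
theorem IsSmooth.exists_isPrismLabelling {m : ℕ} (hf : f.IsSmooth) (hs : f.skeleton.Simple)
    (φ : f.skeleton.toSimpleGraph ≃g prismGraph (m + 4)) : ∃ j₀ α,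
      f.IsPrismLabelling (fun v => ((φ.symm v : f.skeleton.vertexSet) : ℝ × ℝ)) j₀ α := by
  obtain ⟨c, h⟩ := hf.exists_isSubdivision hs φ prismGraph_ncard_neighborSet (0, 0)
  obtain ⟨j₀, α, h1, h2, h3⟩ := hf.exists_outer h isPeripheral_prismCycle prismCycle_injective
    fun u w => even_ncard_prismCycle
  refine ⟨j₀, α, h.injective, fun v => coreVertices_subset f (h.mem v).1, h1, h2, h3, ?_⟩
  intro x y hxy
  obtain ⟨u, w, huw, hm⟩ := h.cover x y hxy
  obtain ⟨j, hu, hw⟩ : ∃ j, u ∈ prismCycle m j ∧ w ∈ prismCycle m j := by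
    obtain ⟨i, k⟩ := u
    rcases (prismGraph_adj_iff _ _).1 huw with rfl | h | rfl
    · exact ⟨.inl i, Or.inl rfl, Or.inr rfl⟩
    · obtain ⟨l, k'⟩ := w
      simp only [Prod.mk.injEq] at h
      exact ⟨.inl l, Or.inr h.1, Or.inl rfl⟩
    · exact ⟨.inl i, Or.inl rfl, Or.inl rfl⟩
  exact hf.exists_interior_of_mem h (isPeripheral_prismCycle j) hu hw huw hm

theorem IsPrismLabelling.exists_mem {m : ℕ} {σ : Fin (m + 4) × Fin 2 → ℝ × ℝ}
    {j₀ : Fin (m + 4) ⊕ Fin 2} {α : Fin (m + 4) ⊕ Fin 2 → ℤ × ℤ} (h : f.IsPrismLabelling σ j₀ α)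
    (v : Fin (m + 4) × Fin 2) : ∃ a ∈ f.cell (σ v), a ∈ f.interiorExponents := by
  have key : ∀ j, j ≠ j₀ → v ∈ prismCycle m j → ∃ a ∈ f.cell (σ v), a ∈ f.interiorExponents :=
    fun j hj hv => ⟨α j, (h.mem_cell_iff j hj v).2 hv, h.interiorExponents_eq ▸ ⟨j, hj, rfl⟩⟩
  by_cases h0 : Sum.inr v.2 = j₀
  · exact key (.inl v.1) (by rw [← h0]; simp) (Or.inl rfl)
  · exact key (.inr v.2) h0 rfl

/-- A skeleton vertex is on the frontier of a bounded region if its exponent is in the cell, and on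
that of the outer region if the cell contains a non-interior exponent. The labelling translates both
into membership in a peripheral cycle. -/
theorem IsPrismLabelling.faces {m : ℕ} (hf : f.IsSmooth)
    {φ : f.skeleton.toSimpleGraph ≃g prismGraph (m + 4)} {j₀ : Fin (m + 4) ⊕ Fin 2}
    {α : Fin (m + 4) ⊕ Fin 2 → ℤ × ℤ}
    (h : f.IsPrismLabelling (fun v => ((φ.symm v : f.skeleton.vertexSet) : ℝ × ℝ)) j₀ α) :
    (∀ F, f.IsFace F → ¬ Bornology.IsBounded F → boundaryVertices φ F = prismCycle m j₀) ∧
    {s | ∃ F, f.IsFace F ∧ Bornology.IsBounded F ∧ boundaryVertices φ F = s} =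
      prismCycle m '' {j | j ≠ j₀} := by
  have hface := hf.isFace_iff h.exists_interior
  have hU : boundaryVertices φ f.outerRegion = prismCycle m j₀ := by
    ext v
    rw [boundaryVertices, Set.mem_ofPred_eq,
      hf.mem_frontier_outerRegion (h.mem_curveVertices v) (h.exists_mem v),
      h.cell_subset_iff v, not_not]
  have hR : ∀ j, j ≠ j₀ → boundaryVertices φ (f.region (α j)) = prismCycle m j := by
    intro j hj
    ext v
    rw [boundaryVertices, Set.mem_ofPred_eq, hf.mem_frontier_region (h.mem_curveVertices v),
      h.mem_cell_iff j hj v]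
  constructor
  · intro F hF hb
    rcases (hface F).1 hF with rfl | ⟨a, ha, rfl⟩
    · exact hU
    · exact absurd (hf.region_bounded ha) hb
  · ext s
    constructor
    · rintro ⟨F, hF, hb, rfl⟩
      rcases (hface F).1 hF with rfl | ⟨a, ha, rfl⟩
      · exact absurd hb hf.outerRegion_unbounded
      · rw [h.interiorExponents_eq] at ha
        obtain ⟨j, hj, rfl⟩ := ha
        exact ⟨j, hj, (hR j hj).symm⟩
    · rintro ⟨j, hj, rfl⟩
      have haI : α j ∈ f.interiorExponents := h.interiorExponents_eq ▸ ⟨j, hj, rfl⟩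
      exact ⟨_, (hface _).2 (Or.inr ⟨_, haI, rfl⟩), hf.region_bounded haI, hR j hj⟩

end TropicalPolynomial

theorem prismCycle_image_eq {m : ℕ} : prismCycle m '' {j | j ≠ .inr 1} =
    insert {v | v.2 = 0}
      {s | ∃ i j, (SimpleGraph.cycleGraph (m + 4)).Adj i j ∧ s = {v | v.1 = i ∨ v.1 = j}} := by
  ext s
  constructor
  · rintro ⟨i | j, hj, rfl⟩
    · right
      exact ⟨i, i + 1, SimpleGraph.cycleGraph_adj.2 (Or.inr (by simp)), rfl⟩
    · left
      have : ∀ j : Fin 2, (Sum.inr j : Fin (m + 4) ⊕ Fin 2) ≠ .inr 1 → j = 0 := by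
        intro j hj
        fin_cases j
        · rfl
        · exact absurd rfl hj
      rw [this j hj]
      rfl
  · rintro (rfl | ⟨i, j, h, rfl⟩)
    · exact ⟨.inr 0, by simp, rfl⟩
    · rcases SimpleGraph.cycleGraph_adj.1 h with h | h
      · refine ⟨.inl j, by simp, ?_⟩
        rw [sub_eq_iff_eq_add, add_comm (1 : Fin (m + 4))] at h
        subst h
        ext v
        exact or_comm
      · refine ⟨.inl i, by simp, ?_⟩
        rw [sub_eq_iff_eq_add, add_comm (1 : Fin (m + 4))] at h
        subst h
        rfl

/-- An automorphism of the prism graph that permutes the peripheral cycles. -/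
structure IsPrismSymmetry {m : ℕ} (ψ : prismGraph (m + 4) ≃g prismGraph (m + 4))
    (τ : Fin (m + 4) ⊕ Fin 2 ≃ Fin (m + 4) ⊕ Fin 2) : Prop where
  image_eq : ∀ j, ψ '' prismCycle m j = prismCycle m (τ j)

namespace TropicalPolynomial

theorem IsPrismLabelling.inheritsStandardEmbedding {f : TropicalPolynomial} {m : ℕ}
    (hf : f.IsSmooth) (hs : f.skeleton.Simple)
    {φ : f.skeleton.toSimpleGraph ≃g prismGraph (m + 4)} {j₀ : Fin (m + 4) ⊕ Fin 2}
    {α : Fin (m + 4) ⊕ Fin 2 → ℤ × ℤ}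
    (h : f.IsPrismLabelling (fun v => ((φ.symm v : f.skeleton.vertexSet) : ℝ × ℝ)) j₀ α)
    {ψ : prismGraph (m + 4) ≃g prismGraph (m + 4)}
    {τ : Fin (m + 4) ⊕ Fin 2 ≃ Fin (m + 4) ⊕ Fin 2} (hψ : IsPrismSymmetry ψ τ)
    (hτ : τ j₀ = .inr 1) : InheritsStandardEmbedding f (m + 4) := by
  obtain ⟨h1, h2⟩ := h.faces hf
  have hb : ∀ F, boundaryVertices (φ.trans ψ) F = ψ '' boundaryVertices φ F := by
    intro F
    ext v
    constructor
    · intro hv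
      exact ⟨ψ.symm v, hv, ψ.apply_symm_apply v⟩
    · rintro ⟨w, hw, rfl⟩
      show (((φ.trans ψ).symm (ψ w) : f.skeleton.vertexSet) : ℝ × ℝ) ∈ frontier F
      have : (φ.trans ψ).symm (ψ w) = φ.symm w := congrArg φ.symm (ψ.symm_apply_apply w)
      rw [this]
      exact hw
  refine ⟨hs, φ.trans ψ, ?_, ?_⟩
  · intro F hF hF'
    rw [hb, h1 F hF hF', hψ.image_eq, hτ]
    rfl
  · rw [← prismCycle_image_eq]
    have : {s | ∃ F, f.IsFace F ∧ Bornology.IsBounded F ∧ boundaryVertices (φ.trans ψ) F = s} =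
        (fun s => ψ '' s) ''
          {s | ∃ F, f.IsFace F ∧ Bornology.IsBounded F ∧ boundaryVertices φ F = s} := by
      ext s
      constructor
      · rintro ⟨F, h1, h2, rfl⟩
        exact ⟨_, ⟨F, h1, h2, rfl⟩, (hb F).symm⟩
      · rintro ⟨_, ⟨F, h1, h2, rfl⟩, rfl⟩
        exact ⟨F, h1, h2, hb F⟩
    rw [this, h2]
    ext s
    constructor
    · rintro ⟨_, ⟨j, hj, rfl⟩, rfl⟩
      exact ⟨τ j, fun he => hj (τ.injective (he.trans hτ.symm)), (hψ.image_eq j).symm⟩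
    · rintro ⟨j, hj, rfl⟩
      refine ⟨_, ⟨τ.symm j, fun he => hj ?_, rfl⟩, ?_⟩
      · rw [← hτ, ← he, τ.apply_symm_apply]
      · show ψ '' _ = _
        rw [hψ.image_eq, τ.apply_symm_apply]

end TropicalPolynomial

theorem isPrismSymmetry_refl {m : ℕ} :
    IsPrismSymmetry (SimpleGraph.Iso.refl : prismGraph (m + 4) ≃g _) (Equiv.refl _) :=
  ⟨fun j => by
    ext v
    simp⟩

/-- Swapping the two copies of the long cycle. -/
theorem exists_isPrismSymmetry_swap {m : ℕ} :
    ∃ (ψ : prismGraph (m + 4) ≃g prismGraph (m + 4)) (τ : _), IsPrismSymmetry ψ τ ∧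
      τ (.inr 0) = .inr 1 := by
  have h2 : ∀ j : Fin 2, j + 1 + 1 = j := by decide
  let e : Fin 2 ≃ Fin 2 := ⟨fun j => j + 1, fun j => j + 1, h2, h2⟩
  refine ⟨⟨(Equiv.refl _).prodCongr e, ?_⟩, (Equiv.refl _).sumCongr e, ⟨?_⟩, rfl⟩
  · rintro ⟨i, j⟩ ⟨k, l⟩
    simp only [prismGraph_adj_iff, Equiv.prodCongr_apply, Equiv.coe_refl, Prod.map_apply, id,
      Prod.mk.injEq, EmbeddingLike.apply_eq_iff_eq]
    simp [e]
  · rintro (i | j)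
    · ext ⟨k, l⟩
      constructor
      · rintro ⟨⟨k', l'⟩, h, he⟩
        obtain ⟨rfl, -⟩ := Prod.mk.inj he
        exact h
      · exact fun h => ⟨(k, l + 1), h, Prod.ext rfl (h2 l)⟩
    · ext ⟨k, l⟩
      constructor
      · rintro ⟨⟨k', l'⟩, (rfl : l' = j), he⟩
        exact (Prod.mk.inj he).2.symm
      · exact fun h => ⟨(k, j), rfl, Prod.ext rfl (Eq.symm h)⟩

/-- The prism over the quadrilateral is the graph of the cube. -/
theorem exists_isPrismSymmetry_cube (i : Fin 4) :
    ∃ (ψ : prismGraph (0 + 4) ≃g prismGraph (0 + 4)) (τ : _), IsPrismSymmetry ψ τ ∧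
      τ (.inl i) = .inr 1 := by
  -- An automorphism of the cube, tabulated by the offset from `i`: the columns `i` and `i + 1`
  -- become copy 1 of the long cycle and the other two become copy 0. The map `g'` is its inverse,
  -- and `t`, `t'` are the induced permutations of the six faces.
  let g : Fin 4 × Fin 2 → Fin 4 × Fin 2 := fun v =>
    (![![0, 1], ![3, 2], ![3, 2], ![0, 1]] (v.1 - i) v.2, ![1, 1, 0, 0] (v.1 - i))
  let g' : Fin 4 × Fin 2 → Fin 4 × Fin 2 := fun v =>
    (i + ![![3, 0], ![3, 0], ![2, 1], ![2, 1]] v.1 v.2, ![0, 1, 1, 0] v.1)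
  let t : Fin 4 ⊕ Fin 2 → Fin 4 ⊕ Fin 2 := Sum.elim
    (fun k => ![.inr 1, .inl 2, .inr 0, .inl 0] (k - i)) ![.inl 3, .inl 1]
  let t' : Fin 4 ⊕ Fin 2 → Fin 4 ⊕ Fin 2 := Sum.elim
    ![.inl (3 + i), .inr 1, .inl (1 + i), .inr 0] ![.inl (2 + i), .inl i]
  have hl : ∀ v, g' (g v) = v := by revert i; decide +kernel
  have hr : ∀ v, g (g' v) = v := by revert i; decide +kernel
  have tl : ∀ v, t' (t v) = v := by revert i; decide +kernel
  have tr : ∀ v, t (t' v) = v := by revert i; decide +kernel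
  have hadj : ∀ v w : Fin 4 × Fin 2, (g w = ((g v).1 + 1, (g v).2) ∨ g v = ((g w).1 + 1, (g w).2) ∨
      g w = ((g v).1, (g v).2 + 1)) ↔ (w = (v.1 + 1, v.2) ∨ v = (w.1 + 1, w.2) ∨
      w = (v.1, v.2 + 1)) := by
    clear hl hr tl tr
    revert i
    decide +kernel
  refine ⟨⟨⟨g, g', hl, hr⟩, ?_⟩, ⟨t, t', tl, tr⟩, ⟨?_⟩, ?_⟩
  · intro v w
    rw [prismGraph_adj_iff, prismGraph_adj_iff]
    exact hadj v w
  · intro j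
    have h : ∀ (j : Fin 4 ⊕ Fin 2) (v : Fin 4 × Fin 2),
        Sum.elim (fun i => decide (v.1 = i ∨ v.1 = i + 1)) (fun j => decide (v.2 = j)) j =
        Sum.elim (fun i => decide ((g v).1 = i ∨ (g v).1 = i + 1))
          (fun j => decide ((g v).2 = j)) (t j) := by
      clear hl hr tl tr hadj
      revert i
      decide +kernel
    have hmem : ∀ (j : Fin 4 ⊕ Fin 2) (v : Fin 4 × Fin 2), v ∈ prismCycle 0 j ↔
        Sum.elim (fun i => decide (v.1 = i ∨ v.1 = i + 1)) (fun j => decide (v.2 = j)) j =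
          true := by
      rintro (j | j) v <;> simp [prismCycle]
    have h' : ∀ j v, v ∈ prismCycle 0 j ↔ g v ∈ prismCycle 0 (t j) := by
      intro j v
      rw [hmem, hmem, h]
    ext v
    constructor
    · rintro ⟨w, hw, rfl⟩
      exact (h' j w).1 hw
    · intro hv
      refine ⟨g' v, (h' j (g' v)).2 ?_, hr v⟩
      rw [hr]
      exact hv
  · show ![Sum.inr 1, Sum.inl 2, Sum.inr 0, Sum.inl 0] (i - i) = _
    rw [sub_self]
    rfl

/-! ### Lattice coordinates and the interior polygon -/

/-- The lattice points of a polygon and its interior lattice points, as far as they matter for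
smooth tropical curves. -/
structure IsInterior (S I : Set (ℤ × ℤ)) : Prop where
  subset : I ⊆ S
  combination : ∀ {w u v z : ℤ × ℤ} {k α β γ : ℤ}, u ∈ I → v ∈ S → z ∈ S → 0 < α → 0 ≤ β → 0 ≤ γ →
    k = α + β + γ → k * w.1 = α * u.1 + β * v.1 + γ * z.1 →
    k * w.2 = α * u.2 + β * v.2 + γ * z.2 → w ∈ I
  exists_lt : ∀ a ∈ I, ∀ p q : ℤ, (p ≠ 0 ∨ q ≠ 0) → ∃ b ∈ S, p * b.1 + q * b.2 < p * a.1 + q * a.2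

/-- The determinant of two lattice vectors. -/
def latticeDet (a b : ℤ × ℤ) : ℤ := a.1 * b.2 - a.2 * b.1

/-- Affine lattice coordinates with origin `p` and axes `e₀` and `e₁`. -/
def latticeFrame (p e₀ e₁ x : ℤ × ℤ) : ℤ × ℤ :=
  (p.1 + x.1 * e₀.1 + x.2 * e₁.1, p.2 + x.1 * e₀.2 + x.2 * e₁.2)

/-- The lattice coordinates of a point. -/
def latticeCoords (p e₀ e₁ y : ℤ × ℤ) : ℤ × ℤ :=
  (latticeDet e₀ e₁ * ((y.1 - p.1) * e₁.2 - (y.2 - p.2) * e₁.1),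
    latticeDet e₀ e₁ * (e₀.1 * (y.2 - p.2) - e₀.2 * (y.1 - p.1)))

theorem latticeFrame_coords {p e₀ e₁ : ℤ × ℤ} (he : latticeDet e₀ e₁ ^ 2 = 1) (y : ℤ × ℤ) :
    latticeFrame p e₀ e₁ (latticeCoords p e₀ e₁ y) = y := by
  have hD : e₀.1 * e₁.2 - e₀.2 * e₁.1 = latticeDet e₀ e₁ := rfl
  ext
  · simp only [latticeFrame, latticeCoords]
    linear_combination latticeDet e₀ e₁ * (y.1 - p.1) * hD + (y.1 - p.1) * he
  · simp only [latticeFrame, latticeCoords]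
    linear_combination latticeDet e₀ e₁ * (y.2 - p.2) * hD + (y.2 - p.2) * he

theorem latticeCoords_frame {p e₀ e₁ : ℤ × ℤ} (he : latticeDet e₀ e₁ ^ 2 = 1) (x : ℤ × ℤ) :
    latticeCoords p e₀ e₁ (latticeFrame p e₀ e₁ x) = x := by
  have hD : e₀.1 * e₁.2 - e₀.2 * e₁.1 = latticeDet e₀ e₁ := rfl
  ext
  · simp only [latticeFrame, latticeCoords]
    linear_combination latticeDet e₀ e₁ * x.1 * hD + x.1 * he
  · simp only [latticeFrame, latticeCoords]
    linear_combination latticeDet e₀ e₁ * x.2 * hD + x.2 * he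

theorem latticeDet_coords {p e₀ e₁ : ℤ × ℤ} (he : latticeDet e₀ e₁ ^ 2 = 1) (y z : ℤ × ℤ) :
    latticeDet (latticeCoords p e₀ e₁ y) (latticeCoords p e₀ e₁ z) =
      latticeDet e₀ e₁ * doubleArea p y z := by
  have hD : e₀.1 * e₁.2 - e₀.2 * e₁.1 = latticeDet e₀ e₁ := rfl
  rw [latticeDet]
  simp only [latticeCoords, doubleArea]
  linear_combination latticeDet e₀ e₁ ^ 2 *
    ((y.1 - p.1) * (z.2 - p.2) - (y.2 - p.2) * (z.1 - p.1)) * hD +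
    latticeDet e₀ e₁ * ((y.1 - p.1) * (z.2 - p.2) - (y.2 - p.2) * (z.1 - p.1)) * he

theorem TropicalPolynomial.IsSmooth.isInterior {f : TropicalPolynomial} (hf : f.IsSmooth)
    (p : ℤ × ℤ) {e₀ e₁ : ℤ × ℤ} (he : latticeDet e₀ e₁ ^ 2 = 1) :
    IsInterior (latticeFrame p e₀ e₁ ⁻¹' f.support)
      (latticeFrame p e₀ e₁ ⁻¹' f.interiorExponents) where
  subset _ hx := hf.interiorExponents_subset hx
  combination {w u v z k α β γ} hu hv hz hα hβ hγ hk h1 h2 := by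
    refine mem_interiorExponents_of_combination (k := k) hu hv hz hα hβ hγ hk ?_ ?_
    · simp only [latticeFrame]
      linear_combination p.1 * hk + e₀.1 * h1 + e₁.1 * h2
    · simp only [latticeFrame]
      linear_combination p.2 * hk + e₀.2 * h1 + e₁.2 * h2
  exists_lt a ha r s hrs := by
    have he0 : latticeDet e₀ e₁ ≠ 0 := by rintro h; rw [h] at he; norm_num at he
    set D := latticeDet e₀ e₁ with hD
    have hD' : e₀.1 * e₁.2 - e₀.2 * e₁.1 = D := rfl
    -- The functional `(r, s)` of the lattice coordinates is carried to standard coordinates by the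
    -- inverse of the frame, which is `D = ±1` times its adjugate.
    obtain ⟨b, hb, hlt⟩ := ha
      (((D * (r * e₁.2 - s * e₀.2) : ℤ) : ℝ), ((D * (s * e₀.1 - r * e₁.1) : ℤ) : ℝ)) (by
        intro h0
        simp only [Prod.mk_eq_zero, Int.cast_eq_zero, mul_eq_zero, he0, false_or] at h0
        have h1 : r * D = 0 := by rw [← hD']; linear_combination e₀.1 * h0.1 + e₀.2 * h0.2
        have h2 : s * D = 0 := by rw [← hD']; linear_combination e₁.1 * h0.1 + e₁.2 * h0.2
        rcases hrs with h | h
        · exact h ((mul_eq_zero.1 h1).resolve_right he0)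
        · exact h ((mul_eq_zero.1 h2).resolve_right he0))
    refine ⟨latticeCoords p e₀ e₁ b, ?_, ?_⟩
    · rw [Set.mem_preimage, latticeFrame_coords he]
      exact hb
    · have hb' := latticeFrame_coords he (p := p) b
      set x := latticeCoords p e₀ e₁ b
      simp only [dot] at hlt
      rw [← hb'] at hlt
      norm_cast at hlt
      simp only [latticeFrame] at hlt
      have k0 : ∀ y : ℤ × ℤ, (p.1 + y.1 * e₀.1 + y.2 * e₁.1) * (D * (r * e₁.2 - s * e₀.2)) +
          (p.2 + y.1 * e₀.2 + y.2 * e₁.2) * (D * (s * e₀.1 - r * e₁.1)) =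
          p.1 * (D * (r * e₁.2 - s * e₀.2)) + p.2 * (D * (s * e₀.1 - r * e₁.1)) +
          (r * y.1 + s * y.2) := by
        intro y
        linear_combination D * (r * y.1 + s * y.2) * hD' + (r * y.1 + s * y.2) * he
      rw [k0, k0] at hlt
      linarith

namespace IsInterior

variable {S I : Set (ℤ × ℤ)}

theorem convex (h : IsInterior S I) {w u v z : ℤ × ℤ} {k α β γ : ℤ} (hu : u ∈ I) (hv : v ∈ I)
    (hz : z ∈ I) (hα : 0 ≤ α) (hβ : 0 ≤ β) (hγ : 0 ≤ γ) (hk0 : 0 < k) (hk : k = α + β + γ)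
    (h1 : k * w.1 = α * u.1 + β * v.1 + γ * z.1) (h2 : k * w.2 = α * u.2 + β * v.2 + γ * z.2) :
    w ∈ I := by
  rcases hα.lt_or_eq with h0 | h0
  · exact h.combination hu (h.subset hv) (h.subset hz) h0 hβ hγ hk h1 h2
  rcases hβ.lt_or_eq with h0' | h0'
  · exact h.combination (k := k) hv (h.subset hu) (h.subset hz) h0' hα hγ (by omega) (by linarith)
      (by linarith)
  · exact h.combination (k := k) hz (h.subset hu) (h.subset hv) (α := γ) (by omega) hα hβ
      (by omega) (by linarith) (by linarith)

/-- A lattice point at distance at least two beyond an edge of the interior polygon would produce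
another interior point beyond that edge. -/
theorem exists_beyond (h : IsInterior S I) {a b v : ℤ × ℤ} (ha : a ∈ I) (hb : b ∈ I)
    (hab : Int.gcd (b.1 - a.1) (b.2 - a.2) = 1) (hv : v ∈ S) {m : ℤ} (hm : 2 ≤ m)
    (hd : doubleArea a b v = -m) :
    ∃ w ∈ I, doubleArea a b w = -1 ∧ ∃ s, 0 ≤ s ∧ s ≤ m - 1 ∧
      m * w.1 = v.1 + s * b.1 + (m - 1 - s) * a.1 ∧
      m * w.2 = v.2 + s * b.2 + (m - 1 - s) * a.2 := by
  obtain ⟨r, t, hrt⟩ : ∃ r t, (b.1 - a.1) * r - (b.2 - a.2) * t = -1 := by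
    have := Int.gcd_eq_gcd_ab (b.1 - a.1) (b.2 - a.2)
    rw [hab] at this
    exact ⟨-Int.gcdA (b.1 - a.1) (b.2 - a.2), Int.gcdB (b.1 - a.1) (b.2 - a.2), by
      push_cast at this; linarith⟩
  have hd' : (b.1 - a.1) * (v.2 - a.2) - (b.2 - a.2) * (v.1 - a.1) = -m := hd
  obtain ⟨j, hj1, hj2⟩ : ∃ j, v.1 - a.1 = m * t + j * (b.1 - a.1) ∧
      v.2 - a.2 = m * r + j * (b.2 - a.2) := by
    refine ⟨(v.2 - a.2) * t - (v.1 - a.1) * r, ?_, ?_⟩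
    · linear_combination -t * hd' + (v.1 - a.1) * hrt
    · linear_combination -r * hd' + (v.2 - a.2) * hrt
  have hs0 := Int.emod_nonneg (-j) (show m ≠ 0 by omega)
  have hs1 := Int.emod_lt_of_pos (-j) (show 0 < m by omega)
  -- In the basis `b - a`, `(t, r)` the point `v` has height `m` and offset `j` from `a`. With `s`
  -- copies of `b` and `m - 1 - s` copies of `a` added, where `s ≡ -j`, the sum is divisible by `m`
  -- and the quotient has height 1.
  set s := (-j) % m with hs
  set i := -((-j) / m) with hi
  have hsi : s = m * i - j := by
    have := Int.emod_add_mul_ediv (-j) m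
    rw [hi, hs]
    linarith
  have e1 : m * (a.1 + t + i * (b.1 - a.1)) = v.1 + s * b.1 + (m - 1 - s) * a.1 := by
    rw [hsi]; linear_combination -hj1
  have e2 : m * (a.2 + r + i * (b.2 - a.2)) = v.2 + s * b.2 + (m - 1 - s) * a.2 := by
    rw [hsi]; linear_combination -hj2
  refine ⟨(a.1 + t + i * (b.1 - a.1), a.2 + r + i * (b.2 - a.2)), ?_, ?_, s, hs0, by omega, e1, e2⟩
  -- As `m ≥ 2`, one of the points `a`, `b` has positive weight, which makes the combination
  -- interior.
  · rcases hs0.lt_or_eq with h0 | h0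
    · exact h.combination (k := m) hb hv (h.subset ha) h0 zero_le_one
        (show 0 ≤ m - 1 - s by omega) (by ring) (by linear_combination e1) (by linear_combination e2)
    · exact h.combination (k := m) ha hv (h.subset hb) (show 0 < m - 1 - s by omega) zero_le_one
        hs0 (by ring) (by linear_combination e1) (by linear_combination e2)
  · simp only [doubleArea]
    linear_combination hrt

/-- At a vertex of the interior polygon, the two adjacent edges moved outwards by one lattice step
meet in a lattice point. -/
theorem dvd_of_corner (h : IsInterior S I) {u v w : ℤ × ℤ} (hu : u ∈ I) (hv : v ∈ I) (hw : w ∈ I)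
    (huv : Int.gcd (v.1 - u.1) (v.2 - u.2) = 1) (hvw : Int.gcd (w.1 - v.1) (w.2 - v.2) = 1)
    (h1 : ∀ t ∈ I, 0 ≤ doubleArea u v t) (h2 : ∀ t ∈ I, 0 ≤ doubleArea v w t) {m : ℤ}
    (hm : (v.1 - u.1) * (w.2 - v.2) - (v.2 - u.2) * (w.1 - v.1) = m) (hm1 : 1 < m) :
    m ∣ (v.1 - u.1) - (w.1 - v.1) ∧ m ∣ (v.2 - u.2) - (w.2 - v.2) := by
  have bound : ∀ {a b : ℤ × ℤ}, a ∈ I → b ∈ I → Int.gcd (b.1 - a.1) (b.2 - a.2) = 1 →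
      (∀ t ∈ I, 0 ≤ doubleArea a b t) → ∀ s ∈ S, -1 ≤ doubleArea a b s := by
    intro a b ha hb hab h1 s hs
    by_contra hcon
    obtain ⟨t, ht, hdt, -⟩ := h.exists_beyond ha hb hab hs (m := -doubleArea a b s) (by omega)
      (by omega)
    have := h1 t ht
    omega
  -- The interior point `v` has an exponent `s` beyond it with respect to the direction of `w - u`.
  -- By `bound` its two edge distances are `(-1, -1)`, `(-1, 0)` or `(0, -1)`. The last two
  -- contradict primitivity of an edge because `m > 1`; in the first case `s` is the lattice point
  -- where the shifted edges meet.
  obtain ⟨s, hs, hlt⟩ := h.exists_lt v hv (-(w.2 - u.2)) (w.1 - u.1) (by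
    by_contra hcon
    push Not at hcon
    have e1 : w.2 = u.2 := by linarith
    have e2 : w.1 = u.1 := by linarith
    rw [e1, e2] at hm
    have : m = 0 := by rw [← hm]; ring
    omega)
  have b1 := bound hu hv huv h1 s hs
  have b2 := bound hv hw hvw h2 s hs
  set α := doubleArea u v s with hα
  set β := doubleArea v w s with hβ
  have hα' : (v.1 - u.1) * (s.2 - v.2) - (v.2 - u.2) * (s.1 - v.1) = α := by
    rw [hα, doubleArea]; ring
  have hβ' : (w.1 - v.1) * (s.2 - v.2) - (w.2 - v.2) * (s.1 - v.1) = β := by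
    rw [hβ, doubleArea]
  have hsum : α + β < 0 := by rw [← hα', ← hβ']; linarith
  have c1 : m * (s.1 - v.1) = α * (w.1 - v.1) - β * (v.1 - u.1) := by
    rw [← hα', ← hβ', ← hm]; ring
  have c2 : m * (s.2 - v.2) = α * (w.2 - v.2) - β * (v.2 - u.2) := by
    rw [← hα', ← hβ', ← hm]; ring
  have key : ∀ {x y : ℤ}, Int.gcd x y = 1 → m ∣ x → m ∣ y → False := by
    intro x y hxy hx hy
    have := Int.dvd_coe_gcd hx hy
    rw [hxy] at this
    have := Int.le_of_dvd (by norm_num) this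
    push_cast at this
    omega
  have hcases : (α = -1 ∧ β = -1) ∨ (α = -1 ∧ β = 0) ∨ (α = 0 ∧ β = -1) := by omega
  rcases hcases with ⟨ha, hb⟩ | ⟨ha, hb⟩ | ⟨ha, hb⟩ <;> rw [ha, hb] at c1 c2
  · exact ⟨⟨s.1 - v.1, by linarith⟩, ⟨s.2 - v.2, by linarith⟩⟩
  · exact (key hvw ⟨-(s.1 - v.1), by linarith⟩ ⟨-(s.2 - v.2), by linarith⟩).elim
  · exact (key huv ⟨s.1 - v.1, by linarith⟩ ⟨s.2 - v.2, by linarith⟩).elim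

end IsInterior

/-! ### Fans spanned by interior lattice points -/

/-- A complete fan of unimodular cones that is spanned by the nonzero interior lattice points. -/
structure IsFan (S I : Set (ℤ × ℤ)) (n : ℕ) (u : ℕ → ℤ × ℤ) : Prop where
  isInterior : IsInterior S I
  eq_insert : I = insert 0 (Set.range u)
  zero : u 0 = (1, 0)
  one : u 1 = (0, 1)
  det_eq : ∀ k, latticeDet (u k) (u (k + 1)) = 1
  periodic : ∀ k, u (k + n) = u k
  neg_of_neg : ∀ k, 1 ≤ k → k + 1 < n → (u k).2 < 0 → (u (k + 1)).2 < 0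

namespace IsFan

variable {S I : Set (ℤ × ℤ)} {n : ℕ} {u : ℕ → ℤ × ℤ}

theorem zero_mem (h : IsFan S I n u) : (0 : ℤ × ℤ) ∈ I := h.eq_insert ▸ Or.inl rfl

theorem mem (h : IsFan S I n u) (k : ℕ) : u k ∈ I := h.eq_insert ▸ Or.inr ⟨k, rfl⟩

/-- A nonzero point of `I` spans a unimodular cone, so it is primitive. This yields the
contradictions in `abs_le`, `exists_ne_two` and `rejects_eq_false`. -/
theorem eq_zero_of_even (h : IsFan S I n u) {x y : ℤ} (hz : (2 * x, 2 * y) ∈ I) :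
    x = 0 ∧ y = 0 := by
  rw [h.eq_insert] at hz
  rcases hz with hz | ⟨k, hk⟩
  · simp only [Prod.mk_eq_zero] at hz
    omega
  · have := h.det_eq k
    rw [hk, latticeDet] at this
    have h2 : 2 * (x * (u (k + 1)).2 - y * (u (k + 1)).1) = 1 := by linear_combination this
    omega

/-- Two adjacent unimodular cones determine each other up to one integer. So the fan is encoded by
its first two rays and the coefficients `latticeDet (u k) (u (k + 2))`, which are what the search
enumerates. -/
theorem recurrence (h : IsFan S I n u) (k : ℕ) :
    (u k).1 + (u (k + 2)).1 = latticeDet (u k) (u (k + 2)) * (u (k + 1)).1 ∧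
    (u k).2 + (u (k + 2)).2 = latticeDet (u k) (u (k + 2)) * (u (k + 1)).2 := by
  have h1 := h.det_eq k
  have h2 := h.det_eq (k + 1)
  simp only [latticeDet] at *
  constructor
  · linear_combination -(u (k + 2)).1 * h1 - (u k).1 * h2
  · linear_combination -(u (k + 2)).2 * h1 - (u k).2 * h2

theorem ne_zero (h : IsFan S I n u) (k : ℕ) : (u k).1 ≠ 0 ∨ (u k).2 ≠ 0 := by
  by_contra hcon
  push Not at hcon
  have := h.det_eq k
  rw [latticeDet, hcon.1, hcon.2] at this
  omega

/-- If the coefficient `d` has absolute value at least 4, the weights `2/|d|` on `u k` and `u (k +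
2)` and `1 - 4/|d|` on the origin give `±2 • u (k + 1)`, an even nonzero point of `I`. -/
theorem abs_le (h : IsFan S I n u) (k : ℕ) :
    -3 ≤ latticeDet (u k) (u (k + 2)) ∧ latticeDet (u k) (u (k + 2)) ≤ 3 := by
  obtain ⟨h1, h2⟩ := h.recurrence k
  set d := latticeDet (u k) (u (k + 2))
  have key : ∀ ε : ℤ, ε ^ 2 = 1 → 4 ≤ ε * d → False := by
    intro ε hε hd
    have hm : (2 * (ε * (u (k + 1)).1), 2 * (ε * (u (k + 1)).2)) ∈ I :=
      h.isInterior.convex (k := ε * d) (α := ε * d - 4) (β := 2) (γ := 2) h.zero_mem (h.mem k)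
        (h.mem (k + 2)) (by omega) (by norm_num) (by norm_num) (by omega) (by ring)
        (by simp only [Prod.fst_zero]
            linear_combination -2 * h1 + 2 * d * (u (k + 1)).1 * hε)
        (by simp only [Prod.snd_zero]
            linear_combination -2 * h2 + 2 * d * (u (k + 1)).2 * hε)
    have h0 := h.eq_zero_of_even hm
    have hε0 : ε ≠ 0 := by rintro rfl; norm_num at hε
    simp only [mul_eq_zero, hε0, false_or] at h0
    rcases h.ne_zero (k + 1) with h3 | h3
    · exact h3 h0.1
    · exact h3 h0.2
  constructor
  · by_contra hcon
    exact key (-1) (by norm_num) (by omega)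
  · by_contra hcon
    exact key 1 (by norm_num) (by omega)

/-- There are no nine consecutive collinear points. -/
theorem exists_ne_two (h : IsFan S I n u) (s : ℕ) :
    ∃ i, s ≤ i ∧ i < s + 7 ∧ latticeDet (u i) (u (i + 2)) ≠ 2 := by
  by_contra hcon
  push Not at hcon
  set x := u s with hx
  set δ : ℤ × ℤ := ((u (s + 1)).1 - (u s).1, (u (s + 1)).2 - (u s).2) with hδ
  have hlin : ∀ i, i ≤ 7 → ((u (s + i)).1 = x.1 + i * δ.1 ∧ (u (s + i)).2 = x.2 + i * δ.2) ∧
      ((u (s + i + 1)).1 = x.1 + (i + 1) * δ.1 ∧ (u (s + i + 1)).2 = x.2 + (i + 1) * δ.2) := by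
    intro i
    induction i with
    | zero => intro _; simp [hδ, hx]
    | succ i ih =>
      intro hi
      obtain ⟨⟨a1, a2⟩, b1, b2⟩ := ih (by omega)
      obtain ⟨r1, r2⟩ := h.recurrence (s + i)
      rw [hcon (s + i) (by omega) (by omega)] at r1 r2
      rw [show s + (i + 1) = s + i + 1 by omega, show s + i + 1 + 1 = s + i + 2 by omega]
      push_cast
      refine ⟨⟨b1, b2⟩, ?_, ?_⟩
      · linear_combination r1 - a1 + 2 * b1
      · linear_combination r2 - a2 + 2 * b2
  have hdet : x.1 * δ.2 - x.2 * δ.1 = 1 := by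
    have := h.det_eq s
    rw [latticeDet] at this
    simp only [hδ, hx]
    linarith
  have hδ0 : δ.2 ≠ 0 ∨ -δ.1 ≠ 0 := by
    by_contra hc
    push Not at hc
    rw [hc.1, neg_eq_zero.1 hc.2] at hdet
    omega
  -- The points `u s`, …, `u (s + 8)` lie on a line in direction `δ` at lattice distance 1 from the
  -- origin. The origin is interior, so some exponent `v` lies at distance `k ≥ 1` on the other
  -- side.
  obtain ⟨v, hv, hlt⟩ := h.isInterior.exists_lt 0 h.zero_mem δ.2 (-δ.1) hδ0
  simp only [Prod.fst_zero, Prod.snd_zero, mul_zero, add_zero] at hlt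
  set k := -(δ.2 * v.1 + -δ.1 * v.2) with hk
  set j := x.1 * v.2 - x.2 * v.1 with hj
  have e1 : v.1 = -k * x.1 + j * δ.1 := by
    rw [hk, hj]; linear_combination -v.1 * hdet
  have e2 : v.2 = -k * x.2 + j * δ.2 := by
    rw [hk, hj]; linear_combination -v.2 * hdet
  have hfin : ∀ c : ℤ, (2 * (c * δ.1), 2 * (c * δ.2)) ∈ I → c = 0 := by
    intro c hc
    have h0 := h.eq_zero_of_even hc
    simp only [mul_eq_zero] at h0
    by_contra hc0
    simp only [hc0, false_or] at h0
    rcases hδ0 with h3 | h3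
    · exact h3 h0.2
    · exact h3 (by rw [h0.1, neg_zero])
  obtain ⟨-, l1, l2⟩ := hlin 7 le_rfl
  push_cast at l1 l2
  -- The segment from `v` to one of the two ends of the row meets the line `ℝδ` at or beyond `2δ`,
  -- respectively `-2δ`. So an even point becomes interior.
  by_cases hbig : 2 * (k + 1) ≤ k * 8 + j
  · have hm : (2 * (1 * δ.1), 2 * (1 * δ.2)) ∈ I := by
      refine h.isInterior.combination (k := k * 8 + j) (α := 2 * k) (β := 2)
        (γ := k * 8 + j - 2 * (k + 1)) (h.mem (s + 7 + 1)) hv (h.isInterior.subset h.zero_mem)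
        (by omega) (by norm_num) (by omega) (by ring) ?_ ?_
      · rw [l1, e1]; simp only [Prod.fst_zero]; ring
      · rw [l2, e2]; simp only [Prod.snd_zero]; ring
    exact absurd (hfin 1 hm) one_ne_zero
  · have hm : (2 * (-1 * δ.1), 2 * (-1 * δ.2)) ∈ I := by
      refine h.isInterior.combination (k := -j) (α := 2 * k) (β := 2)
        (γ := -j - 2 * (k + 1)) (h.mem s) hv (h.isInterior.subset h.zero_mem)
        (by omega) (by norm_num) (by omega) (by ring) ?_ ?_
      · rw [e1]; simp only [Prod.fst_zero]; ring
      · rw [e2]; simp only [Prod.snd_zero]; ring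
    exact absurd (hfin (-1) hm) (by norm_num)

/-- Up to the factor `latticeDet a b`, the determinants are the barycentric coordinates of `z` in
the triangle with corners `a`, `b` and the origin. -/
theorem mem_of_triangle (h : IsFan S I n u) {a b z : ℤ × ℤ} (ha : a ∈ I) (hb : b ∈ I)
    (hx : 0 ≤ latticeDet z b) (hy : 0 ≤ latticeDet a z) (hD : 0 < latticeDet a b)
    (hxy : latticeDet z b + latticeDet a z ≤ latticeDet a b) : z ∈ I := by
  refine h.isInterior.convex (k := latticeDet a b)
    (γ := latticeDet a b - latticeDet z b - latticeDet a z) ha hb h.zero_mem hx hy (by omega) hD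
    (by ring) ?_ ?_
  · simp only [latticeDet, Prod.fst_zero]; ring
  · simp only [latticeDet, Prod.snd_zero]; ring

end IsFan

/-! ### Exhaustive search for long fans -/

namespace FanSearch

/-- Passes on an integer in evaluated form. -/
def force (x : ℤ) (k : ℤ → Bool) : Bool :=
  match x with
  | .ofNat 0 => k (.ofNat 0)
  | .ofNat (n + 1) => k (.ofNat (n + 1))
  | .negSucc 0 => k (.negSucc 0)
  | .negSucc (n + 1) => k (.negSucc (n + 1))

theorem force_eq (x : ℤ) (k : ℤ → Bool) : force x k = k x := by
  rcases x with (_ | n) | (_ | n) <;> rfl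

/-- Both orientations are admitted, since an earlier ray may be on either side of the new one. -/
def inTriangle (x y D : ℤ) : Bool :=
  (decide (0 ≤ x) && decide (0 ≤ y) && decide (0 < D) && decide (x + y ≤ D)) ||
    (decide (x ≤ 0) && decide (y ≤ 0) && decide (D < 0) && decide (D ≤ x + y))

/-- Some multiples of two, which cannot be interior lattice points. -/
def evenPoints : List (ℤ × ℤ) := [(-2, 0), (0, -2), (0, 2), (2, -4), (2, -2)]

/-- The point `q` cannot follow `p` in a fan that starts with the points in `L`. -/
def rejects (p q : ℤ × ℤ) (L : List (ℤ × ℤ)) : Bool :=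
  (decide (p.2 < 0) && decide (0 ≤ q.2)) ||
    evenPoints.any fun z => force (latticeDet z q) fun x =>
      L.any fun a => force (latticeDet a z) fun y => inTriangle x y (latticeDet a q)

def leftOf (u v : ℤ × ℤ) (L : List (ℤ × ℤ)) : Bool :=
  L.all fun t => decide (0 ≤ doubleArea u v t)

/-- The convex hull of the points has a vertex with edges that do not meet in a lattice point
when they are moved outwards. -/
def badCorner (L : List (ℤ × ℤ)) : Bool :=
  L.any fun v => (L.filter fun u => decide (u ≠ v) && leftOf u v L).any fun u =>
    (L.filter fun w => decide (w ≠ v) && leftOf v w L).any fun w =>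
    let m := (v.1 - u.1) * (w.2 - v.2) - (v.2 - u.2) * (w.1 - v.1)
    decide (1 < m) && decide (Int.gcd (v.1 - u.1) (v.2 - u.2) = 1) &&
      decide (Int.gcd (w.1 - v.1) (w.2 - v.2) = 1) &&
      (decide (¬ m ∣ (v.1 - u.1) - (w.1 - v.1)) || decide (¬ m ∣ (v.2 - u.2) - (w.2 - v.2)))

/-- No fan with at least eleven rays starts with the points `L = q :: p :: …`, if its first two
coefficients are `D` and `E`, and this is the lexicographically largest pair of consecutive
coefficients. -/
def search (D E : ℤ) : ℕ → ℕ → ℕ → ℤ → ℤ × ℤ → ℤ × ℤ → List (ℤ × ℤ) → Bool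
  | 0, _, _, _, _, _, _ => false
  | fuel + 1, len, run, d', p, q, L =>
    (Nat.blt len 11 || !decide (latticeDet q (1, 0) = 1) || badCorner ((0, 0) :: L)) &&
    [(-3 : ℤ), -2, -1, 0, 1, 2, 3].all fun d =>
      force (d * q.1 - p.1) fun r₁ => force (d * q.2 - p.2) fun r₂ =>
      -- Coefficients lie between -3 and 3, so the factor 7 turns the lexicographic order of pairs
      -- into an order of integers.
      decide (D < d) || decide (7 * D + E < 7 * d' + d) ||
        Nat.beq (if d = 2 then run + 1 else 0) 7 || rejects q (r₁, r₂) L ||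
        search D E fuel (len + 1) (if d = 2 then run + 1 else 0) d q (r₁, r₂) ((r₁, r₂) :: L)

/-- The start `(1, 0), (0, 1), (-1, D), (-E, E * D - 1)` is given by the recurrence. Running out of
fuel counts as failure, so the fuel 20 matters only for the evaluation to succeed. -/
def searchAll : Bool :=
  [(-3 : ℤ), -2, -1, 0, 1, 2, 3].all fun D => [(-3 : ℤ), -2, -1, 0, 1, 2, 3].all fun E =>
    decide (D < E) || rejects (0, 1) (-1, D) [(0, 1), (1, 0)] ||
      rejects (-1, D) (-E, E * D - 1) [(-1, D), (0, 1), (1, 0)] ||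
      search D E 20 4 0 E (-1, D) (-E, E * D - 1)
        [(-E, E * D - 1), (-1, D), (0, 1), (1, 0)]

theorem searchAll_eq_true : searchAll = true := by decide +kernel

/-- The first `k` points of a sequence, in reverse order. -/
def initial (u : ℕ → ℤ × ℤ) : ℕ → List (ℤ × ℤ)
  | 0 => []
  | k + 1 => u k :: initial u k

theorem mem_initial {u : ℕ → ℤ × ℤ} {k : ℕ} {a : ℤ × ℤ} :
    a ∈ initial u k ↔ ∃ i < k, a = u i := by
  induction k with
  | zero => simp [initial]
  | succ k ih =>
    rw [initial, List.mem_cons, ih]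
    constructor
    · rintro (rfl | ⟨i, hi, rfl⟩)
      · exact ⟨k, by omega, rfl⟩
      · exact ⟨i, by omega, rfl⟩
    · rintro ⟨i, hi, rfl⟩
      by_cases h : i = k
      · exact Or.inl (h ▸ rfl)
      · exact Or.inr ⟨i, by omega, rfl⟩

variable {S I : Set (ℤ × ℤ)} {n : ℕ} {u : ℕ → ℤ × ℤ}

/-- A fan winds only once around the origin, and a triangle with corners in `I` contains no nonzero
even point. -/
theorem rejects_eq_false (h : IsFan S I n u) {k : ℕ} (hk : 1 ≤ k) (hkn : k + 1 < n) :
    rejects (u k) (u (k + 1)) (initial u (k + 1)) = false := by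
  rw [rejects, Bool.or_eq_false_iff]
  constructor
  · have := h.neg_of_neg k hk hkn
    simp only [Bool.and_eq_false_iff, decide_eq_false_iff_not, not_lt, not_le]
    by_cases h1 : (u k).2 < 0
    · exact Or.inr (this h1)
    · exact Or.inl (not_lt.1 h1)
  · rw [List.any_eq_false]
    intro z hz
    rw [force_eq, Bool.not_eq_true, List.any_eq_false]
    intro a ha
    rw [force_eq]
    obtain ⟨i, -, rfl⟩ := mem_initial.1 ha
    intro htri
    have hzI : z ∈ I := by
      simp only [inTriangle, Bool.or_eq_true, Bool.and_eq_true, decide_eq_true_eq] at htri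
      rcases htri with ⟨⟨⟨h1, h2⟩, h3⟩, h4⟩ | ⟨⟨⟨h1, h2⟩, h3⟩, h4⟩
      · exact h.mem_of_triangle (h.mem i) (h.mem (k + 1)) h1 h2 h3 h4
      · have hs : ∀ x y : ℤ × ℤ, latticeDet x y = -latticeDet y x := by
          intro x y; simp only [latticeDet]; ring
        rw [hs (u i) z] at h2 h4
        rw [hs z (u (k + 1))] at h1 h4
        rw [hs (u i)] at h3 h4
        exact h.mem_of_triangle (h.mem (k + 1)) (h.mem i) (by omega) (by omega) (by omega)
          (by omega)
    have hz2 : ∃ x y : ℤ, z = (2 * x, 2 * y) ∧ (x ≠ 0 ∨ y ≠ 0) := by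
      simp only [evenPoints, List.mem_cons, List.not_mem_nil, or_false] at hz
      rcases hz with rfl | rfl | rfl | rfl | rfl
      exacts [⟨-1, 0, rfl, by decide⟩, ⟨0, -1, rfl, by decide⟩, ⟨0, 1, rfl, by decide⟩,
        ⟨1, -2, rfl, by decide⟩, ⟨1, -1, rfl, by decide⟩]
    obtain ⟨x, y, rfl, hxy⟩ := hz2
    have := h.eq_zero_of_even hzI
    tauto

/-- By periodicity the list is all of `I`, so its corners are subject to `dvd_of_corner`. -/
theorem badCorner_eq_false (h : IsFan S I n u) (hn : 0 < n) :
    badCorner ((0, 0) :: initial u n) = false := by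
  have hI : ∀ a, a ∈ (0, 0) :: initial u n ↔ a ∈ I := by
    intro a
    rw [h.eq_insert, List.mem_cons, mem_initial]
    have hper : ∀ k i, u (i + n * k) = u i := by
      intro k
      induction k with
      | zero => intro i; rfl
      | succ k ih =>
        intro i
        rw [Nat.mul_succ, ← add_assoc, h.periodic, ih]
    constructor
    · rintro (rfl | ⟨i, -, rfl⟩)
      · exact Or.inl rfl
      · exact Or.inr ⟨i, rfl⟩
    · rintro (rfl | ⟨i, rfl⟩)
      · exact Or.inl rfl
      · refine Or.inr ⟨i % n, Nat.mod_lt _ hn, ?_⟩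
        conv_lhs => rw [← Nat.mod_add_div i n]
        exact hper _ _
  have hleft : ∀ u v, leftOf u v ((0, 0) :: initial (‹ℕ → ℤ × ℤ›) n) = true →
      ∀ t ∈ I, 0 ≤ doubleArea u v t := by
    intro u v hl t ht
    rw [leftOf, List.all_eq_true] at hl
    simpa using hl t ((hI t).2 ht)
  rw [badCorner, List.any_eq_false]
  intro b hb
  rw [Bool.not_eq_true, List.any_eq_false]
  intro a ha
  rw [Bool.not_eq_true, List.any_eq_false]
  intro c hc
  rw [List.mem_filter, Bool.and_eq_true] at ha hc
  intro hcon
  simp only [Bool.and_eq_true, Bool.or_eq_true, decide_eq_true_eq] at hcon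
  obtain ⟨⟨⟨h1, h2⟩, h3⟩, h4⟩ := hcon
  have := h.isInterior.dvd_of_corner ((hI a).1 ha.1) ((hI b).1 hb) ((hI c).1 hc.1) h2 h3
    (hleft _ _ ha.2.2) (hleft _ _ hc.2.2) rfl h1
  tauto

/-- The branch of the actual fan is never pruned, and when its list of rays is complete it closes up
without a bad corner. So the search answers `false` there, whatever the fuel. The counter `run` need
only be a lower bound for the current run of twos. -/
theorem search_sound (h : IsFan S I n u) (hn : 11 ≤ n)
    (hmax : ∀ k, 7 * latticeDet (u k) (u (k + 2)) + latticeDet (u (k + 1)) (u (k + 3)) ≤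
      7 * latticeDet (u 0) (u 2) + latticeDet (u 1) (u 3)) (fuel : ℕ) :
    ∀ (j run : ℕ), 1 ≤ j → j + 3 ≤ n →
    (∃ s, s + run = j + 1 ∧ ∀ i, s ≤ i → i ≤ j → latticeDet (u i) (u (i + 2)) = 2) →
    search (latticeDet (u 0) (u 2)) (latticeDet (u 1) (u 3)) fuel (j + 3) run
      (latticeDet (u j) (u (j + 2))) (u (j + 1)) (u (j + 2)) (initial u (j + 3)) = false := by
  induction fuel with
  | zero => intros; rfl
  | succ fuel ih =>
    intro j run hj hjn hrun
    by_contra hcon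
    rw [Bool.not_eq_false, search, Bool.and_eq_true] at hcon
    obtain ⟨hclose, hall⟩ := hcon
    rcases hjn.eq_or_lt with hjn | hjn
    · rw [hjn, Bool.or_eq_true, Bool.or_eq_true, badCorner_eq_false h (by omega)] at hclose
      rcases hclose with (hc | hc) | hc
      · rw [Nat.blt_eq] at hc
        omega
      · have h1 := h.det_eq (j + 2)
        rw [show j + 2 + 1 = 0 + n by omega, h.periodic, h.zero] at h1
        rw [h1] at hc
        simp at hc
      · simp at hc
    · set d := latticeDet (u (j + 1)) (u (j + 3)) with hd
      obtain ⟨b1, b2⟩ := h.abs_le (j + 1)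
      rw [show j + 1 + 2 = j + 3 by omega, ← hd] at b1 b2
      have hdm : d ∈ [(-3 : ℤ), -2, -1, 0, 1, 2, 3] := by
        simp only [List.mem_cons, List.not_mem_nil, or_false]
        omega
      have hc := List.all_eq_true.1 hall d hdm
      obtain ⟨r1, r2⟩ := h.recurrence (j + 1)
      rw [show j + 1 + 2 = j + 3 by omega, show j + 1 + 1 = j + 2 by omega, ← hd] at r1 r2
      have hr : (d * (u (j + 2)).1 - (u (j + 1)).1, d * (u (j + 2)).2 - (u (j + 1)).2) =
          u (j + 3) := by
        ext
        · simp only; linarith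
        · simp only; linarith
      rw [force_eq, force_eq, hr] at hc
      simp only [Bool.or_eq_true, decide_eq_true_eq] at hc
      obtain ⟨s, hs, hs2⟩ := hrun
      have hrun' : ∃ s, s + (if d = 2 then run + 1 else 0) = j + 1 + 1 ∧
          ∀ i, s ≤ i → i ≤ j + 1 → latticeDet (u i) (u (i + 2)) = 2 := by
        by_cases hd2 : d = 2
        · refine ⟨s, by rw [if_pos hd2]; omega, fun i hi hi' => ?_⟩
          rcases hi'.eq_or_lt with rfl | hi'
          · rw [← hd2, hd]
          · exact hs2 i hi (by omega)
        · exact ⟨j + 2, by rw [if_neg hd2], fun i hi hi' => by omega⟩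
      have hmaxj := hmax j
      have hmaxj' := hmax (j + 1)
      rw [show j + 1 + 2 = j + 3 by omega, show j + 1 + 3 = j + 4 by omega,
        show j + 1 + 1 = j + 2 by omega, ← hd] at hmaxj'
      rw [← hd] at hmaxj
      rcases hc with (((hc | hc) | hc) | hc) | hc
      -- The second members of two pairs differ by at most 6, which is less than the weight 7 of the
      -- first member.
      · have b3 := (h.abs_le (j + 2)).1
        rw [show j + 2 + 2 = j + 4 by omega] at b3
        have b4 := (h.abs_le 1).2
        rw [show 1 + 2 = 3 by omega] at b4
        omega
      · omega
      · obtain ⟨s', hs', hs2'⟩ := hrun'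
        rw [Nat.eq_of_beq_eq_true hc] at hs'
        obtain ⟨i, hi1, hi2, hi3⟩ := h.exists_ne_two s'
        exact hi3 (hs2' i hi1 (by omega))
      · have := rejects_eq_false h (k := j + 2) (by omega) (by omega)
        rw [this] at hc
        simp at hc
      · have := ih (j + 1) _ (by omega) (by omega) hrun'
        rw [show j + 1 + 2 = j + 3 by omega, show j + 1 + 1 = j + 2 by omega,
          show j + 1 + 3 = j + 3 + 1 by omega, ← hd] at this
        rw [show initial u (j + 3 + 1) = u (j + 3) :: initial u (j + 3) from rfl] at this
        rw [this] at hc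
        simp at hc

end FanSearch

/-- A fan spanned by interior lattice points has at most ten rays. -/
theorem IsFan.lt_eleven {S I : Set (ℤ × ℤ)} {n : ℕ} {u : ℕ → ℤ × ℤ} (h : IsFan S I n u)
    (hmax : ∀ k, 7 * latticeDet (u k) (u (k + 2)) + latticeDet (u (k + 1)) (u (k + 3)) ≤
      7 * latticeDet (u 0) (u 2) + latticeDet (u 1) (u 3)) : n < 11 := by
  by_contra hn
  push Not at hn
  have hall := FanSearch.searchAll_eq_true
  rw [FanSearch.searchAll, List.all_eq_true] at hall
  have hlist : ∀ d : ℤ, -3 ≤ d ∧ d ≤ 3 → d ∈ [(-3 : ℤ), -2, -1, 0, 1, 2, 3] := by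
    intro d hd
    simp only [List.mem_cons, List.not_mem_nil, or_false]
    omega
  have hc := List.all_eq_true.1 (hall _ (hlist _ (h.abs_le 0))) _ (hlist _ (h.abs_le 1))
  have b1 := h.abs_le 1
  have b2 := h.abs_le 2
  have hm := hmax 1
  have hr0 := h.recurrence 0
  have hr1 := h.recurrence 1
  simp only [show 0 + 2 = 2 from rfl, show 1 + 2 = 3 from rfl, show 0 + 1 = 1 from rfl,
    show 1 + 3 = 4 from rfl] at hc b1 b2 hm hr0 hr1
  have hs := FanSearch.search_sound h hn hmax 20 1 0 le_rfl (by omega)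
    ⟨2, rfl, fun i h1 h2 => by omega⟩
  simp only [show 1 + 2 = 3 from rfl, show 1 + 1 = 2 from rfl, show 1 + 3 = 4 from rfl] at hs
  set D := latticeDet (u 0) (u 2) with hD
  set E := latticeDet (u 1) (u 3) with hE
  have h2 : u 2 = (-1, D) := by
    rw [h.zero, h.one] at hr0
    simp only at hr0
    ext <;> simp only <;> linarith
  have h3 : u 3 = (-E, E * D - 1) := by
    rw [h.one, h2] at hr1
    simp only at hr1
    ext <;> simp only <;> linarith
  have j1 := FanSearch.rejects_eq_false h (k := 1) le_rfl (by omega)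
  have j2 := FanSearch.rejects_eq_false h (k := 2) (by omega) (by omega)
  simp only [show 1 + 1 = 2 from rfl, show 2 + 1 = 3 from rfl, FanSearch.initial, h.zero, h.one, h2,
    h3] at j1 j2 hs
  rw [j1, j2, hs] at hc
  simp only [Bool.or_false, decide_eq_true_eq] at hc
  omega

/-! ### From the standard embedding to a fan -/

namespace TropicalPolynomial

variable {f : TropicalPolynomial}

theorem IsSmooth.abs_doubleArea (hf : f.IsSmooth) {x : ℝ × ℝ} (hx : x ∈ f.curveVertices)
    {a b c : ℤ × ℤ} (ha : a ∈ f.cell x) (hb : b ∈ f.cell x) (hc : c ∈ f.cell x) (hab : a ≠ b)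
    (hac : a ≠ c) (hbc : b ≠ c) : f.cell x = {a, b, c} ∧ |doubleArea a b c| = 1 := by
  obtain ⟨d, hd, h1⟩ := hf.exists_third hx ha hb hab
  rw [hd] at hc
  rcases hc with rfl | rfl | rfl
  · exact absurd rfl hac
  · exact absurd rfl hbc
  · exact ⟨hd, h1⟩

/-- An exponent whose region borders the region of `p` does not lie in the cone of a cell at `p`. -/
theorem notMem_cone {x y : ℝ × ℝ} {p a b c : ℤ × ℤ}
    (hp : p ∈ f.cell x) (ha : a ∈ f.cell x) (hb : b ∈ f.cell x) (hd : doubleArea p a b = 1)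
    (hpy : p ∈ f.cell y) (hcy : c ∈ f.cell y) (hcx : c ∉ f.cell x) :
    ¬ (0 ≤ doubleArea p c b ∧ 0 ≤ doubleArea p a c) := by
  rintro ⟨hs, ht⟩
  set s : ℝ := (doubleArea p c b : ℝ) with hs'
  set t : ℝ := (doubleArea p a c : ℝ) with ht'
  have hs0 : 0 ≤ s := by rw [hs']; exact_mod_cast hs
  have ht0 : 0 ≤ t := by rw [ht']; exact_mod_cast ht
  have hdR : ((a.1 : ℝ) - p.1) * (b.2 - p.2) - (a.2 - p.2) * (b.1 - p.1) = 1 := by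
    have := congrArg (Int.cast : ℤ → ℝ) hd
    simpa [doubleArea] using this
  have hsR : s = ((c.1 : ℝ) - p.1) * (b.2 - p.2) - (c.2 - p.2) * (b.1 - p.1) := by
    rw [hs', doubleArea]; push_cast; ring
  have htR : t = ((a.1 : ℝ) - p.1) * (c.2 - p.2) - (a.2 - p.2) * (c.1 - p.1) := by
    rw [ht', doubleArea]; push_cast; ring
  have hc1 : (c.1 : ℝ) - p.1 = s * (a.1 - p.1) + t * (b.1 - p.1) := by
    rw [hsR, htR]; linear_combination -((c.1 : ℝ) - p.1) * hdR
  have hc2 : (c.2 : ℝ) - p.2 = s * (a.2 - p.2) + t * (b.2 - p.2) := by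
    rw [hsR, htR]; linear_combination -((c.2 : ℝ) - p.2) * hdR
  -- As `c - p = s (a - p) + t (b - p)`, the left side does not depend on the point. It is positive
  -- at `x`, where `p`, `a`, `b` tie below `c`, and at most zero at `y`, where `p` and `c` tie and
  -- are minimal.
  have key : ∀ z, f.monomialValue c z - f.monomialValue p z -
      s * (f.monomialValue a z - f.monomialValue p z) -
      t * (f.monomialValue b z - f.monomialValue p z) =
      f.coeff c - f.coeff p - s * (f.coeff a - f.coeff p) - t * (f.coeff b - f.coeff p) := by
    intro z
    simp only [monomialValue]
    linear_combination z.1 * hc1 + z.2 * hc2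
  have kx := key x
  have ky := key y
  rw [← value_eq_of_mem_cell hp ha, ← value_eq_of_mem_cell hp hb] at kx
  have hlt := lt_value_of_notMem_cell hp hcy.1 hcx
  rw [← value_eq_of_mem_cell hpy hcy] at ky
  have h1 := mul_nonneg hs0 (sub_nonneg.2 (hpy.2 a ha.1))
  have h2 := mul_nonneg ht0 (sub_nonneg.2 (hpy.2 b hb.1))
  linarith

/-- The interior exponents form a star around `p`. -/
structure IsStar {m : ℕ} (f : TropicalPolynomial) (p : ℤ × ℤ) (w : Fin (m + 4) → ℤ × ℤ) : Prop where
  eq_insert : f.interiorExponents = insert p (Set.range w)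
  doubleArea_eq : ∀ i, doubleArea p (w i) (w (i + 1)) = 1
  notMem_cone : ∀ i k, k ≠ i → k ≠ i + 1 →
    ¬ (0 ≤ doubleArea p (w k) (w (i + 1)) ∧ 0 ≤ doubleArea p (w i) (w k))

open Fin.CommRing in
-- With `p` as origin and two consecutive rays as basis, the star unrolls to a periodic fan. The
-- first ray is chosen so that the pair of leading coefficients is lexicographically largest.
theorem IsStar.lt_eleven {m : ℕ} {p : ℤ × ℤ} {w : Fin (m + 4) → ℤ × ℤ} (h : f.IsStar p w)
    (hf : f.IsSmooth) : m + 4 < 11 := by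
  obtain ⟨i₀, hi₀⟩ := Finite.exists_max fun i : Fin (m + 4) =>
    7 * doubleArea p (w i) (w (i + 1 + 1)) + doubleArea p (w (i + 1)) (w (i + 1 + 1 + 1))
  set e₀ : ℤ × ℤ := ((w i₀).1 - p.1, (w i₀).2 - p.2) with he₀
  set e₁ : ℤ × ℤ := ((w (i₀ + 1)).1 - p.1, (w (i₀ + 1)).2 - p.2) with he₁
  have hdet : latticeDet e₀ e₁ = 1 := h.doubleArea_eq i₀
  have hdet2 : latticeDet e₀ e₁ ^ 2 = 1 := by rw [hdet, one_pow]
  set u : ℕ → ℤ × ℤ := fun k => latticeCoords p e₀ e₁ (w (i₀ + (k : Fin (m + 4)))) with hu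
  have hcast : ∀ k : ℕ, i₀ + ((k + 1 : ℕ) : Fin (m + 4)) = i₀ + (k : Fin (m + 4)) + 1 := by
    intro k
    rw [Nat.cast_succ, add_assoc]
  have hudet : ∀ k l, latticeDet (u k) (u l) =
      doubleArea p (w (i₀ + (k : Fin (m + 4)))) (w (i₀ + (l : Fin (m + 4)))) := by
    intro k l
    simp only [hu]
    rw [latticeDet_coords hdet2, hdet, one_mul]
  have hu0 : u 0 = (1, 0) := by
    have h1 : latticeFrame p e₀ e₁ (1, 0) = w i₀ := by
      ext <;> simp [latticeFrame, he₀]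
    simp only [hu, Nat.cast_zero, add_zero]
    rw [← h1, latticeCoords_frame hdet2]
  have hu1 : u 1 = (0, 1) := by
    have h1 : latticeFrame p e₀ e₁ (0, 1) = w (i₀ + 1) := by
      ext <;> simp [latticeFrame, he₁]
    simp only [hu, Nat.cast_one]
    rw [← h1, latticeCoords_frame hdet2]
  have hfan : IsFan (latticeFrame p e₀ e₁ ⁻¹' f.support)
      (latticeFrame p e₀ e₁ ⁻¹' f.interiorExponents) (m + 4) u := by
    refine ⟨hf.isInterior p hdet2, ?_, hu0, hu1, ?_, ?_, ?_⟩
    · ext x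
      rw [Set.mem_preimage, h.eq_insert, Set.mem_insert_iff, Set.mem_insert_iff, Set.mem_range,
        Set.mem_range]
      have hinj : ∀ y, latticeFrame p e₀ e₁ x = y ↔ x = latticeCoords p e₀ e₁ y := by
        intro y
        constructor
        · rintro rfl
          rw [latticeCoords_frame hdet2]
        · rintro rfl
          rw [latticeFrame_coords hdet2]
      refine or_congr ?_ ?_
      · rw [hinj]
        simp [latticeCoords, Prod.mk_zero_zero]
      · simp only [eq_comm (b := latticeFrame p e₀ e₁ x), hinj]
        constructor
        · rintro ⟨i, rfl⟩
          refine ⟨(i - i₀).val, ?_⟩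
          simp only [hu]
          rw [Fin.cast_val_eq_self, add_sub_cancel]
        · rintro ⟨k, rfl⟩
          exact ⟨_, rfl⟩
    · intro k
      rw [hudet, hcast]
      exact h.doubleArea_eq _
    · intro k
      simp only [hu]
      rw [Nat.cast_add, Fin.natCast_self, add_zero]
    -- Otherwise the ray `(1, 0)` would lie in the cone of `u k` and `u (k + 1)`.
    · intro k hk hkn hneg
      have hlt : ∀ l : ℕ, l < m + 4 → 0 < l → i₀ ≠ i₀ + (l : Fin (m + 4)) := by
        intro l hl hl0 he
        have := congrArg Fin.val (add_eq_left.1 he.symm)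
        rw [Fin.val_natCast, Nat.mod_eq_of_lt hl] at this
        simp at this
        omega
      have hcone := h.notMem_cone (i₀ + (k : Fin (m + 4))) i₀ (hlt k (by omega) hk)
        (by rw [← hcast]; exact hlt (k + 1) hkn (by omega))
      have e1 := hudet 0 (k + 1)
      have e2 := hudet k 0
      rw [hcast, Nat.cast_zero, add_zero, hu0] at e1
      rw [Nat.cast_zero, add_zero, hu0] at e2
      rw [← e1, ← e2] at hcone
      simp only [latticeDet, one_mul, zero_mul, sub_zero, mul_zero, mul_one, zero_sub] at hcone
      omega
  refine hfan.lt_eleven fun k => ?_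
  simp only [hudet]
  have := hi₀ (i₀ + (k : Fin (m + 4)))
  simp only [hcast, show (2 : ℕ) = 1 + 1 from rfl, show (3 : ℕ) = 1 + 1 + 1 from rfl,
    ← add_assoc k, Nat.cast_one, Nat.cast_zero, add_zero, show ((1 + 1 : ℕ) : Fin (m + 4)) =
    1 + 1 by rw [Nat.cast_add, Nat.cast_one], show ((1 + 1 + 1 : ℕ) : Fin (m + 4)) = 1 + 1 + 1 by
    rw [Nat.cast_add, Nat.cast_add, Nat.cast_one], ← add_assoc i₀]
  exact this

namespace IsPrismLabelling

variable {m : ℕ} {σ : Fin (m + 4) × Fin 2 → ℝ × ℝ} {j₀ : Fin (m + 4) ⊕ Fin 2}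
  {α : Fin (m + 4) ⊕ Fin 2 → ℤ × ℤ}

theorem label_injective (h : f.IsPrismLabelling σ j₀ α) {j k : Fin (m + 4) ⊕ Fin 2} (hj : j ≠ j₀)
    (hk : k ≠ j₀) (he : α j = α k) : j = k := by
  apply prismCycle_injective
  ext v
  rw [← h.mem_cell_iff j hj, he, h.mem_cell_iff k hk]

theorem mem_cells (h : f.IsPrismLabelling σ j₀ α) (i : Fin (m + 4)) (j : Fin 2) :
    (.inl i ≠ j₀ → α (.inl i) ∈ f.cell (σ (i + 1, j))) ∧
    (.inl (i + 1) ≠ j₀ → α (.inl (i + 1)) ∈ f.cell (σ (i + 1, j))) ∧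
    (.inr j ≠ j₀ → α (.inr j) ∈ f.cell (σ (i + 1, j))) :=
  ⟨fun hj => (h.mem_cell_iff _ hj _).2 (Or.inr rfl), fun hj => (h.mem_cell_iff _ hj _).2 (Or.inl rfl),
    fun hj => (h.mem_cell_iff _ hj _).2 rfl⟩

theorem cell_eq (h : f.IsPrismLabelling σ j₀ α) (hf : f.IsSmooth) {i : Fin (m + 4)} {j : Fin 2}
    (hi : .inl i ≠ j₀) (hi' : .inl (i + 1) ≠ j₀) (hj : .inr j ≠ j₀) :
    f.cell (σ (i + 1, j)) = {α (.inr j), α (.inl i), α (.inl (i + 1))} ∧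
      |doubleArea (α (.inr j)) (α (.inl i)) (α (.inl (i + 1)))| = 1 := by
  obtain ⟨h1, h2, h3⟩ := h.mem_cells i j
  refine hf.abs_doubleArea (h.mem_curveVertices _) (h3 hj) (h1 hi) (h2 hi')
    (fun he => ?_) (fun he => ?_) (fun he => ?_)
  · exact absurd (h.label_injective hj hi he) (by simp)
  · exact absurd (h.label_injective hj hi' he) (by simp)
  · have := h.label_injective hi hi' he
    exact (Fin.add_ne_self i).1 (Sum.inl_injective this).symm

/-- Consecutive triangles at a common vertex have the same orientation. -/
theorem doubleArea_succ (h : f.IsPrismLabelling σ j₀ α) (hf : f.IsSmooth) {i : Fin (m + 4)}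
    {j : Fin 2} (hi : .inl i ≠ j₀) (hi' : .inl (i + 1) ≠ j₀) (hi'' : .inl (i + 1 + 1) ≠ j₀)
    (hj : .inr j ≠ j₀) :
    doubleArea (α (.inr j)) (α (.inl (i + 1))) (α (.inl (i + 1 + 1))) =
      doubleArea (α (.inr j)) (α (.inl i)) (α (.inl (i + 1))) := by
  obtain ⟨c1, d1⟩ := h.cell_eq hf hi hi' hj
  obtain ⟨c2, d2⟩ := h.cell_eq hf hi' hi'' hj
  have hne : σ (i + 1, j) ≠ σ (i + 1 + 1, j) := fun he => by
    have := h.injective he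
    simp only [Prod.mk.injEq, and_true] at this
    exact (Fin.add_ne_self (i + 1)).1 this.symm
  have d1' : doubleArea (α (.inr j)) (α (.inl (i + 1))) (α (.inl i)) =
      -doubleArea (α (.inr j)) (α (.inl i)) (α (.inl (i + 1))) := doubleArea_swap' _ _ _
  obtain ⟨m1, m2, m3⟩ := h.mem_cells i j
  obtain ⟨m4, m5, m6⟩ := h.mem_cells (i + 1) j
  have := doubleArea_mul_neg (a := α (.inr j)) (b := α (.inl (i + 1))) (c := α (.inl i))
    (e := α (.inl (i + 1 + 1))) hne (m3 hj) (m2 hi') (m6 hj) (m4 hi') (m1 hi) (m5 hi'') (by rw [d1']; intro h0; rw [neg_eq_zero.1 h0] at d1; simp at d1)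
    (by intro h0; rw [h0] at d2; simp at d2)
  rw [d1'] at this
  rcases abs_eq (zero_le_one' ℤ) |>.1 d1 with e1 | e1 <;>
  rcases abs_eq (zero_le_one' ℤ) |>.1 d2 with e2 | e2 <;>
  rw [e1, e2] at this ⊢ <;> norm_num at this

/-- In the standard embedding the interior exponents form a star. -/
theorem exists_isStar (h : f.IsPrismLabelling σ j₀ α) (hf : f.IsSmooth) {j : Fin 2}
    (hj₀ : j₀ = .inr j) : ∃ (p : ℤ × ℤ) (w : Fin (m + 4) → ℤ × ℤ), f.IsStar p w := by
  have hl : ∀ i : Fin (m + 4), Sum.inl i ≠ j₀ := fun i => by rw [hj₀]; simp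
  have hr : (Sum.inr (j + 1) : Fin (m + 4) ⊕ Fin 2) ≠ j₀ := by
    have : ∀ j : Fin 2, j + 1 ≠ j := by decide
    rw [hj₀]
    simp [this]
  set p := α (.inr (j + 1)) with hp
  set q : Fin (m + 4) → ℤ × ℤ := fun i => α (.inl i) with hq
  have heq : f.interiorExponents = insert p (Set.range q) := by
    rw [h.interiorExponents_eq]
    ext x
    constructor
    · rintro ⟨i | k, hk, rfl⟩
      · exact Or.inr ⟨i, rfl⟩
      · left
        have h2 : ∀ k j : Fin 2, k ≠ j → k = j + 1 := by decide
        rw [h2 k j (fun he => hk (by rw [hj₀, he]))]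
    · rintro (rfl | ⟨i, rfl⟩)
      · exact ⟨_, hr, rfl⟩
      · exact ⟨_, hl i, rfl⟩
  have hcell : ∀ i, f.cell (σ (i + 1, j + 1)) = {p, q i, q (i + 1)} ∧
      |doubleArea p (q i) (q (i + 1))| = 1 := fun i => h.cell_eq hf (hl _) (hl _) hr
  have horient : ∀ i, doubleArea p (q i) (q (i + 1)) = doubleArea p (q 0) (q (0 + 1)) := by
    intro i
    refine iterate_cycle (P := fun i => doubleArea p (q i) (q (i + 1)) =
      doubleArea p (q 0) (q (0 + 1))) (fun i hi => ?_) 0 i rfl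
    rw [← hi]
    exact h.doubleArea_succ hf (hl _) (hl _) (hl _) hr
  have hqi : Function.Injective q := fun i k he =>
    Sum.inl_injective (h.label_injective (hl i) (hl k) he)
  have hpq : ∀ i, q i ≠ p := fun i he => absurd (h.label_injective (hl i) hr he) (by simp)
  have hmem : ∀ i k, q k ∈ f.cell (σ (i + 1, j + 1)) → k = i ∨ k = i + 1 := by
    intro i k hk
    rw [(hcell i).1] at hk
    rcases hk with hk | hk | hk
    · exact absurd hk (hpq k)
    · exact Or.inl (hqi hk)
    · exact Or.inr (hqi hk)
  rcases abs_eq (zero_le_one' ℤ) |>.1 (hcell 0).2 with h1 | h1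
  · refine ⟨p, q, heq, fun i => (horient i).trans h1, fun i k hki hki' => ?_⟩
    refine TropicalPolynomial.notMem_cone (f := f) (x := σ (i + 1, j + 1)) (y := σ (k + 1, j + 1)) ?_ ?_ ?_
      ((horient i).trans h1) ?_ ?_ ?_
    · simp [(hcell i).1]
    · simp [(hcell i).1]
    · simp [(hcell i).1]
    · simp [(hcell k).1]
    · simp [(hcell k).1]
    · intro hk
      rcases hmem i k hk with rfl | rfl
      exacts [hki rfl, hki' rfl]
  -- If the orientation is clockwise, the cycle is traversed backwards.
  · have harea : ∀ i, doubleArea p (q (-i)) (q (-(i + 1))) = 1 := by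
      intro i
      rw [doubleArea_swap', show -i = -(i + 1) + 1 by
        rw [neg_add, neg_add_cancel_right], horient, h1, neg_neg]
    refine ⟨p, fun i => q (-i), ?_, harea, fun i k hki hki' => ?_⟩
    · rw [heq]
      congr 1
      ext x
      constructor
      · rintro ⟨i, rfl⟩
        exact ⟨-i, by simp⟩
      · rintro ⟨i, rfl⟩
        exact ⟨-i, rfl⟩
    · have hc := (hcell (-(i + 1))).1
      have hi : -(i + 1) + 1 = -i := by rw [neg_add, neg_add_cancel_right]
      rw [hi] at hc
      refine TropicalPolynomial.notMem_cone (f := f) (x := σ (-i, j + 1)) (y := σ (-k + 1, j + 1)) ?_ ?_ ?_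
        (harea i) ?_ ?_ ?_
      · simp [hc]
      · simp [hc]
      · simp [hc]
      · simp [(hcell (-k)).1]
      · simp [(hcell (-k)).1]
      · intro hk
        rw [← hi] at hk
        rcases hmem (-(i + 1)) (-k) hk with he | he
        · exact hki' (neg_injective he)
        · rw [hi] at he
          exact hki (neg_injective he)

end IsPrismLabelling

end TropicalPolynomial

/-! ### No quadrilateral bounds the outer face for `n ≥ 5` -/

theorem latticeFrame_injective {p e₀ e₁ : ℤ × ℤ} (he : latticeDet e₀ e₁ ^ 2 = 1) :
    Function.Injective (latticeFrame p e₀ e₁) := fun x y h => by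
  rw [← latticeCoords_frame he x, h, latticeCoords_frame he]

namespace IsInterior

variable {S I : Set (ℤ × ℤ)}

/-- The interior polygon has no vertex that sees a long edge at lattice distance one. -/
theorem false_of_line (h : IsInterior S I) {M : ℤ} (hM : 3 ≤ M) (h1 : (0, 1) ∈ I)
    (h0 : (0, 0) ∈ I) (hM0 : (M, 0) ∈ I) (hI : ∀ w ∈ I, w = (0, 1) ∨ w.2 ≤ 0) : False := by
  obtain ⟨v, hv, hlt⟩ := h.exists_lt (0, 1) h1 0 (-1) (Or.inr (by norm_num))
  simp only at hlt
  -- An exponent two or more steps beyond the edge from `(0, 1)` to the origin would create a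
  -- further interior point of positive height.
  have hx : -1 ≤ v.1 := by
    by_contra hx
    obtain ⟨w, hw, hd, s, hs0, hs1, e1, e2⟩ := h.exists_beyond h1 h0 (by simp) hv
      (m := -v.1) (by omega) (by simp [doubleArea])
    rcases hI w hw with rfl | hw
    · simp [doubleArea] at hd
    · simp only at e2
      nlinarith
  -- As `v.2 ≥ 2` and `M ≥ 3`, the exponent is two or more steps beyond the edge from `(M, 0)` to
  -- `(0, 1)`, with the same contradiction.
  have hm : 2 ≤ M * (v.2 - 1) + v.1 := by nlinarith
  obtain ⟨w, hw, hd, s, hs0, hs1, e1, e2⟩ := h.exists_beyond hM0 h1 (by simp) hv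
    hm (by simp only [doubleArea]; ring)
  rcases hI w hw with rfl | hw
  · simp [doubleArea] at hd
  · simp only at e2
    nlinarith

/-- The interior polygon has no obtuse vertex that sees a bent path of four points at lattice
distance one. -/
theorem false_of_bend (h : IsInterior S I) {L R κ : ℤ} (hL : 1 ≤ L) (hR : 1 ≤ R) (hLR : 3 ≤ L + R)
    (hκ : 0 ≤ κ) (h0 : (0, -1) ∈ I) (h1 : (R, 0) ∈ I) (h2 : (-L, L * κ) ∈ I)
    (hI : ∀ w ∈ I, 0 ≤ R * (w.2 + 1) - w.1 ∧ 0 ≤ L * (w.2 + 1) + (1 + L * κ) * w.1) : False := by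
  obtain ⟨v, hv, hlt⟩ := h.exists_lt (0, -1) h0 0 1 (Or.inr (by norm_num))
  simp only at hlt
  -- By `hI` both sides at `(0, -1)` are supporting lines of the interior polygon, so `v` is at most
  -- one step beyond each.
  have k1 : -1 ≤ R * (v.2 + 1) - v.1 := by
    by_contra hx
    obtain ⟨w, hw, hd, -⟩ := h.exists_beyond h0 h1 (by simp) hv
      (m := -(R * (v.2 + 1) - v.1)) (by omega) (by simp only [doubleArea]; ring)
    have := (hI w hw).1
    simp only [doubleArea] at hd
    linarith
  have k2 : -1 ≤ L * (v.2 + 1) + (1 + L * κ) * v.1 := by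
    by_contra hx
    obtain ⟨w, hw, hd, -⟩ := h.exists_beyond h2 h0
      (Int.isCoprime_iff_gcd_eq_one.1 ⟨-κ, -1, by ring⟩) hv
      (m := -(L * (v.2 + 1) + (1 + L * κ) * v.1)) (by omega) (by simp only [doubleArea]; ring)
    have := (hI w hw).2
    simp only [doubleArea] at hd
    linarith
  have hLκ : 0 ≤ L * κ := mul_nonneg (by omega) hκ
  -- Here `v.2 ≤ -2`. Together with `v.1 ≤ 0` the two bounds add up to `-2 ≤ -(L + R)`, contrary to
  -- `L + R ≥ 3`.
  have hR' : R * (v.2 + 1) ≤ -R := by nlinarith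
  have hL' : L * (v.2 + 1) ≤ -L := by nlinarith
  have hx : v.1 ≤ 0 := by omega
  have : (1 + L * κ) * v.1 ≤ v.1 := by nlinarith
  omega

end IsInterior

/-- Two adjacent unimodular triangles at `p` on the path `a`, `o`, `b`. -/
theorem add_sub_eq_smul {s : ℤ} (hs : s ^ 2 = 1) {p a o b : ℤ × ℤ}
    (h1 : doubleArea p a o = s) (h2 : doubleArea p o b = s) :
    (a - o) + (b - o) = (s * doubleArea o b a) • (p - o) := by
  simp only [doubleArea] at h1 h2
  ext
  · simp only [Prod.fst_add, Prod.fst_sub, Prod.smul_fst, smul_eq_mul, doubleArea]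
    linear_combination -((a.1 - o.1) + (b.1 - o.1)) * hs + s * (b.1 - o.1) * (h2 - h1) -
      s * ((a.1 - o.1) + (b.1 - o.1)) * h2
  · simp only [Prod.snd_add, Prod.snd_sub, Prod.smul_snd, smul_eq_mul, doubleArea]
    linear_combination -((a.2 - o.2) + (b.2 - o.2)) * hs + s * (b.2 - o.2) * (h2 - h1) -
      s * ((a.2 - o.2) + (b.2 - o.2)) * h2

/-- Two pairs of adjacent triangles on both sides of a path. -/
theorem add_eq_add_self_or {s : ℤ} (hs : s ^ 2 = 1) {p q a o b : ℤ × ℤ}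
    (h1 : doubleArea p a o = s) (h2 : doubleArea p o b = s) (h3 : doubleArea q a o = -s)
    (h4 : doubleArea q o b = -s) : a + b = o + o ∨ p + q = o + o := by
  have e := add_sub_eq_smul hs h1 h2
  have e' := add_sub_eq_smul (s := -s) (by rw [neg_sq, hs]) h3 h4
  rw [neg_mul] at e'
  -- The vector `a + b - 2o` is both `κ (p - o)` and `-κ (q - o)`.
  generalize s * doubleArea o b a = κ at e e'
  simp only [Prod.ext_iff, Prod.fst_add, Prod.fst_sub, Prod.smul_fst, Prod.snd_add, Prod.snd_sub,
    Prod.smul_snd, smul_eq_mul] at e e'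
  obtain ⟨e1, e2⟩ := e
  obtain ⟨e3, e4⟩ := e'
  by_cases h0 : κ = 0
  · left
    rw [h0] at e1 e2
    ext
    · simp only [Prod.fst_add]; linarith
    · simp only [Prod.snd_add]; linarith
  · right
    ext
    · have := (mul_eq_zero.1 (show κ * (p.1 + q.1 - (o.1 + o.1)) = 0 by linarith)).resolve_left h0
      simp only [Prod.fst_add]; linarith
    · have := (mul_eq_zero.1 (show κ * (p.2 + q.2 - (o.2 + o.2)) = 0 by linarith)).resolve_left h0
      simp only [Prod.snd_add]; linarith

theorem eq_add_smul_of_add_eq {u : ℕ → ℤ × ℤ} {M : ℕ}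
    (h : ∀ j, j + 2 ≤ M → u j + u (j + 2) = u (j + 1) + u (j + 1)) :
    ∀ j, j ≤ M → u j = u 0 + (j : ℤ) • (u 1 - u 0) := by
  have key : ∀ j, j + 1 ≤ M → u j = u 0 + (j : ℤ) • (u 1 - u 0) ∧
      u (j + 1) = u 0 + ((j + 1 : ℕ) : ℤ) • (u 1 - u 0) := by
    intro j
    induction j with
    | zero => intro _; simp
    | succ j ih =>
      intro hj
      obtain ⟨h1, h2⟩ := ih (by omega)
      refine ⟨h2, ?_⟩
      have := h j (by omega)
      rw [← eq_sub_iff_add_eq'] at this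
      rw [this, h1, h2]
      push_cast
      module
  intro j hj
  rcases j with _ | j
  · simp
  · exact (key j hj).2

/-- The interior exponents form the suspension of a path with end points `p` and `q`. -/
structure IsSuspension (I : Set (ℤ × ℤ)) (N : ℕ) (p q : ℤ × ℤ) (r : ℕ → ℤ × ℤ) (s : ℤ) : Prop where
  eq_insert : I = insert p (insert q {x | ∃ k < N, r k = x})
  injOn : ∀ k l, k < N → l < N → r k = r l → k = l
  sq_eq : s ^ 2 = 1
  left : ∀ k, k + 1 < N → doubleArea p (r k) (r (k + 1)) = s
  right : ∀ k, k + 1 < N → doubleArea q (r k) (r (k + 1)) = -s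

namespace IsSuspension

variable {f : TropicalPolynomial} {N : ℕ} {p q : ℤ × ℤ} {r : ℕ → ℤ × ℤ} {s : ℤ}

theorem swap {I : Set (ℤ × ℤ)} (h : IsSuspension I N p q r s) : IsSuspension I N q p r (-s) :=
  ⟨by rw [h.eq_insert, Set.insert_comm], h.injOn, by rw [neg_sq, h.sq_eq], h.right,
    fun k hk => by rw [h.left k hk, neg_neg]⟩

/-- In suitable coordinates the path runs along the first axis from the origin, `p` is `(0, 1)` and
`q` has height -1. Hence `p` alone lies above the axis, and `false_of_line` applies. -/
theorem not_isSmooth_of_line (h : IsSuspension f.interiorExponents N p q r s) (hf : f.IsSmooth)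
    (hN : 4 ≤ N) (hr : ∀ j, j + 2 ≤ N - 1 → r j + r (j + 2) = r (j + 1) + r (j + 1)) : False := by
  have hlin := eq_add_smul_of_add_eq hr
  have hleft := h.left 0 (by omega)
  have hright := h.right 0 (by omega)
  set o := r 0
  set e₀ := r (0 + 1) - o with he₀
  set e₁ := p - o with he₁
  have hdet : latticeDet e₀ e₁ = s := by
    rw [← hleft, latticeDet, he₀, he₁, doubleArea]
    simp only [Prod.fst_sub, Prod.snd_sub]
    ring
  have hdet2 : latticeDet e₀ e₁ ^ 2 = 1 := by rw [hdet, h.sq_eq]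
  have hs := h.sq_eq
  have hfr : ∀ j : ℕ, j ≤ N - 1 → latticeFrame o e₀ e₁ ((j : ℤ), 0) = r j := by
    intro j hj
    rw [hlin j hj]
    ext <;> simp [latticeFrame, he₀]
  have hfp : latticeFrame o e₀ e₁ (0, 1) = p := by
    ext <;> simp [latticeFrame, he₁]
  have hfq : ∃ x, latticeFrame o e₀ e₁ (x, -1) = q := by
    refine ⟨(latticeCoords o e₀ e₁ q).1, ?_⟩
    have : (latticeCoords o e₀ e₁ q).2 = -1 := by
      simp only [latticeCoords, hdet]
      simp only [doubleArea] at hright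
      simp only [he₀, Prod.fst_sub, Prod.snd_sub]
      linear_combination s * hright - hs
    rw [← this]
    exact latticeFrame_coords hdet2 q
  obtain ⟨x, hx⟩ := hfq
  have hmem : ∀ j : ℕ, j ≤ N - 1 → ((j : ℤ), (0 : ℤ)) ∈
      latticeFrame o e₀ e₁ ⁻¹' f.interiorExponents := fun j hj => by
    rw [Set.mem_preimage, hfr j hj, h.eq_insert]
    exact Or.inr (Or.inr ⟨j, by omega, rfl⟩)
  refine (hf.isInterior o hdet2).false_of_line (M := ((N - 1 : ℕ) : ℤ)) (by omega) ?_
    (by simpa using hmem 0 (by omega)) (hmem (N - 1) le_rfl) ?_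
  · rw [Set.mem_preimage, hfp, h.eq_insert]
    exact Or.inl rfl
  · intro w hw
    rw [Set.mem_preimage, h.eq_insert] at hw
    rcases hw with hw | hw | ⟨k, hk, hw⟩
    · exact Or.inl (latticeFrame_injective hdet2 (hw.trans hfp.symm))
    · right
      rw [latticeFrame_injective hdet2 (hw.trans hx.symm)]
      norm_num
    · right
      rw [latticeFrame_injective hdet2 (hw.symm.trans (hfr k (by omega)).symm)]

/-- A bend must sit at the midpoint of `p` and `q`, so `r k` is the only one. With `r k` as origin,
`p = (0, 1)` and `q = (0, -1)`, the straight arms end in `(N - 1 - k, 0)` and `(-k, k * κ)`, as in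
`false_of_bend`. -/
theorem not_isSmooth_of_bend (h : IsSuspension f.interiorExponents N p q r s) (hf : f.IsSmooth)
    (hN : 4 ≤ N) {k : ℕ} (hk0 : 1 ≤ k) (hkN : k + 2 ≤ N) (hmid : p + q = r k + r k)
    (hκ : 0 ≤ s * doubleArea (r k) (r (k + 1)) (r (k - 1))) : False := by
  have hstraight : ∀ j, j + 2 < N → j + 1 ≠ k → r j + r (j + 2) = r (j + 1) + r (j + 1) := by
    intro j hj hjk
    refine (add_eq_add_self_or h.sq_eq (h.left j (by omega)) (h.left (j + 1) (by omega))
      (h.right j (by omega)) (h.right (j + 1) (by omega))).resolve_right fun h' => hjk ?_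
    refine h.injOn _ _ (by omega) (by omega) ?_
    rw [hmid, Prod.ext_iff] at h'
    simp only [Prod.fst_add, Prod.snd_add] at h'
    ext <;> omega
  have hfwd := eq_add_smul_of_add_eq (u := fun j => r (k + j)) (M := N - 1 - k) (fun j hj =>
    hstraight (k + j) (by omega) (by omega))
  have hbwd := eq_add_smul_of_add_eq (u := fun j => r (k - j)) (M := k) (fun j hj => by
    have := hstraight (k - (j + 2)) (by omega) (by omega)
    rw [show k - (j + 2) + 2 = k - j by omega, show k - (j + 2) + 1 = k - (j + 1) by omega] at this
    rw [← this, add_comm])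
  simp only [add_zero, Nat.sub_zero] at hfwd hbwd
  have h1 := h.left k (by omega)
  have h2 := h.left (k - 1) (by omega)
  rw [show k - 1 + 1 = k by omega] at h2
  have hs := h.sq_eq
  set o := r k
  set a := r (k - 1)
  set e₀ := r (k + 1) - o with he₀
  set e₁ := p - o with he₁
  set κ := s * doubleArea o (r (k + 1)) a with hκ'
  have hdet : latticeDet e₀ e₁ = s := by
    rw [← h1, latticeDet, he₀, he₁, doubleArea]
    simp only [Prod.fst_sub, Prod.snd_sub]
    ring
  have hdet2 : latticeDet e₀ e₁ ^ 2 = 1 := by rw [hdet, hs]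
  have hfR : ∀ j : ℕ, j ≤ N - 1 - k → latticeFrame o e₀ e₁ ((j : ℤ), 0) = r (k + j) := by
    intro j hj
    rw [hfwd j hj]
    ext <;> simp [latticeFrame, he₀]
  have ha := add_sub_eq_smul hs h2 h1
  simp only [Prod.ext_iff, Prod.fst_add, Prod.fst_sub, Prod.smul_fst, Prod.snd_add, Prod.snd_sub,
    Prod.smul_snd, smul_eq_mul] at ha
  have ha1 : a.1 - o.1 = -e₀.1 + κ * e₁.1 := by
    simp only [he₀, he₁, Prod.fst_sub]
    linear_combination ha.1
  have ha2 : a.2 - o.2 = -e₀.2 + κ * e₁.2 := by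
    simp only [he₀, he₁, Prod.snd_sub]
    linear_combination ha.2
  have hfL : ∀ j : ℕ, j ≤ k → latticeFrame o e₀ e₁ (-(j : ℤ), (j : ℤ) * κ) = r (k - j) := by
    intro j hj
    rw [hbwd j hj]
    ext
    · simp only [latticeFrame, Prod.fst_add, Prod.smul_fst, smul_eq_mul, Prod.fst_sub]
      linear_combination -(j : ℤ) * ha1
    · simp only [latticeFrame, Prod.snd_add, Prod.smul_snd, smul_eq_mul, Prod.snd_sub]
      linear_combination -(j : ℤ) * ha2
  have hfp : latticeFrame o e₀ e₁ (0, 1) = p := by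
    ext <;> simp [latticeFrame, he₁]
  have hfq : latticeFrame o e₀ e₁ (0, -1) = q := by
    rw [Prod.ext_iff] at hmid
    simp only [Prod.fst_add, Prod.snd_add] at hmid
    ext <;> simp [latticeFrame, he₁] <;> omega
  refine (hf.isInterior o hdet2).false_of_bend (L := k) (R := ((N - 1 - k : ℕ) : ℤ)) (κ := κ)
    (by omega) (by omega) (by omega) hκ ?_ ?_ ?_ ?_
  · rw [Set.mem_preimage, hfq, h.eq_insert]
    exact Or.inr (Or.inl rfl)
  · rw [Set.mem_preimage, hfR _ le_rfl, h.eq_insert]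
    exact Or.inr (Or.inr ⟨_, by omega, rfl⟩)
  · rw [Set.mem_preimage, hfL _ le_rfl, h.eq_insert]
    exact Or.inr (Or.inr ⟨_, by omega, rfl⟩)
  · intro w hw
    rw [Set.mem_preimage, h.eq_insert] at hw
    generalize hRd : ((N - 1 - k : ℕ) : ℤ) = R at *
    have hk1 : (1 : ℤ) ≤ k := by exact_mod_cast hk0
    have hR1 : 1 ≤ R := by omega
    have hkκ : 0 ≤ (k : ℤ) * κ := mul_nonneg (by omega) hκ
    rcases hw with hw | hw | ⟨l, hl, hw⟩
    · rw [latticeFrame_injective hdet2 (hw.trans hfp.symm)]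
      simp only
      constructor <;> omega
    · rw [latticeFrame_injective hdet2 (hw.trans hfq.symm)]
      simp
    · rcases le_total k l with hkl | hkl
      · have := hfR (l - k) (by omega)
        rw [show k + (l - k) = l by omega] at this
        rw [latticeFrame_injective hdet2 (hw.symm.trans this.symm)]
        have : ((l - k : ℕ) : ℤ) ≤ R := by omega
        have h0 : 0 ≤ ((l - k : ℕ) : ℤ) := by positivity
        constructor
        · simp only; linarith
        · simp only
          nlinarith
      · have := hfL (k - l) (by omega)
        rw [show k - (k - l) = l by omega] at this
        rw [latticeFrame_injective hdet2 (hw.symm.trans this.symm)]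
        have h1 : ((k - l : ℕ) : ℤ) ≤ k := by omega
        have h0 : 0 ≤ ((k - l : ℕ) : ℤ) := by positivity
        have h3 : 0 ≤ ((k - l : ℕ) : ℤ) * κ := mul_nonneg h0 hκ
        constructor
        · simp only
          nlinarith
        · simp only
          linarith

/-- The path is straight, or it bends at the midpoint of `p` and `q`. Exchanging `p` and `q` gives
the bend the required sign. -/
theorem not_isSmooth (h : IsSuspension f.interiorExponents N p q r s) (hN : 4 ≤ N) :
    ¬ f.IsSmooth := by
  intro hf
  by_cases hr : ∀ j, j + 2 ≤ N - 1 → r j + r (j + 2) = r (j + 1) + r (j + 1)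
  · exact h.not_isSmooth_of_line hf hN hr
  push Not at hr
  obtain ⟨j, hj, hne⟩ := hr
  have hmid := (add_eq_add_self_or h.sq_eq (h.left j (by omega)) (h.left (j + 1) (by omega))
      (h.right j (by omega)) (h.right (j + 1) (by omega))).resolve_left hne
  rcases le_total 0 (s * doubleArea (r (j + 1)) (r (j + 1 + 1)) (r (j + 1 - 1))) with hκ | hκ
  · exact h.not_isSmooth_of_bend hf hN (by omega) (by omega) hmid hκ
  · refine h.swap.not_isSmooth_of_bend hf hN (k := j + 1) (by omega) (by omega) ?_ (by linarith)
    rw [add_comm, hmid]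

end IsSuspension

namespace TropicalPolynomial.IsPrismLabelling

variable {f : TropicalPolynomial} {m : ℕ} {σ : Fin (m + 4) × Fin 2 → ℝ × ℝ}
  {j₀ : Fin (m + 4) ⊕ Fin 2} {α : Fin (m + 4) ⊕ Fin 2 → ℤ × ℤ}

open Fin.CommRing in
/-- The unbounded face is bounded by one of the two `n`-cycles. -/
theorem ne_inl (h : f.IsPrismLabelling σ j₀ α) (hf : f.IsSmooth) (hm : 1 ≤ m) (i₀ : Fin (m + 4)) :
    j₀ ≠ .inl i₀ := by
  intro hj₀
  have hR : ∀ j, Sum.inr j ≠ j₀ := fun j => by rw [hj₀]; simp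
  have hne : ∀ k : ℕ, k < m + 3 → i₀ + 1 + (k : Fin (m + 4)) ≠ i₀ := by
    intro k hk he
    have h1 : (((k + 1 : ℕ) : Fin (m + 4))) = 0 := by
      rw [add_assoc, add_eq_left] at he
      rw [Nat.cast_add, Nat.cast_one]
      exact (add_comm _ _).trans he
    have := congrArg Fin.val h1
    rw [Fin.val_natCast, Nat.mod_eq_of_lt (by omega)] at this
    simp at this
  have hL : ∀ k : ℕ, k < m + 3 → Sum.inl (i₀ + 1 + (k : Fin (m + 4))) ≠ j₀ := fun k hk => by
    rw [hj₀]
    exact fun he => hne k hk (Sum.inl_injective he)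
  have hsucc : ∀ k : ℕ, i₀ + 1 + ((k + 1 : ℕ) : Fin (m + 4)) = i₀ + 1 + (k : Fin (m + 4)) + 1 := by
    intro k
    rw [Nat.cast_succ, add_assoc (i₀ + 1)]
  -- Without the outer quadrilateral the remaining `m + 3` quadrilaterals form a path; the two long
  -- cycles give the end points of the suspension.
  set r : ℕ → ℤ × ℤ := fun k => α (.inl (i₀ + 1 + (k : Fin (m + 4)))) with hr
  set p : Fin 2 → ℤ × ℤ := fun j => α (.inr j) with hp
  have horient : ∀ j k, k + 1 < m + 3 →
      doubleArea (p j) (r k) (r (k + 1)) = doubleArea (p j) (r 0) (r 1) := by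
    intro j k
    induction k with
    | zero => intro _; rfl
    | succ k ih =>
      intro hk
      rw [← ih (by omega)]
      simp only [hr, hsucc]
      refine h.doubleArea_succ hf (hL _ (by omega)) ?_ ?_ (hR j)
      · rw [← hsucc]; exact hL _ (by omega)
      · rw [← hsucc, ← hsucc]; exact hL _ (by omega)
  have hl0 := hL 0 (by omega)
  have hl1 := hL 1 (by omega)
  rw [hsucc] at hl1
  have hr1 : r 1 = α (.inl (i₀ + 1 + ((0 : ℕ) : Fin (m + 4)) + 1)) := by
    simp only [hr]
    rw [← hsucc]
  have harea : ∀ j, |doubleArea (p j) (r 0) (r 1)| = 1 := fun j => by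
    rw [hr1]
    exact (h.cell_eq hf hl0 hl1 (hR j)).2
  -- The two ends of a rung have the side `r 0`, `r 1` in common, and their third corners lie on
  -- different sides of it.
  have hneg : doubleArea (p 1) (r 0) (r 1) = -doubleArea (p 0) (r 0) (r 1) := by
    obtain ⟨m1, m2, m3⟩ := h.mem_cells (i₀ + 1 + ((0 : ℕ) : Fin (m + 4))) 0
    obtain ⟨m4, m5, m6⟩ := h.mem_cells (i₀ + 1 + ((0 : ℕ) : Fin (m + 4))) 1
    have hrot : ∀ a b c, doubleArea b c a = doubleArea a b c := fun a b c => by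
      simp only [doubleArea]; ring
    have h0 := harea 0
    have h1 := harea 1
    rw [hr1] at h0 h1 ⊢
    have := doubleArea_mul_neg (fun he => by simpa using h.injective he) (m1 hl0) (m2 hl1) (m4 hl0)
      (m5 hl1) (m3 (hR 0)) (m6 (hR 1))
      (by rw [hrot]; intro h2; simp only [hr, hp] at h0; rw [h2] at h0; simp at h0)
      (by rw [hrot]; intro h2; simp only [hr, hp] at h1; rw [h2] at h1; simp at h1)
    rw [hrot (α (.inr 0)), hrot (α (.inr 1))] at this
    simp only [hr, hp] at h0 h1 this ⊢
    rcases abs_eq (zero_le_one' ℤ) |>.1 h0 with e1 | e1 <;>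
    rcases abs_eq (zero_le_one' ℤ) |>.1 h1 with e2 | e2 <;>
    rw [e1, e2] at this ⊢ <;> first | (exfalso; norm_num at this; done) | norm_num
  have hsus : IsSuspension f.interiorExponents (m + 3) (p 0) (p 1) r
      (doubleArea (p 0) (r 0) (r 1)) := by
    refine ⟨?_, ?_, by rw [← sq_abs, harea, one_pow], fun k hk => horient 0 k hk, fun k hk => by
      rw [horient 1 k hk, hneg]⟩
    · rw [h.interiorExponents_eq]
      ext x
      constructor
      · rintro ⟨i | j, hi, rfl⟩
        · right; right
          have hlt := (i - (i₀ + 1)).isLt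
          refine ⟨(i - (i₀ + 1)).val, ?_, ?_⟩
          · by_contra hge
            have hv : (i - (i₀ + 1)).val = m + 3 := by omega
            apply hi
            rw [hj₀]
            congr 1
            have h1 : i - (i₀ + 1) = ((m + 3 : ℕ) : Fin (m + 4)) := by
              rw [← hv, Fin.cast_val_eq_self]
            have h2 : ((m + 3 : ℕ) : Fin (m + 4)) + 1 = 0 := by
              rw [← Nat.cast_succ]
              exact Fin.natCast_self _
            rw [sub_eq_iff_eq_add, ← add_assoc, add_comm _ i₀, add_assoc, h2, add_zero] at h1
            exact h1
          · simp only [hr]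
            rw [Fin.cast_val_eq_self, add_sub_cancel]
        · fin_cases j
          · exact Or.inl rfl
          · exact Or.inr (Or.inl rfl)
      · rintro (rfl | rfl | ⟨k, hk, rfl⟩)
        · exact ⟨_, hR 0, rfl⟩
        · exact ⟨_, hR 1, rfl⟩
        · exact ⟨_, hL k hk, rfl⟩
    · intro k l hk hl he
      have := add_left_cancel (Sum.inl_injective (h.label_injective (hL k hk) (hL l hl) he))
      have := congrArg Fin.val this
      rwa [Fin.val_natCast, Fin.val_natCast, Nat.mod_eq_of_lt (by omega),
        Nat.mod_eq_of_lt (by omega)] at this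
  exact hsus.not_isSmooth (by omega) hf

end TropicalPolynomial.IsPrismLabelling

/-! ### Finite certificates for smooth curves and their skeleta -/

namespace TropicalPolynomial

variable {f : TropicalPolynomial} {τ : Type*}

/-- The part of the bounded curve that is induced on the set of points `X`, described by a list of
labels with a Boolean adjacency relation. -/
structure IsGraphModel (f : TropicalPolynomial) (L : List τ) (pos : τ → ℝ × ℝ) (adj : τ → τ → Bool)
    (X : Set (ℝ × ℝ)) : Prop where
  nodup : L.Nodup
  injOn : ∀ t ∈ L, ∀ u ∈ L, pos t = pos u → t = u
  mem_iff : ∀ x, x ∈ X ↔ ∃ t ∈ L, pos t = x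
  adj_iff : ∀ t ∈ L, ∀ u ∈ L, f.curveGraph.Adj (pos t) (pos u) ↔ adj t u

namespace IsGraphModel

variable {L : List τ} {pos : τ → ℝ × ℝ} {adj : τ → τ → Bool} {X : Set (ℝ × ℝ)}

theorem ncard_neighbors (h : f.IsGraphModel L pos adj X) {t : τ} (ht : t ∈ L) :
    {y | y ∈ X ∧ f.curveGraph.Adj (pos t) y}.ncard = (L.filter (adj t)).length := by
  classical
  have h1 : {y | y ∈ X ∧ f.curveGraph.Adj (pos t) y} =
      pos '' ((L.filter (adj t)).toFinset : Set τ) := by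
    ext y
    simp only [Set.mem_ofPred_eq, h.mem_iff, Set.mem_image, List.coe_toFinset, List.mem_filter]
    constructor
    · rintro ⟨⟨u, hu, rfl⟩, hy⟩
      exact ⟨u, ⟨hu, (h.adj_iff t ht u hu).1 hy⟩, rfl⟩
    · rintro ⟨u, ⟨hu, hy⟩, rfl⟩
      exact ⟨⟨u, hu, rfl⟩, (h.adj_iff t ht u hu).2 hy⟩
  rw [h1, Set.InjOn.ncard_image, Set.ncard_coe_finset,
    List.toFinset_card_of_nodup (h.nodup.filter _)]
  intro u hu v hv he
  simp only [List.coe_toFinset, Set.mem_ofPred_eq, List.mem_filter] at hu hv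
  exact h.injOn u hu.1 v hv.1 he

theorem existsUnique_iff (h : f.IsGraphModel L pos adj X) {t : τ} (ht : t ∈ L) :
    (∃! y, y ∈ X ∧ f.curveGraph.Adj (pos t) y) ↔ (L.filter (adj t)).length = 1 := by
  rw [← h.ncard_neighbors ht, Set.ncard_eq_one]
  simp only [Set.ext_iff, Set.mem_ofPred_eq, Set.mem_singleton_iff]
  constructor
  · rintro ⟨y, hy, huniq⟩
    exact ⟨y, fun z => ⟨huniq z, fun hz => hz ▸ hy⟩⟩
  · rintro ⟨y, hy⟩
    exact ⟨y, (hy y).2 rfl, fun z hz => (hy z).1 hz⟩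

/-- If there are no `1`-valent vertices, then nothing is pruned. -/
theorem core (h : f.IsGraphModel L pos adj f.curveVertices)
    (hL : ∀ t ∈ L, (L.filter (adj t)).length ≠ 1) :
    f.IsGraphModel L pos adj f.coreVertices := by
  have hk : ∀ k, f.pruned k = f.curveVertices := by
    intro k
    induction k with
    | zero => rfl
    | succ k ih =>
      ext x
      rw [pruned, ih, Set.mem_ofPred_eq, and_iff_left_iff_imp]
      intro hx
      obtain ⟨t, ht, rfl⟩ := (h.mem_iff x).1 hx
      rw [h.existsUnique_iff ht]
      exact hL t ht
  have : f.coreVertices = f.curveVertices := by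
    ext x
    simp [coreVertices, hk]
  rwa [this]

variable {C : List τ}

theorem coreGraph_adj (h : f.IsGraphModel C pos adj f.coreVertices) {t u : τ} (ht : t ∈ C)
    (hu : u ∈ C) : f.coreGraph.Adj (pos t) (pos u) ↔ adj t u := by
  rw [← h.adj_iff t ht u hu]
  exact ⟨fun h' => h'.2.2, fun h' => ⟨(h.mem_iff _).2 ⟨t, ht, rfl⟩, (h.mem_iff _).2 ⟨u, hu, rfl⟩, h'⟩⟩

theorem isTwoValent_iff (h : f.IsGraphModel C pos adj f.coreVertices) {t : τ} (ht : t ∈ C) :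
    f.IsTwoValent (pos t) ↔ (C.filter (adj t)).length = 2 := by
  rw [← h.ncard_neighbors ht, IsTwoValent]
  have : f.coreGraph.neighborSet (pos t) =
      {y | y ∈ f.coreVertices ∧ f.curveGraph.Adj (pos t) y} := by
    ext y
    exact ⟨fun h' => ⟨h'.2.1, h'.2.2⟩, fun h' => ⟨(h.mem_iff _).2 ⟨t, ht, rfl⟩, h'⟩⟩
  rw [this]

theorem mem_skeletonVertices_iff (h : f.IsGraphModel C pos adj f.coreVertices) (x : ℝ × ℝ) :
    x ∈ f.skeletonVertices ↔ ∃ t ∈ C.filter (fun t => (C.filter (adj t)).length != 2), pos t = x := by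
  simp only [skeletonVertices, Set.mem_ofPred_eq, List.mem_filter]
  constructor
  · rintro ⟨hx, hn⟩
    obtain ⟨t, ht, rfl⟩ := (h.mem_iff x).1 hx
    rw [h.isTwoValent_iff ht] at hn
    exact ⟨t, ⟨ht, by simpa using hn⟩, rfl⟩
  · rintro ⟨t, ⟨ht, hn⟩, rfl⟩
    refine ⟨(h.mem_iff _).2 ⟨t, ht, rfl⟩, ?_⟩
    rw [h.isTwoValent_iff ht]
    simpa using hn

end IsGraphModel

theorem isChain_of_list {l : List (ℝ × ℝ)} {u v : ℝ × ℝ} (hu : u ∈ f.skeletonVertices)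
    (hv : v ∈ f.skeletonVertices) (hl : l.IsChain f.coreGraph.Adj) (hnd : l.Nodup)
    (hlen : 2 ≤ l.length) (hhead : l.head? = some u) (hlast : l.getLast? = some v)
    (htwo : ∀ w ∈ l.tail.dropLast, f.IsTwoValent w) :
    f.IsChain {d | d ∈ List.zipWith (fun x y => s(x, y)) l l.tail} u v := by
  have hne : l ≠ [] := by rintro rfl; simp at hlen
  have h1 : l.head hne = u := by
    rw [List.head?_eq_some_head hne] at hhead
    exact Option.some.inj hhead
  have h2 : l.getLast hne = v := by
    rw [List.getLast?_eq_some_getLast hne] at hlast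
    exact Option.some.inj hlast
  subst h1 h2
  have hs := SimpleGraph.Walk.support_ofSupport hne hl
  refine ⟨hu, hv, SimpleGraph.Walk.ofSupport l hne hl, ?_, ?_, ?_, ?_⟩
  · refine SimpleGraph.Walk.IsPath.isTrail ?_
    rwa [SimpleGraph.Walk.isPath_def, hs]
  · have := SimpleGraph.Walk.length_support (SimpleGraph.Walk.ofSupport l hne hl)
    rw [hs] at this
    omega
  · rwa [hs]
  · rw [SimpleGraph.Walk.edges_eq_zipWith_support, hs]

variable {W E : Type*} {G : SimpleGraph W} {src tgt : E → W}

/-- A subdivision that is given by one chain for each edge. -/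
theorem isSubdivision_of_edges {σ : W → ℝ × ℝ} {c : E → Set (Sym2 (ℝ × ℝ))}
    (hG : ∀ v w, G.Adj v w ↔ ∃ e, s(src e, tgt e) = s(v, w))
    (hE : ∀ e e', s(src e, tgt e) = s(src e', tgt e') → e = e')
    (hσ : Function.Injective σ) (hrange : Set.range σ = f.skeletonVertices)
    (hc : ∀ e, f.IsChain (c e) (σ (src e)) (σ (tgt e)))
    (hcover : ∀ x y, f.coreGraph.Adj x y → ∃ e, s(x, y) ∈ c e) :
    f.IsSubdivision G σ fun v w => {d | ∃ e, s(src e, tgt e) = s(v, w) ∧ d ∈ c e} := by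
  have hset : ∀ e v w, s(src e, tgt e) = s(v, w) →
      {d | ∃ e, s(src e, tgt e) = s(v, w) ∧ d ∈ c e} = c e := by
    intro e v w he
    ext d
    constructor
    · rintro ⟨e', he', hd⟩
      rwa [hE e e' (he.trans he'.symm)]
    · exact fun hd => ⟨e, he, hd⟩
  have hchain : ∀ v w, G.Adj v w →
      f.IsChain {d | ∃ e, s(src e, tgt e) = s(v, w) ∧ d ∈ c e} (σ v) (σ w) := by
    intro v w h
    obtain ⟨e, he⟩ := (hG v w).1 h
    rw [hset e v w he]
    rcases Sym2.eq_iff.1 he with ⟨h1, h2⟩ | ⟨h1, h2⟩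
    · rw [← h1, ← h2]
      exact hc e
    · rw [← h1, ← h2]
      exact (hc e).symm
  refine ⟨hσ, hrange, hchain, fun v w _ => by simp only [Sym2.eq_swap (a := v)], ?_, ?_⟩
  · intro v w v' w' h h' he
    have h1 := hchain v w h
    have h2 := hchain v' w' h'
    rw [he] at h1
    have k1 := h1.left_eq_or_eq h2
    have k2 := h1.symm.left_eq_or_eq h2
    rw [hσ.eq_iff, hσ.eq_iff] at k1 k2
    rcases k1 with rfl | rfl <;> rcases k2 with rfl | rfl
    · exact absurd rfl h.ne
    · rfl
    · exact Sym2.eq_swap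
    · exact absurd rfl h.ne
  · intro x y h
    obtain ⟨e, he⟩ := hcover x y h
    exact ⟨src e, tgt e, (hG _ _).2 ⟨e, rfl⟩, e, rfl, he⟩

end TropicalPolynomial

namespace TropicalPolynomial

/-- The tropical polynomial with the given exponents and coefficients. -/
def ofPoints (P : List ((ℤ × ℤ) × ℤ)) : TropicalPolynomial where
  support := (P.map Prod.fst).toFinset
  coeff a := ((P.find? fun x => x.1 == a).elim 0 Prod.snd : ℤ)

end TropicalPolynomial

/-- A list of lattice points with heights together with a list of triangles, whose corners are given
by their indices in the list of points. -/
structure TriangleList where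
  points : List ((ℤ × ℤ) × ℤ)
  triangles : List (ℕ × ℕ × ℕ)

namespace TriangleList

open TropicalPolynomial

variable (T : TriangleList)

def exponent (i : ℕ) : ℤ × ℤ := (T.points.getD i ((0, 0), 0)).1

def height (i : ℕ) : ℤ := (T.points.getD i ((0, 0), 0)).2

def corners (t : ℕ × ℕ × ℕ) : List ℕ := [t.1, t.2.1, t.2.2]

def area (i j k : ℕ) : ℤ := doubleArea (T.exponent i) (T.exponent j) (T.exponent k)

/-- The value of a monomial at a lattice point. -/
def value (i : ℕ) (z : ℤ × ℤ) : ℤ := T.height i + (T.exponent i).1 * z.1 + (T.exponent i).2 * z.2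

/-- The vertex of the curve that is dual to a triangle. -/
def dual (t : ℕ × ℕ × ℕ) : ℤ × ℤ :=
  let a := T.exponent t.1
  let b := T.exponent t.2.1
  let c := T.exponent t.2.2
  let r := T.height t.1 - T.height t.2.1
  let s := T.height t.1 - T.height t.2.2
  let d := T.area t.1 t.2.1 t.2.2
  -- Cramer's rule, with multiplication by `d` in place of division since `d = ±1` for a unimodular
  -- triangle. With integer heights all vertices are lattice points.
  (d * (r * (c.2 - a.2) - (b.2 - a.2) * s), d * ((b.1 - a.1) * s - (c.1 - a.1) * r))

/-- The triangle is a unimodular cell of the regular subdivision. -/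
def checkCell (t : ℕ × ℕ × ℕ) : Bool :=
  (corners t).all (fun i => decide (i < T.points.length)) && (T.area t.1 t.2.1 t.2.2).natAbs == 1 &&
    (List.range T.points.length).all fun i =>
      if (corners t).contains i then T.value i (T.dual t) == T.value t.1 (T.dual t)
      else decide (T.value t.1 (T.dual t) < T.value i (T.dual t))

/-- Each side of the triangle is a side of another triangle or lies on the boundary. -/
def checkSides (t : ℕ × ℕ × ℕ) : Bool :=
  (corners t).all fun i => (corners t).all fun j => (corners t).all fun k =>
    T.area i j k != 1 ||
      T.triangles.any (fun u => (corners u).contains i && (corners u).contains j &&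
        !(corners u).contains k) ||
      (List.range T.points.length).all fun l => decide (0 ≤ T.area i j l)

def check : Bool :=
  decide (T.points.map Prod.fst).Nodup && !T.triangles.isEmpty && T.triangles.all T.checkCell &&
    T.triangles.all T.checkSides &&
    decide (T.triangles.Pairwise fun t u => (corners t).all (corners u).contains = false)

/-- Exactly two common corners are required, so a triangle with distinct corners is not adjacent to
itself. -/
def adj (t u : ℕ × ℕ × ℕ) : Bool := ((corners t).filter (corners u).contains).length == 2

def poly : TropicalPolynomial := ofPoints T.points

def pos (t : ℕ × ℕ × ℕ) : ℝ × ℝ := (((T.dual t).1 : ℝ), ((T.dual t).2 : ℝ))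

variable {T}

theorem exponent_injOn (hT : (T.points.map Prod.fst).Nodup) {i j : ℕ} (hi : i < T.points.length)
    (hj : j < T.points.length) (h : T.exponent i = T.exponent j) : i = j := by
  have hi' : i < (T.points.map Prod.fst).length := by simpa using hi
  have hj' : j < (T.points.map Prod.fst).length := by simpa using hj
  refine (hT.getElem_inj_iff (hi := hi') (hj := hj')).1 ?_
  simpa [exponent, List.getD_eq_getElem?_getD, hi, hj] using h

theorem mem_support_iff (a : ℤ × ℤ) :
    a ∈ T.poly.support ↔ ∃ i < T.points.length, T.exponent i = a := by
  simp only [poly, ofPoints, List.mem_toFinset, List.mem_map]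
  constructor
  · rintro ⟨x, hx, rfl⟩
    obtain ⟨i, hi, rfl⟩ := List.mem_iff_getElem.1 hx
    exact ⟨i, hi, by simp [exponent, List.getD_eq_getElem?_getD, hi]⟩
  · rintro ⟨i, hi, rfl⟩
    exact ⟨T.points[i], List.getElem_mem _, by simp [exponent, List.getD_eq_getElem?_getD, hi]⟩

theorem coeff_exponent (hT : (T.points.map Prod.fst).Nodup) {i : ℕ} (hi : i < T.points.length) :
    T.poly.coeff (T.exponent i) = T.height i := by
  have hx : T.points.getD i ((0, 0), 0) = T.points[i] := by
    simp [List.getD_eq_getElem?_getD, hi]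
  have hfind : T.points.find? (fun x => x.1 == T.exponent i) = some T.points[i] := by
    rcases hf : T.points.find? (fun x => x.1 == T.exponent i) with _ | y
    · rw [List.find?_eq_none] at hf
      exact absurd (by simp [exponent, List.getD_eq_getElem?_getD, hi]) (hf T.points[i] (List.getElem_mem _))
    · have hy := List.mem_of_find?_eq_some hf
      have hy' := List.find?_some hf
      obtain ⟨j, hj, rfl⟩ := List.mem_iff_getElem.1 hy
      have : j = i := exponent_injOn hT hj hi (by
        simpa [exponent, List.getD_eq_getElem?_getD, hj] using hy')
      subst this
      exact hf
  simp only [poly, ofPoints, hfind, Option.elim_some, height, hx]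

theorem monomialValue_pos (hT : (T.points.map Prod.fst).Nodup) {i : ℕ} (hi : i < T.points.length)
    (t : ℕ × ℕ × ℕ) :
    T.poly.monomialValue (T.exponent i) (T.pos t) = (T.value i (T.dual t) : ℝ) := by
  simp only [monomialValue, coeff_exponent hT hi, pos, value]
  push_cast
  ring


structure IsCell (T : TriangleList) (t : ℕ × ℕ × ℕ) : Prop where
  lt_length : ∀ i ∈ corners t, i < T.points.length
  area_eq : |T.area t.1 t.2.1 t.2.2| = 1
  eq_value : ∀ i < T.points.length, i ∈ corners t → T.value i (T.dual t) = T.value t.1 (T.dual t)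
  lt_value : ∀ i < T.points.length, i ∉ corners t → T.value t.1 (T.dual t) < T.value i (T.dual t)

theorem isCell_of_checkCell {t : ℕ × ℕ × ℕ} (h : T.checkCell t = true) : T.IsCell t := by
  simp only [checkCell, Bool.and_eq_true, List.all_eq_true, decide_eq_true_eq, beq_iff_eq,
    List.mem_range, List.contains_iff_mem] at h
  obtain ⟨⟨h1, h2⟩, h3⟩ := h
  refine ⟨h1, by rw [Int.abs_eq_natAbs, h2]; rfl, fun i hi hit => ?_, fun i hi hit => ?_⟩
  · have := h3 i hi
    rw [if_pos hit] at this
    simpa using this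
  · have := h3 i hi
    rw [if_neg hit] at this
    simpa using this

theorem fst_mem_corners (t : ℕ × ℕ × ℕ) : t.1 ∈ corners t := by simp [corners]

namespace IsCell

variable {t u : ℕ × ℕ × ℕ}

theorem mem_cell_iff (h : T.IsCell t) (hT : (T.points.map Prod.fst).Nodup) {i : ℕ}
    (hi : i < T.points.length) : T.exponent i ∈ T.poly.cell (T.pos t) ↔ i ∈ corners t := by
  have h0 := h.lt_length _ (fst_mem_corners t)
  constructor
  · rintro ⟨-, hmin⟩
    by_contra hit
    have h1 := h.lt_value i hi hit
    have h2 := hmin (T.exponent t.1) ((mem_support_iff _).2 ⟨_, h0, rfl⟩)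
    rw [monomialValue_pos hT hi, monomialValue_pos hT h0, Int.cast_le] at h2
    omega
  · intro hit
    refine ⟨(mem_support_iff _).2 ⟨_, hi, rfl⟩, fun b hb => ?_⟩
    obtain ⟨j, hj, rfl⟩ := (mem_support_iff _).1 hb
    rw [monomialValue_pos hT hi, monomialValue_pos hT hj, Int.cast_le, h.eq_value i hi hit]
    by_cases hjt : j ∈ corners t
    · rw [h.eq_value j hj hjt]
    · exact (h.lt_value j hj hjt).le

theorem cell_eq (h : T.IsCell t) (hT : (T.points.map Prod.fst).Nodup) :
    T.poly.cell (T.pos t) = {T.exponent t.1, T.exponent t.2.1, T.exponent t.2.2} := by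
  ext a
  constructor
  · intro ha
    obtain ⟨i, hi, rfl⟩ := (mem_support_iff _).1 ha.1
    have := (h.mem_cell_iff hT hi).1 ha
    simp only [corners, List.mem_cons, List.not_mem_nil, or_false] at this
    rcases this with rfl | rfl | rfl <;> simp
  · have key : ∀ i ∈ corners t, T.exponent i ∈ T.poly.cell (T.pos t) := fun i hi =>
      (h.mem_cell_iff hT (h.lt_length i hi)).2 hi
    rintro (rfl | rfl | rfl) <;> exact key _ (by simp [corners])

theorem isUnimodularAt (h : T.IsCell t) (hT : (T.points.map Prod.fst).Nodup) :
    T.poly.IsUnimodularAt (T.pos t) := ⟨_, _, _, h.cell_eq hT, h.area_eq⟩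

theorem pos_eq_of_subset (h : T.IsCell t) (h' : T.IsCell u) (hT : (T.points.map Prod.fst).Nodup)
    (hs : ∀ i ∈ corners t, i ∈ corners u) : T.pos t = T.pos u := by
  have key : ∀ i ∈ corners t, T.exponent i ∈ T.poly.cell (T.pos t) ∧
      T.exponent i ∈ T.poly.cell (T.pos u) := fun i hi =>
    ⟨(h.mem_cell_iff hT (h.lt_length i hi)).2 hi, (h'.mem_cell_iff hT (h.lt_length i hi)).2 (hs i hi)⟩
  have k1 := key t.1 (by simp [corners])
  have k2 := key t.2.1 (by simp [corners])
  have k3 := key t.2.2 (by simp [corners])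
  refine eq_of_mem_cells (f := T.poly) (a := T.exponent t.1) (b := T.exponent t.2.1)
    (c := T.exponent t.2.2) ?_ k1.1 k2.1 k3.1 k1.2 k2.2 k3.2
  intro h0
  have := h.area_eq
  rw [area, h0] at this
  simp at this

theorem subset_of_pos_eq (h : T.IsCell t) (h' : T.IsCell u) (hT : (T.points.map Prod.fst).Nodup)
    (hp : T.pos t = T.pos u) : ∀ i ∈ corners t, i ∈ corners u := fun i hi => by
  have hi' := h.lt_length i hi
  rw [← h'.mem_cell_iff hT hi', ← hp, h.mem_cell_iff hT hi']
  exact hi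

theorem ne (h : T.IsCell t) : t.1 ≠ t.2.1 ∧ t.1 ≠ t.2.2 ∧ t.2.1 ≠ t.2.2 := by
  have := h.area_eq
  refine ⟨fun he => ?_, fun he => ?_, fun he => ?_⟩ <;> rw [he] at this <;>
    simp [area, doubleArea, mul_comm] at this

theorem curveGraph_adj_iff (h : T.IsCell t) (h' : T.IsCell u) (hT : (T.points.map Prod.fst).Nodup) :
    T.poly.curveGraph.Adj (T.pos t) (T.pos u) ↔ adj t u = true := by
  obtain ⟨n1, n2, n3⟩ := h.ne
  have h1 := h.lt_length t.1 (by simp [corners])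
  have h2 := h.lt_length t.2.1 (by simp [corners])
  have h3 := h.lt_length t.2.2 (by simp [corners])
  have m1 : T.exponent t.1 ≠ T.exponent t.2.1 := fun he => n1 (exponent_injOn hT h1 h2 he)
  have m2 : T.exponent t.1 ≠ T.exponent t.2.2 := fun he => n2 (exponent_injOn hT h1 h3 he)
  have m3 : T.exponent t.2.1 ≠ T.exponent t.2.2 := fun he => n3 (exponent_injOn hT h2 h3 he)
  have hcell : T.poly.cell (T.pos t) ∩ T.poly.cell (T.pos u) =
      {a | (a = T.exponent t.1 ∧ t.1 ∈ corners u) ∨ (a = T.exponent t.2.1 ∧ t.2.1 ∈ corners u) ∨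
        (a = T.exponent t.2.2 ∧ t.2.2 ∈ corners u)} := by
    ext a
    rw [Set.mem_inter_iff, h.cell_eq hT]
    simp only [Set.mem_insert_iff, Set.mem_singleton_iff, Set.mem_ofPred_eq, or_and_right,
      ← h'.mem_cell_iff hT h1, ← h'.mem_cell_iff hT h2, ← h'.mem_cell_iff hT h3]
    refine or_congr ?_ (or_congr ?_ ?_) <;> exact and_congr_right fun he => by rw [he]
  have hpos : (t.1 ∈ corners u ∧ t.2.1 ∈ corners u ∧ t.2.2 ∈ corners u) ↔ T.pos t = T.pos u := by
    constructor
    · rintro ⟨k1, k2, k3⟩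
      refine h.pos_eq_of_subset h' hT ?_
      simp only [corners, List.mem_cons, List.not_mem_nil, or_false] at k1 k2 k3 ⊢
      rintro i (rfl | rfl | rfl) <;> assumption
    · intro he
      have := h.subset_of_pos_eq h' hT he
      exact ⟨this _ (by simp [corners]), this _ (by simp [corners]), this _ (by simp [corners])⟩
  have hadj : T.poly.curveGraph.Adj (T.pos t) (T.pos u) ↔
      ¬ (t.1 ∈ corners u ∧ t.2.1 ∈ corners u ∧ t.2.2 ∈ corners u) ∧
        (T.poly.cell (T.pos t) ∩ T.poly.cell (T.pos u)).Nontrivial := by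
    rw [hpos]
    exact ⟨fun h => ⟨h.1, h.2.2.2⟩, fun k =>
      ⟨k.1, (h.isUnimodularAt hT).mem_curveVertices, (h'.isUnimodularAt hT).mem_curveVertices, k.2⟩⟩
  rw [hadj, hcell, adj]
  simp only [corners, List.filter_cons, List.filter_nil, List.contains_iff_mem, Set.Nontrivial,
    Set.mem_ofPred_eq]
  generalize [u.1, u.2.1, u.2.2] = l
  by_cases c1 : t.1 ∈ l <;> by_cases c2 : t.2.1 ∈ l <;> by_cases c3 : t.2.2 ∈ l <;>
    simp [c1, c2, c3, m1, m2, m3]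

end IsCell

structure IsValid (T : TriangleList) : Prop where
  nodup_points : (T.points.map Prod.fst).Nodup
  ne_nil : T.triangles ≠ []
  isCell : ∀ t ∈ T.triangles, T.IsCell t
  sides : ∀ t ∈ T.triangles, ∀ i ∈ corners t, ∀ j ∈ corners t, ∀ k ∈ corners t, T.area i j k = 1 →
    (∃ u ∈ T.triangles, i ∈ corners u ∧ j ∈ corners u ∧ k ∉ corners u) ∨
      ∀ l < T.points.length, 0 ≤ T.area i j l
  pairwise : T.triangles.Pairwise fun t u => ¬ ∀ i ∈ corners t, i ∈ corners u

theorem isValid_of_check (h : T.check = true) : T.IsValid := by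
  simp only [check, Bool.and_eq_true, List.all_eq_true, decide_eq_true_eq] at h
  obtain ⟨⟨⟨⟨h1, h2⟩, h3⟩, h4⟩, h5⟩ := h
  refine ⟨h1, by simpa using h2, fun t ht => isCell_of_checkCell (h3 t ht), ?_, ?_⟩
  · intro t ht i hi j hj k hk ha
    have := h4 t ht
    simp only [checkSides, List.all_eq_true, Bool.or_eq_true, bne_iff_ne, List.any_eq_true,
      Bool.and_eq_true, Bool.not_eq_true', List.contains_iff_mem, List.mem_range,
      decide_eq_true_eq] at this
    rcases this i hi j hj k hk with (h | ⟨u, hu, ⟨h6, h7⟩, h8⟩) | h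
    · exact absurd ha h
    · refine Or.inl ⟨u, hu, h6, h7, ?_⟩
      simpa using h8
    · exact Or.inr h
  · refine h5.imp fun {t u} htu hall => ?_
    rw [List.all_eq_false] at htu
    obtain ⟨i, hi, hiu⟩ := htu
    exact hiu (by simpa using hall i hi)

namespace IsValid

/-- The condition `sides` makes the list closed under passing to the other end of a bounded edge, so
the simplex method shows that no vertex is missing. -/
theorem curveVertices_eq (h : T.IsValid) : T.poly.curveVertices = {x | ∃ t ∈ T.triangles, T.pos t = x} := by
  have hT := h.nodup_points
  refine subset_antisymm (curveVertices_subset_of_closed ?_ ?_ ?_ ?_) ?_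
  · exact (T.triangles.finite_toSet.image T.pos).subset (by rintro x ⟨t, ht, rfl⟩; exact ⟨t, ht, rfl⟩)
  · obtain ⟨t, ht⟩ := List.exists_mem_of_ne_nil _ h.ne_nil
    exact ⟨_, t, ht, rfl⟩
  · rintro x ⟨t, ht, rfl⟩
    exact (h.isCell t ht).isUnimodularAt hT
  · rintro x ⟨t, ht, rfl⟩ a b c e habc he h1 hneg
    have hcell := h.isCell t ht
    have hmem : ∀ a ∈ T.poly.cell (T.pos t), ∃ i ∈ corners t, T.exponent i = a := by
      intro a ha
      obtain ⟨i, hi, rfl⟩ := (mem_support_iff _).1 ha.1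
      exact ⟨i, (hcell.mem_cell_iff hT hi).1 ha, rfl⟩
    obtain ⟨i, hi, rfl⟩ := hmem a (by rw [habc]; simp)
    obtain ⟨j, hj, rfl⟩ := hmem b (by rw [habc]; simp)
    obtain ⟨k, hk, rfl⟩ := hmem c (by rw [habc]; simp)
    obtain ⟨l, hl, rfl⟩ := (mem_support_iff _).1 he
    rcases h.sides t ht i hi j hj k hk h1 with ⟨u, hu, hiu, hju, hku⟩ | hall
    · have hcell' := h.isCell u hu
      refine ⟨T.pos u, ⟨u, hu, rfl⟩, fun heq => hku ?_,
        (hcell'.mem_cell_iff hT (hcell'.lt_length i hiu)).2 hiu,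
        (hcell'.mem_cell_iff hT (hcell'.lt_length j hju)).2 hju⟩
      exact hcell.subset_of_pos_eq hcell' hT heq.symm k hk
    · exact absurd (hall l hl) (not_le.2 hneg)
  · rintro x ⟨t, ht, rfl⟩
    exact ((h.isCell t ht).isUnimodularAt hT).mem_curveVertices

theorem isSmooth (h : T.IsValid) : T.poly.IsSmooth := by
  have hT := h.nodup_points
  constructor
  · obtain ⟨t, ht⟩ := List.exists_mem_of_ne_nil _ h.ne_nil
    have hcell := h.isCell t ht
    have hm : ∀ i ∈ corners t, T.exponent i ∈ (T.poly.support : Set (ℤ × ℤ)) := fun i hi =>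
      (mem_support_iff _).2 ⟨i, hcell.lt_length i hi, rfl⟩
    refine ⟨_, hm t.1 (by simp [corners]), _, hm t.2.1 (by simp [corners]), _,
      hm t.2.2 (by simp [corners]), fun h0 => ?_⟩
    have := hcell.area_eq
    rw [area, h0] at this
    simp at this
  · intro x hx
    rw [h.curveVertices_eq] at hx
    obtain ⟨t, ht, rfl⟩ := hx
    exact (h.isCell t ht).isUnimodularAt hT

theorem isGraphModel (h : T.IsValid) :
    T.poly.IsGraphModel T.triangles T.pos adj T.poly.curveVertices := by
  have hT := h.nodup_points
  refine ⟨?_, ?_, ?_, fun t ht u hu => (h.isCell t ht).curveGraph_adj_iff (h.isCell u hu) hT⟩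
  · refine h.pairwise.imp fun {t u} hn he => hn ?_
    rw [he]
    exact fun _ hi => hi
  · intro t ht u hu he
    by_contra hne
    have hsym : Std.Symm fun t u => ¬ ((∀ i ∈ corners t, i ∈ corners u) ∧
      ∀ i ∈ corners u, i ∈ corners t) := ⟨fun a b hab hba => hab ⟨hba.2, hba.1⟩⟩
    have hp : T.triangles.Pairwise fun t u => ¬ ((∀ i ∈ corners t, i ∈ corners u) ∧
      ∀ i ∈ corners u, i ∈ corners t) := h.pairwise.imp fun hn hn' => hn hn'.1
    exact hp.forall ht hu hne
      ⟨(h.isCell t ht).subset_of_pos_eq (h.isCell u hu) hT he,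
        (h.isCell u hu).subset_of_pos_eq (h.isCell t ht) hT he.symm⟩
  · intro x
    rw [h.curveVertices_eq]
    rfl

end IsValid

end TriangleList

/-! ### Curves with prism skeleton for `3 ≤ n ≤ 10` -/

open TropicalPolynomial TriangleList

/-- The edges of the prism graph: the two copies of the long cycle, and the rungs. -/
def prismEdgeSource {n : ℕ} (e : Fin n × Fin 3) : Fin n × Fin 2 := (e.1, if e.2 = 1 then 1 else 0)

def prismEdgeTarget {n : ℕ} [NeZero n] (e : Fin n × Fin 3) : Fin n × Fin 2 :=
  (if e.2 = 2 then e.1 else e.1 + 1, if e.2 = 0 then 0 else 1)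

theorem prismGraph_adj_iff_exists {m : ℕ} (v w : Fin (m + 3) × Fin 2) :
    (prismGraph (m + 3)).Adj v w ↔
      ∃ e : Fin (m + 3) × Fin 3, s(prismEdgeSource e, prismEdgeTarget e) = s(v, w) := by
  obtain ⟨i, j⟩ := v
  obtain ⟨k, l⟩ := w
  rw [prismGraph, SimpleGraph.boxProd_adj]
  simp only [SimpleGraph.cycleGraph_adj, SimpleGraph.completeGraph_eq_top, SimpleGraph.top_adj,
    sub_eq_iff_eq_add, add_comm (1 : Fin (m + 3))]
  constructor
  · rintro (⟨rfl | rfl, rfl⟩ | ⟨hj, rfl⟩)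
    · refine ⟨(k, if j = 0 then 0 else 1), ?_⟩
      fin_cases j <;> simp [prismEdgeSource, prismEdgeTarget]
    · refine ⟨(i, if j = 0 then 0 else 1), ?_⟩
      fin_cases j <;> simp [prismEdgeSource, prismEdgeTarget]
    · refine ⟨(i, 2), ?_⟩
      fin_cases j <;> fin_cases l <;> simp [prismEdgeSource, prismEdgeTarget] at hj ⊢
  · rintro ⟨⟨a, b⟩, h⟩
    rw [Sym2.eq_iff] at h
    fin_cases b <;> simp [prismEdgeSource, prismEdgeTarget] at h <;>
      obtain (⟨⟨rfl, rfl⟩, rfl, rfl⟩ | ⟨⟨rfl, rfl⟩, rfl, rfl⟩) := h <;> simp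

/-- Since the cycle has length at least 3, the edge from `i` to `i + 1` cannot also be the edge from
`i + 1` to `i`. -/
theorem prismEdge_injective {m : ℕ} (e e' : Fin (m + 3) × Fin 3)
    (h : s(prismEdgeSource e, prismEdgeTarget e) = s(prismEdgeSource e', prismEdgeTarget e')) :
    e = e' := by
  obtain ⟨i, j⟩ := e
  obtain ⟨k, l⟩ := e'
  have h1 : (1 : Fin (m + 3)) ≠ 0 := by simp
  have h2 : (1 + 1 : Fin (m + 3)) ≠ 0 := by
    intro h
    have := congrArg Fin.val h
    simp [Fin.val_add, Nat.mod_eq_of_lt (show 2 < m + 3 by omega)] at this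
  have h3 : ¬ (i = k + 1 ∧ i + 1 = k) := by
    rintro ⟨rfl, h⟩
    rw [add_assoc, add_eq_left] at h
    exact h2 h
  fin_cases j <;> fin_cases l <;> simp [prismEdgeSource, prismEdgeTarget] at h ⊢
  · exact h.resolve_right h3
  · exact h.resolve_right h3
  · exact h

/-- A triangulation whose interior points are a point with index `0` and the points with indices
`1, …, n` around it, and each of whose triangles has an interior point as a corner. The `i`-th block
lists the boundary points that are joined to the end of the `i`-th edge of the interior polygon, from
the third corner of the outer triangle at this edge to that at the next one. -/
structure PrismData (n : ℕ) where
  points : List ((ℤ × ℤ) × ℤ)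
  blocks : List (List ℕ)

namespace PrismData

variable {n : ℕ} (D : PrismData n)

/-- The triangles at the edge with index `i` and at its end that lie outside of the interior
polygon. -/
def strip (i : ℕ) : List (ℕ × ℕ × ℕ) :=
  let l := D.blocks.getD (i % n) []
  (i % n + 1, (i + 1) % n + 1, l.headD 0) ::
    List.zipWith (fun b b' => ((i + 1) % n + 1, b, b')) l l.tail

def vertex (v : Fin n × Fin 2) : ℕ × ℕ × ℕ :=
  if v.2 = 0 then (0, v.1 % n + 1, (v.1 + 1) % n + 1) else (D.strip v.1).headD (0, 0, 0)

def triangles : List (ℕ × ℕ × ℕ) :=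
  (List.finRange n).map (fun i => D.vertex (i, 0)) ++ (List.finRange n).flatMap (D.strip ·)

def toTriangleList : TriangleList := ⟨D.points, D.triangles⟩

def degree (t : ℕ × ℕ × ℕ) : ℕ := (D.triangles.filter (adj t)).length

section

variable [NeZero n]

/-- Only the edges of the outer cycle are subdivided, by the triangles that a corner of the interior
polygon forms with consecutive boundary points. -/
def chain (e : Fin n × Fin 3) : List (ℕ × ℕ × ℕ) :=
  if e.2 = 1 then D.strip e.1 ++ [D.vertex (prismEdgeTarget e)]
  else [D.vertex (prismEdgeSource e), D.vertex (prismEdgeTarget e)]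

def checkChain (e : Fin n × Fin 3) : Bool :=
  let l := D.chain e
  decide l.Nodup && decide (2 ≤ l.length) && l.head? == some (D.vertex (prismEdgeSource e)) &&
    l.getLast? == some (D.vertex (prismEdgeTarget e)) &&
    l.tail.dropLast.all (fun t => D.degree t == 2) && l.all (D.triangles.contains ·) &&
    decide (l.IsChain fun t u => adj t u = true)

def edgeList : List (Fin n × Fin 3) := (List.finRange n).product (List.finRange 3)

def vertexList : List (Fin n × Fin 2) := (List.finRange n).product (List.finRange 2)

def edges : List (Sym2 (ℕ × ℕ × ℕ)) :=
  edgeList.flatMap fun e => List.zipWith (fun t u => s(t, u)) (D.chain e) (D.chain e).tail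

def check : Bool :=
  D.toTriangleList.check && decide ((vertexList (n := n)).map D.vertex).Nodup &&
    D.triangles.all (fun t => D.degree t != 1) &&
    (vertexList (n := n)).all (fun v => D.triangles.contains (D.vertex v) &&
      D.degree (D.vertex v) != 2) &&
    D.triangles.all (fun t =>
      D.degree t == 2 || (vertexList (n := n)).any fun v => D.vertex v == t) &&
    (edgeList (n := n)).all D.checkChain &&
    D.triangles.all fun t => D.triangles.all fun u => !(adj t u) || D.edges.contains s(t, u)

end

/-- No triangle has a single neighbour, so nothing is pruned. The triangles of degree other than two
are the vertices of the prism, and the chains between them cover all adjacent pairs. -/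
theorem tropicallyPlanar {m : ℕ} (D : PrismData (m + 3)) (h : D.check = true) :
    TropicallyPlanar (prismGraph (m + 3)) := by
  have hve : ∀ v : Fin (m + 3) × Fin 2, v ∈ vertexList (n := m + 3) := fun v =>
    List.mem_product.2 ⟨List.mem_finRange _, List.mem_finRange _⟩
  have hed : ∀ e : Fin (m + 3) × Fin 3, e ∈ edgeList (n := m + 3) := fun e =>
    List.mem_product.2 ⟨List.mem_finRange _, List.mem_finRange _⟩
  simp only [check, Bool.and_eq_true, List.all_eq_true, decide_eq_true_eq] at h
  obtain ⟨⟨⟨⟨⟨⟨h1, h2⟩, h3⟩, h4⟩, h5⟩, h6⟩, h7⟩ := h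
  set T := D.toTriangleList with hT
  have hvalid : T.IsValid := isValid_of_check h1
  have hcore : T.poly.IsGraphModel D.triangles T.pos adj T.poly.coreVertices :=
    hvalid.isGraphModel.core fun t ht => bne_iff_ne.1 (h3 t ht)
  have hvert : ∀ v, D.vertex v ∈ D.triangles ∧ D.degree (D.vertex v) ≠ 2 := fun v => by
    simpa using h4 v (hve v)
  have hinj : Function.Injective D.vertex := fun v w hvw =>
    List.inj_on_of_nodup_map h2 (hve v) (hve w) hvw
  have hskel : ∀ x, x ∈ T.poly.skeletonVertices ↔ ∃ v, T.pos (D.vertex v) = x := by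
    intro x
    rw [hcore.mem_skeletonVertices_iff]
    simp only [List.mem_filter]
    constructor
    · rintro ⟨t, ⟨ht, hd⟩, rfl⟩
      have h5t := h5 t ht
      simp only [Bool.or_eq_true, beq_iff_eq, List.any_eq_true] at h5t
      obtain ⟨v, -, rfl⟩ := h5t.resolve_left (by simpa [degree] using hd)
      exact ⟨v, rfl⟩
    · rintro ⟨v, rfl⟩
      exact ⟨_, ⟨(hvert v).1, by simpa [degree] using (hvert v).2⟩, rfl⟩
  refine ⟨T.poly, hvalid.isSmooth, (isSubdivision_of_edges (σ := fun v => T.pos (D.vertex v))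
    (c := fun e => {d | d ∈ List.zipWith (fun x y => s(x, y)) ((D.chain e).map T.pos)
      ((D.chain e).map T.pos).tail}) prismGraph_adj_iff_exists prismEdge_injective
    (fun v w hvw => hinj (hcore.injOn _ (hvert v).1 _ (hvert w).1 hvw)) ?_ ?_ ?_).hasSkeleton⟩
  · ext x
    rw [hskel]
    rfl
  · intro e
    have he := h6 e (hed e)
    simp only [checkChain, Bool.and_eq_true, decide_eq_true_eq, beq_iff_eq, List.all_eq_true,
      List.contains_iff_mem] at he
    obtain ⟨⟨⟨⟨⟨⟨e1, e2⟩, e3⟩, e4⟩, e5⟩, e6⟩, e7⟩ := he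
    refine isChain_of_list ((hskel _).2 ⟨_, rfl⟩) ((hskel _).2 ⟨_, rfl⟩) ?_ ?_ ?_ ?_ ?_ ?_
    · rw [List.isChain_map]
      refine List.IsChain.imp_of_mem_imp (fun t u ht hu htu => ?_) e7
      exact (hcore.coreGraph_adj (e6 t ht) (e6 u hu)).2 htu
    · exact List.Nodup.map_on (fun t ht u hu => hcore.injOn t (e6 t ht) u (e6 u hu)) e1
    · simpa using e2
    · simp [e3]
    · simp [e4]
    · intro w hw
      rw [← List.map_tail, ← List.map_dropLast] at hw
      obtain ⟨t, ht, rfl⟩ := List.mem_map.1 hw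
      exact (hcore.isTwoValent_iff (e6 t (List.mem_of_mem_tail (List.mem_of_mem_dropLast ht)))).2
        (e5 t ht)
  · intro x y hxy
    obtain ⟨t, ht, rfl⟩ := (hcore.mem_iff x).1 hxy.1
    obtain ⟨u, hu, rfl⟩ := (hcore.mem_iff y).1 hxy.2.1
    have h7' := h7 t ht u hu
    rw [(hcore.coreGraph_adj ht hu).1 hxy] at h7'
    simp only [Bool.not_true, Bool.false_or, List.contains_iff_mem, edges, List.mem_flatMap] at h7'
    obtain ⟨e, -, he⟩ := h7'
    refine ⟨e, ?_⟩
    rw [Set.mem_ofPred_eq, ← List.map_tail, List.zipWith_map]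
    have := List.mem_map_of_mem (f := Sym2.map T.pos) he
    rw [List.map_zipWith] at this
    exact this

end PrismData

/-- Plane curves whose skeleton is a prism graph, one for each of the possible lengths. -/
theorem tropicallyPlanar_prismGraph {n : ℕ} (hn : 3 ≤ n) (hn' : n ≤ 10) :
    TropicallyPlanar (prismGraph n) := by
  interval_cases n
  · exact PrismData.tropicallyPlanar (m := 0) ⟨
      [((0, 0), 1), ((1, 0), 2), ((0, 1), 2), ((-1, -1), 0), ((-2, -2), 7), ((0, -1), 2),
        ((2, 0), 5), ((1, 1), 4), ((0, 2), 7), ((-1, 0), 4)],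
      [[7, 8, 9], [9, 4, 5], [5, 6, 7]]⟩
      (by decide +kernel)
  · exact PrismData.tropicallyPlanar (m := 1) ⟨
      [((0, 0), 0), ((1, 0), 2), ((0, 1), 2), ((-1, 0), 1), ((-1, -1), 2), ((-2, -1), 6),
        ((-2, -2), 8), ((0, -1), 6), ((2, 0), 9), ((1, 1), 5), ((0, 2), 8)],
      [[9, 10], [10, 5], [5, 6, 7], [7, 8, 9]]⟩
      (by decide +kernel)
  · exact PrismData.tropicallyPlanar (m := 2) ⟨
      [((0, 0), 0), ((1, 0), 2), ((0, 1), 2), ((-1, 0), 3), ((-1, -1), 3), ((0, -1), 3),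
        ((-2, -1), 8), ((-1, -2), 8), ((2, 0), 7), ((1, 1), 5), ((0, 2), 7)],
      [[9, 10], [10, 6], [6, 7], [7, 8], [8, 9]]⟩
      (by decide +kernel)
  · exact PrismData.tropicallyPlanar (m := 3) ⟨
      [((0, 0), 0), ((1, 0), 3), ((0, 1), 5), ((-1, 1), 3), ((-1, 0), 1), ((-2, -1), 4),
        ((-1, -1), 4), ((-3, -2), 10), ((2, 0), 9), ((-1, 2), 9), ((-2, 0), 4)],
      [[8, 9], [9, 10], [10], [10, 7], [7, 8], [8]]⟩
      (by decide +kernel)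
  · exact PrismData.tropicallyPlanar (m := 4) ⟨
      [((0, 0), 0), ((1, 0), 6), ((0, 1), 7), ((-1, 0), 5), ((-2, -1), 7), ((-1, -1), 4),
        ((-1, -2), 8), ((0, -1), 5), ((-3, -1), 18), ((-2, -2), 10), ((-1, -3), 18),
        ((0, -2), 14), ((1, -1), 14), ((2, 0), 17), ((1, 1), 14), ((0, 2), 18), ((-1, 1), 13),
        ((-2, 0), 14)],
      [[14, 15, 16], [16, 17], [17, 8, 9], [9], [9, 10, 11], [11, 12], [12, 13, 14]]⟩
      (by decide +kernel)
  · exact PrismData.tropicallyPlanar (m := 5) ⟨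
      [((0, 0), 0), ((1, 0), 10), ((0, 1), 10), ((-1, 1), 8), ((-1, 0), 6), ((0, -1), 3),
        ((1, -2), 3), ((2, -3), 4), ((1, -1), 2), ((1, -3), 7), ((2, -4), 11), ((3, -5), 21),
        ((2, -2), 9), ((1, 1), 21), ((-2, 2), 20), ((-2, 1), 15)],
      [[13, 14], [14, 15], [15, 9], [9], [9], [9, 10, 11, 12], [12], [12, 13]]⟩
      (by decide +kernel)
  · exact PrismData.tropicallyPlanar (m := 6) ⟨
      [((0, 0), 0), ((1, 0), 11), ((0, 1), 11), ((-1, 1), 9), ((-2, 1), 12), ((-1, 0), 6),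
        ((0, -1), 3), ((1, -2), 2), ((2, -3), 4), ((1, -1), 4), ((0, -2), 7), ((1, -3), 8),
        ((2, -4), 12), ((3, -5), 22), ((2, -2), 9), ((1, 1), 23), ((-1, 2), 22), ((-2, 2), 21),
        ((-3, 2), 25)],
      [[15, 16], [16, 17], [17, 18, 10], [10], [10], [10, 11], [11, 12, 13, 14], [14], [14, 15]]⟩
      (by decide +kernel)
  · exact PrismData.tropicallyPlanar (m := 7) ⟨
      [((0, 0), 0), ((1, 0), 18), ((0, 1), 17), ((-1, 1), 10), ((-3, 2), 16), ((-2, 1), 9),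
        ((-1, 0), 5), ((0, -1), 5), ((1, -2), 9), ((2, -3), 15), ((1, -1), 9), ((-1, -1), 11),
        ((0, -2), 13), ((1, -3), 18), ((2, -4), 27), ((3, -5), 39), ((2, -2), 21), ((1, 1), 37),
        ((-2, 2), 22), ((-5, 3), 38), ((-4, 2), 27), ((-3, 1), 18), ((-2, 0), 12)],
      [[17, 18], [18], [18, 19, 20, 21], [21, 22], [22, 11], [11, 12], [12, 13], [13, 14, 15, 16],
        [16], [16, 17]]⟩
      (by decide +kernel)

/-! ### Conclusion -/

namespace TropicalPolynomial

theorem HasSkeleton.exists_isStar {f : TropicalPolynomial} {m : ℕ} (hf : f.IsSmooth)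
    (hs : f.HasSkeleton (prismGraph (m + 4))) (hm : 1 ≤ m) :
    ∃ (p : ℤ × ℤ) (w : Fin (m + 4) → ℤ × ℤ), f.IsStar p w := by
  obtain ⟨hsimple, ⟨φ⟩⟩ := hs
  obtain ⟨j₀, α, h⟩ := hf.exists_isPrismLabelling hsimple φ
  rcases hj : j₀ with i | j
  · exact absurd hj (h.ne_inl hf hm i)
  · exact h.exists_isStar hf hj

theorem HasSkeleton.inheritsStandardEmbedding {f : TropicalPolynomial} {m : ℕ} (hf : f.IsSmooth)
    (hs : f.HasSkeleton (prismGraph (m + 4))) : InheritsStandardEmbedding f (m + 4) := by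
  obtain ⟨hsimple, ⟨φ⟩⟩ := hs
  obtain ⟨j₀, α, h⟩ := hf.exists_isPrismLabelling hsimple φ
  obtain ⟨ψ, τ, hψ, hτ⟩ : ∃ (ψ : prismGraph (m + 4) ≃g prismGraph (m + 4)) (τ : _),
      IsPrismSymmetry ψ τ ∧ τ j₀ = .inr 1 := by
    rcases hj : j₀ with i | j
    -- Only for `n = 4` can a quadrilateral bound the outer face; there a symmetry of the cube moves
    -- it to a copy of the long cycle.
    · rcases Nat.eq_zero_or_pos m with rfl | hm
      · exact exists_isPrismSymmetry_cube i
      · exact absurd hj (h.ne_inl hf hm i)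
    · rcases Fin.exists_fin_two.1 ⟨j, rfl⟩ with rfl | rfl
      · exact exists_isPrismSymmetry_swap
      · exact ⟨_, _, isPrismSymmetry_refl, rfl⟩
  exact h.inheritsStandardEmbedding hf hsimple hψ hτ

end TropicalPolynomial

theorem theorem1p1 (n g : ℕ) (hn : 3 ≤ n) (hg : g = n + 1) :
    (TropicallyPlanar (prismGraph n) ↔ g ≤ 11) ∧
      (5 ≤ g → g ≤ 11 → ∀ f : TropicalPolynomial, f.IsSmooth → f.HasSkeleton (prismGraph n) →
        InheritsStandardEmbedding f n) := by
  subst hg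
  refine ⟨⟨?_, fun h => tropicallyPlanar_prismGraph hn (by omega)⟩, ?_⟩
  · rintro ⟨f, hf, hs⟩
    by_contra hlt
    obtain ⟨m, rfl⟩ := Nat.exists_eq_add_of_le' (show 4 ≤ n by omega)
    obtain ⟨p, w, h⟩ := hs.exists_isStar hf (by omega)
    have := h.lt_eleven hf
    omega
  · intro h5 _ f hf hs
    obtain ⟨m, rfl⟩ := Nat.exists_eq_add_of_le' (show 4 ≤ n by omega)
    exact hs.inheritsStandardEmbedding hf
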